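/- **Setting.** Let $W$ be a standard $d$-dimensional Brownian motion on a probability space, $(\mathcal F_t)$ its augmented filtration, and $T>0$. A market has deterministic càdlàg coefficients $r_t\in\mathbb R$ (interest rate), $\mu_t\in\mathbb R^d$ (appreciation rates) and $\sigma_t\in\mathbb R^{d\times d}$ (volatilities) on $[0,\infty)$, with $\sigma_t$ non-singular for Lebesgue-a.e. $t\ge 0$. Put $\theta_t=\sigma_t^{-1}(\mu_t-r_t\mathbf 1)$ (defined for a.e. $t$), $R_t=\int_0^t r_u\,du$, $\|f\|_t=(\int_0^t|f_u|^2du)^{1/2}$, and assume $\|\theta\|_T<\infty$. A control $\varsigma=(y,vX^{\varsigma})\in\mathcal U$ is given by a deterministic $y:[0,T]\to\mathbb R^d$ with $\|y\|_T<\infty$ and a deterministic $v\ge 0$ with $\int_0^Tv_t\,dt<\infty$. For the initial endowment $x>0$ its wealth process $X^{\varsigma}$ is the continuous strong solution on $[0,T]$ of $$dX_t=X_t\,(r_t-v_t+y_t'\theta_t)\,dt+X_t\,y_t'\,dW_t,\qquad X_0=x,$$ where the stochastic integral is the Itô integral of integrands that are square integrable over $[0,T]\times\Omega$. The corresponding portfolio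 is $\pi_t=(\sigma_t')^{-1}y_t$. With linear utilities, $J(x,\varsigma)=\mathbf E\big(\int_0^Tv_tX^{\varsigma}_t\,dt+X^{\varsigma}_T\big)$. Let $0<\alpha\le 1/2$ and let $z_\alpha$ be the $\alpha$-quantile of the standard normal distribution. Let $\mathrm{VaR}_t(x,\varsigma,\alpha)=xe^{R_t}-\lambda_t$ with $\lambda_t=\inf\{\lambda\ge0:\mathbf P(X^{\varsigma}_t\le\lambda)\ge\alpha\}$, and $\zeta_t(x)=\zeta xe^{R_t}$ for $\zeta\in(0,1)$. Consider the problem $$\max_{\varsigma\in\mathcal U}J(x,\varsigma)\quad\text{subject to}\quad\sup_{0\le t\le T}\frac{\mathrm{VaR}_t(x,\varsigma,\alpha)}{\zeta_t(x)}\le 1 .\tag{P}$$ Let $$\rho^*=\sqrt{(|z_\alpha|-\|\theta\|_T)^2-2\ln(1-\zeta)}-(|z_\alpha|-\|\theta\|_T).$$ **Theorem 3.5.** Assume $r_t\ge0$ for all $t\in[0,T]$ and $$\max\big(0,\,1-e^{z_\alpha^2/2-|z_\alpha|\|\theta\|_T}\big)<\zeta<1 .$$ Then the maximum in (P) is attained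 and equals $x\,e^{\rho^*\|\theta\|_T+R_T}$. 1. If $\|\theta\|_T>0$, then $$y^*_t=\rho^*\frac{\theta_t}{\|\theta\|_T},\qquad v^*_t=0$$ is an optimal control, and every optimal control coincides with it for a.e. $t\in[0,T]$. Its portfolio is $\pi^*_t=\frac{\rho^*}{\|\theta\|_T}(\sigma_t\sigma_t')^{-1}(\mu_t-r_t\mathbf 1)$ for a.e. $t\in[0,T]$, and its wealth process satisfies $$dX^*_t=X^*_t\Big(r_t+\rho^*\frac{|\theta_t|^2}{\|\theta\|_T}\Big)dt+X^*_t\,\rho^*\frac{\theta_t'}{\|\theta\|_T}\,dW_t,\qquad X^*_0=x.$$ 2. If $\|\theta\|_T=0$, then $\rho^*=\sqrt{z_\alpha^2-2\ln(1-\zeta)}-|z_\alpha|$, the maximum in (P) is $x\,e^{R_T}$, and for every deterministic $y^*$ with $\|y^*\|_T\le\rho^*$ the control given by $(y^*,v^*=0)$ is optimal; its wealth process satisfies $dX^*_t=X^*_tr_t\,dt+X^*_t(y^*_t)'dW_t$, $X^*_0=x$. -/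

import Mathlib

open MeasureTheory ProbabilityTheory Filter Set
open scoped NNReal ENNReal Topology Matrix

noncomputable section

/-! ### Deterministic notation -/

/-- Right continuous with left limits on `[0, ∞)`. -/
def IsCadlag {α : Type*} [TopologicalSpace α] (f : ℝ → α) : Prop :=
  (∀ t, 0 ≤ t → ContinuousWithinAt f (Ici t) t) ∧
    ∀ t, 0 < t → ∃ l, Tendsto f (𝓝[<] t) (𝓝 l)

/-- `‖f‖_t = (∫₀ᵗ |f_u|² du)^{1/2}` (used for square integrable `f`). -/
def l2norm {d : ℕ} (f : ℝ → EuclideanSpace ℝ (Fin d)) (t : ℝ) : ℝ :=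
  √(∫ u in (0 : ℝ)..t, ‖f u‖ ^ 2)

/-- The `α`-quantile of the standard normal distribution. -/
def normalQuantile (α : ℝ) : ℝ :=
  sInf {z : ℝ | α ≤ cdf (gaussianReal 0 1) z}

/-! ### The market -/

/-- The coefficients of the market with one bond and `d` stocks: interest rate, appreciation rates
and volatility matrix, deterministic and càdlàg, with `σ_t` non-singular for almost all `t`. -/
structure Market (d : ℕ) where
  r : ℝ → ℝ
  μ : ℝ → EuclideanSpace ℝ (Fin d)
  σ : ℝ → Matrix (Fin d) (Fin d) ℝ
  r_cadlag : IsCadlag r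
  μ_cadlag : IsCadlag μ
  σ_cadlag : IsCadlag σ
  σ_nonsing : ∀ᵐ t ∂(volume.restrict (Ici (0 : ℝ))), IsUnit (σ t).det

namespace Market

variable {d : ℕ} (M : Market d)

/-- The excess return vector `μ_t - r_t 𝟏`. -/
def excess (t : ℝ) : EuclideanSpace ℝ (Fin d) :=
  WithLp.toLp 2 (fun i => M.μ t i - M.r t)

/-- `θ_t = σ_t⁻¹ (μ_t - r_t 𝟏)`. -/
def θ (t : ℝ) : EuclideanSpace ℝ (Fin d) :=
  WithLp.toLp 2 ((M.σ t)⁻¹ *ᵥ (M.excess t).ofLp)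

/-- `R_t = ∫₀ᵗ r_u du`. -/
def R (t : ℝ) : ℝ := ∫ u in (0 : ℝ)..t, M.r u

/-- The portfolio `π_t = (σ_t')⁻¹ y_t` which corresponds to the control `y`. -/
def portfolio (y : ℝ → EuclideanSpace ℝ (Fin d)) (t : ℝ) : EuclideanSpace ℝ (Fin d) :=
  WithLp.toLp 2 (((M.σ t)ᵀ)⁻¹ *ᵥ (y t).ofLp)

end Market

/-! ### Brownian motion and the Itô integral -/

section Ito

variable {Ω : Type*} [MeasurableSpace Ω] {d : ℕ}

/-- A standard `d`-dimensional Brownian motion. -/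
structure IsStandardBrownian (W : ℝ≥0 → Ω → EuclideanSpace ℝ (Fin d)) (P : Measure Ω) : Prop where
  measurable : ∀ t, Measurable (W t)
  coord : ∀ j, IsBrownianReal (fun t ω => W t ω j) P
  indep : iIndepFun (fun j ω (t : ℝ≥0) => W t ω j) P

/-- The σ-algebra `σ{W_s, s ≤ t}`. Measurability with respect to its augmentation by the
`P`-null sets is expressed by `AEStronglyMeasurable[pastSigma W t] · P`. -/
@[reducible]
def pastSigma (W : ℝ≥0 → Ω → EuclideanSpace ℝ (Fin d)) (t : ℝ≥0) : MeasurableSpace Ω :=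
  ⨆ s : {s : ℝ≥0 // s ≤ t}, MeasurableSpace.comap (W s) inferInstance

/-- An elementary integrand `∑_{i < n} ξ_i 1_{(t_i, t_{i+1}]}` with `0 ≤ t_0 ≤ t_1 ≤ …` and each
`ξ_i` square integrable and measurable for the augmented σ-algebra at time `t_i`. -/
structure ElementaryProcess (W : ℝ≥0 → Ω → EuclideanSpace ℝ (Fin d)) (P : Measure Ω) where
  n : ℕ
  time : ℕ → ℝ≥0
  time_mono : Monotone time
  ξ : ℕ → Ω → EuclideanSpace ℝ (Fin d)
  ξ_adapted : ∀ i, AEStronglyMeasurable[pastSigma W (time i)] (ξ i) P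
  ξ_sq : ∀ i, MemLp (ξ i) 2 P

namespace ElementaryProcess

variable {W : ℝ≥0 → Ω → EuclideanSpace ℝ (Fin d)} {P : Measure Ω}

/-- The value of the elementary integrand at time `t`. -/
def val (H : ElementaryProcess W P) (t : ℝ) (ω : Ω) : EuclideanSpace ℝ (Fin d) :=
  ∑ i ∈ Finset.range H.n,
    (Ioc (H.time i : ℝ) (H.time (i + 1) : ℝ)).indicator (fun _ => H.ξ i ω) t

/-- `∫₀ᵗ H' dW = ∑_{i < n} ξ_i' (W_{t ∧ t_{i+1}} - W_{t ∧ t_i})`. -/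
def integral (H : ElementaryProcess W P) (t : ℝ≥0) (ω : Ω) : ℝ :=
  ∑ i ∈ Finset.range H.n,
    inner ℝ (H.ξ i ω) (W (min t (H.time (i + 1))) ω - W (min t (H.time i)) ω)

end ElementaryProcess

/-- `I_t = ∫₀ᵗ H_u' dW_u` for `0 ≤ t ≤ T`, in the sense of Itô: `H ∈ L²([0, T] × Ω)` is the limit
in `L²([0, T] × Ω)` of elementary integrands, and `I_t` is the `L²(P)`-limit of their integrals. -/
def IsItoIntegral (W : ℝ≥0 → Ω → EuclideanSpace ℝ (Fin d)) (P : Measure Ω) (T : ℝ)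
    (H : ℝ → Ω → EuclideanSpace ℝ (Fin d)) (I : ℝ → Ω → ℝ) : Prop :=
  MemLp (fun p : ℝ × Ω => H p.1 p.2) 2 ((volume.restrict (Icc 0 T)).prod P) ∧
  (∀ t ∈ Icc 0 T, MemLp (I t) 2 P) ∧
  ∃ Hn : ℕ → ElementaryProcess W P,
    Tendsto (fun n => eLpNorm (fun p : ℝ × Ω => (Hn n).val p.1 p.2 - H p.1 p.2) 2
      ((volume.restrict (Icc 0 T)).prod P)) atTop (𝓝 0) ∧
    ∀ t ∈ Icc 0 T,
      Tendsto (fun n => eLpNorm (fun ω => (Hn n).integral t.toNNReal ω - I t ω) 2 P) atTop (𝓝 0)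

/-- `X` is a strong solution on `[0, T]`, with continuous paths, of the linear equation
`dX_t = X_t a_t dt + X_t b_t' dW_t`, `X_0 = x`, with deterministic coefficients `a` and `b`. -/
structure SolvesLinearSDE (W : ℝ≥0 → Ω → EuclideanSpace ℝ (Fin d)) (P : Measure Ω) (T x : ℝ)
    (a : ℝ → ℝ) (b : ℝ → EuclideanSpace ℝ (Fin d)) (X : ℝ → Ω → ℝ) : Prop where
  adapted : ∀ t ∈ Icc 0 T, AEStronglyMeasurable[pastSigma W t.toNNReal] (X t) P
  cont : ∀ᵐ ω ∂P, ContinuousOn (fun t => X t ω) (Icc 0 T)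
  init : ∀ᵐ ω ∂P, X 0 ω = x
  drift_integrable : ∀ᵐ ω ∂P, IntegrableOn (fun u => X u ω * a u) (Icc 0 T)
  eqn : ∃ I : ℝ → Ω → ℝ, IsItoIntegral W P T (fun t ω => X t ω • b t) I ∧
    ∀ᵐ ω ∂P, ∀ t ∈ Icc 0 T, X t ω = x + (∫ u in (0 : ℝ)..t, X u ω * a u) + I t ω

end Ito

/-! ### Controls, cost and risk -/

section Control

variable {Ω : Type*} [MeasurableSpace Ω] {d : ℕ}

/-- The deterministic controls: a square integrable `y` and a nonnegative integrable consumption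
rate `v`, where the consumption is `c_t = v_t X_t`. -/
structure IsControl (T : ℝ) (y : ℝ → EuclideanSpace ℝ (Fin d)) (v : ℝ → ℝ) : Prop where
  y_sq : MemLp y 2 (volume.restrict (Icc 0 T))
  v_nonneg : ∀ t ∈ Icc 0 T, 0 ≤ v t
  v_int : IntegrableOn v (Icc 0 T)

/-- `X` is the wealth process of the control `(y, v)` with initial endowment `x`:
`dX_t = X_t (r_t - v_t + y_t' θ_t) dt + X_t y_t' dW_t`, `X_0 = x`. -/
def IsWealth (M : Market d) (W : ℝ≥0 → Ω → EuclideanSpace ℝ (Fin d)) (P : Measure Ω) (T x : ℝ)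
    (y : ℝ → EuclideanSpace ℝ (Fin d)) (v : ℝ → ℝ) (X : ℝ → Ω → ℝ) : Prop :=
  SolvesLinearSDE W P T x (fun t => M.r t - v t + inner ℝ (y t) (M.θ t)) y X

/-- The power utility function `z ↦ z ^ γ`, `z ≥ 0`. -/
def powerUtility (γ z : ℝ) : ℝ := z ^ γ

/-- The cost function `E (∫₀ᵀ U(c_t) dt + h(X_T))` with `c_t = v_t X_t`, `U(z) = z ^ γ₁` and
`h(z) = z ^ γ₂`, an element of `[0, ∞]` (wealth and consumption are nonnegative). -/
def cost (P : Measure Ω) (γ₁ γ₂ T : ℝ) (v : ℝ → ℝ) (X : ℝ → Ω → ℝ) : ℝ≥0∞ :=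
  ∫⁻ ω, ((∫⁻ t in Icc 0 T, ENNReal.ofReal (powerUtility γ₁ (v t * X t ω)))
    + ENNReal.ofReal (powerUtility γ₂ (X T ω))) ∂P

/-- The `α`-quantile `λ_t` of the wealth at time `t`. -/
def wealthQuantile (P : Measure Ω) (α : ℝ) (X : ℝ → Ω → ℝ) (t : ℝ) : ℝ :=
  sInf {l : ℝ | 0 ≤ l ∧ ENNReal.ofReal α ≤ P {ω | X t ω ≤ l}}

/-- `VaR_t = x e^{R_t} - λ_t`. -/
def valueAtRisk (M : Market d) (P : Measure Ω) (x α : ℝ) (X : ℝ → Ω → ℝ) (t : ℝ) : ℝ :=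
  x * Real.exp (M.R t) - wealthQuantile P α X t

/-- The level risk function `ζ_t(x) = ζ x e^{R_t}`. -/
def riskLevel (M : Market d) (x ζ t : ℝ) : ℝ := ζ * x * Real.exp (M.R t)

/-- The constraint `sup_{0 ≤ t ≤ T} VaR_t / ζ_t(x) ≤ 1`. -/
def VaRBound (M : Market d) (P : Measure Ω) (T x α ζ : ℝ) (X : ℝ → Ω → ℝ) : Prop :=
  (⨆ t ∈ Icc 0 T, ((valueAtRisk M P x α X t / riskLevel M x ζ t : ℝ) : EReal)) ≤ 1

/-- The values `J(x, ς)` of the cost function over all controls `ς = (y, v X)` whose wealth process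
`X` satisfies the Value-at-Risk constraint. -/
def costValues (M : Market d) (W : ℝ≥0 → Ω → EuclideanSpace ℝ (Fin d)) (P : Measure Ω)
    (T x α ζ γ₁ γ₂ : ℝ) : Set ℝ≥0∞ :=
  {j | ∃ (y : ℝ → EuclideanSpace ℝ (Fin d)) (v : ℝ → ℝ) (X : ℝ → Ω → ℝ),
    IsControl T y v ∧ IsWealth M W P T x y v X ∧ VaRBound M P T x α ζ X ∧
      j = cost P γ₁ γ₂ T v X}

/-- `(y, v)` is an optimal control for the Value-at-Risk problem: its wealth process exists,
satisfies the constraint, and the cost function attains its maximum there. -/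
structure IsOptimalControl (M : Market d) (W : ℝ≥0 → Ω → EuclideanSpace ℝ (Fin d)) (P : Measure Ω)
    (T x α ζ γ₁ γ₂ : ℝ) (y : ℝ → EuclideanSpace ℝ (Fin d)) (v : ℝ → ℝ) : Prop where
  control : IsControl T y v
  exists_wealth : ∃ X, IsWealth M W P T x y v X
  bound : ∀ X, IsWealth M W P T x y v X → VaRBound M P T x α ζ X
  greatest : ∀ X, IsWealth M W P T x y v X →
    IsGreatest (costValues M W P T x α ζ γ₁ γ₂) (cost P γ₁ γ₂ T v X)

end Control

/-- `ρ*_VaR` in terms of `α`, `ζ` and `n = ‖θ‖_T`. -/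
def rhoVaR (α ζ n : ℝ) : ℝ :=
  √((|normalQuantile α| - n) ^ 2 - 2 * Real.log (1 - ζ)) - (|normalQuantile α| - n)

/-- The control `y*_t = ρ*_VaR θ_t / ‖θ‖_T`. -/
def optimalY {d : ℕ} (M : Market d) (T α ζ : ℝ) (t : ℝ) : EuclideanSpace ℝ (Fin d) :=
  (rhoVaR α ζ (l2norm M.θ T) / l2norm M.θ T) • M.θ t

end

set_option linter.unusedSectionVars false

/-! ### Absolutely continuous functions -/

/-! With deterministic coefficients the wealth is lognormal. Write V_t = ∫₀ᵗ v, S_t = ∫₀ᵗ y'θ and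
n_t = ‖y‖_t. Then X_t = x exp(R_t - V_t + S_t + Z_t - n_t²/2) with Z_t centred Gaussian of variance
n_t². Hence E X_t = x exp(R_t - V_t + S_t), and, since z_α ≤ 0, the α-quantile of X_t is x exp(R_t -
V_t + S_t - n_t²/2 - |z_α| n_t). The problem becomes deterministic, with constraint V_t + n_t²/2 +
|z_α| n_t - S_t ≤ -ln(1-ζ) for all t ≤ T (`IsWealth.varBound_iff`, `IsWealth.cost_eq`).

Upper bound. At t = T, Cauchy–Schwarz S_T ≤ n_T ‖θ‖_T turns the constraint into a quadratic
inequality for n_T with positive root ρ*. So n_T ≤ ρ*, and S_t ≤ ρ*‖θ‖_T for every t by monotonicity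
of the norms. Put c = ρ*‖θ‖_T + R_T. As r ≥ 0, consumption contributes at most x e^c ∫ v e^{-V} = x
e^c (1 - e^{-V_T}), while terminal wealth contributes x e^{-V_T} e^{S_T + R_T}; the sum is at most x
e^c (`IsWealth.cost_le_sub`). If ‖θ‖_T > 0, equality forces S_T = ρ*‖θ‖_T, which is the equality
case of Cauchy–Schwarz and determines y; the constraint at T then leaves no room for consumption
(`IsWealth.ae_eq_of_le_cost`).

Attainment. The lower bound on ζ gives ρ* ≥ 2‖θ‖_T - |z_α|, which is what makes y* satisfy the
constraint before T as well (`isOptimalControl_optimalY`). If ‖θ‖_T = 0 then S vanishes, and without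
consumption only n_T ≤ ρ* is required.

Stochastic part. The lognormal form is derived without Itô's formula. Elementary pairs (integrand,
integral) span a space whose closure `itoSpace` carries the Itô isometry. For a step function b the
exponential martingale is close in L² to 1 plus its Itô sums (`brownianExp_sub_sum`), and the
identity E[𝓔(f) 𝓔(g)] = exp⟨f, g⟩ carries this to all square integrable b
(`IsWienerIntegral.isItoPair_doleansExp`). Integration by parts against a deterministic function
inserts the drift, which gives existence, and removes it from the difference of two solutions, after
which the isometry and Grönwall's inequality give uniqueness (`SolvesLinearSDE.ae_eq`). -/

theorem AbsolutelyContinuousOnInterval.lipschitz_comp {f g : ℝ → ℝ} {a b : ℝ} {K : ℝ≥0}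
    {s : Set ℝ} (hf : AbsolutelyContinuousOnInterval f a b) (hg : LipschitzOnWith K g s)
    (hs : ∀ x ∈ uIcc a b, f x ∈ s) : AbsolutelyContinuousOnInterval (fun x => g (f x)) a b := by
  rw [absolutelyContinuousOnInterval_iff] at hf ⊢
  intro ε hε
  obtain ⟨δ, hδ, h⟩ := hf (ε / (K + 1)) (by positivity)
  refine ⟨δ, hδ, fun E hE hE' => ?_⟩
  have h1 := h E hE hE'
  have hE2 := hE
  simp only [AbsolutelyContinuousOnInterval.disjWithin, mem_ofPred_eq] at hE2
  calc ∑ i ∈ Finset.range E.1, dist (g (f (E.2 i).1)) (g (f (E.2 i).2))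
      ≤ ∑ i ∈ Finset.range E.1, K * dist (f (E.2 i).1) (f (E.2 i).2) := by
        refine Finset.sum_le_sum fun i hi => ?_
        exact hg.dist_le_mul _ (hs _ (hE2.1 i hi).1) _ (hs _ (hE2.1 i hi).2)
    _ = K * ∑ i ∈ Finset.range E.1, dist (f (E.2 i).1) (f (E.2 i).2) := by rw [Finset.mul_sum]
    _ ≤ (K + 1) * ∑ i ∈ Finset.range E.1, dist (f (E.2 i).1) (f (E.2 i).2) := by
        gcongr; linarith
    _ < (K + 1) * (ε / (K + 1)) := by gcongr
    _ = ε := by field_simp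

theorem AbsolutelyContinuousOnInterval.exp {f : ℝ → ℝ} {a b : ℝ}
    (hf : AbsolutelyContinuousOnInterval f a b) :
    AbsolutelyContinuousOnInterval (fun x => Real.exp (f x)) a b := by
  obtain ⟨C, hC⟩ := hf.exists_bound
  have h1 : ContDiffOn ℝ 1 Real.exp (Icc (-C) C) := Real.contDiff_exp.contDiffOn
  obtain ⟨K, hK⟩ := h1.exists_lipschitzOnWith (by decide) (convex_Icc _ _) isCompact_Icc
  exact hf.lipschitz_comp hK fun x hx => abs_le.1 (hC x hx)

/-- The coefficients of the equation are only integrable in time, so their primitives are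
differentiable only almost everywhere; absolute continuity is what keeps the fundamental theorem of
calculus valid for exponentials and products of them. -/
theorem AbsolutelyContinuousOnInterval.integral_eq_sub_of_ae_hasDerivAt {f f' : ℝ → ℝ} {a b : ℝ}
    (hf : AbsolutelyContinuousOnInterval f a b)
    (h : ∀ᵐ x, x ∈ uIcc a b → HasDerivAt f (f' x) x) :
    ∫ x in a..b, f' x = f b - f a := by
  rw [← hf.integral_deriv_eq_sub]
  refine intervalIntegral.integral_congr_ae ?_
  filter_upwards [h] with x hx hx'
  exact (hx (uIoc_subset_uIcc hx')).deriv.symm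

section Primitive

variable {T t : ℝ} {a : ℝ → ℝ}

theorem MeasureTheory.IntegrableOn.intervalIntegrable_zero {E : Type*} [NormedAddCommGroup E]
    {a : ℝ → E} (ha : IntegrableOn a (Icc 0 T)) (ht : t ∈ Icc 0 T) :
    IntervalIntegrable a volume 0 t :=
  (ha.mono_set (by rw [uIcc_of_le ht.1]; exact Icc_subset_Icc_right ht.2)).intervalIntegrable

theorem absolutelyContinuous_primitive (ha : IntegrableOn a (Icc 0 T)) (ht : t ∈ Icc 0 T) :
    AbsolutelyContinuousOnInterval (fun s => ∫ u in (0 : ℝ)..s, a u) 0 t :=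
  (ha.intervalIntegrable_zero ht).absolutelyContinuousOnInterval_intervalIntegral (by simp)

theorem ae_hasDerivAt_primitive (ha : IntegrableOn a (Icc 0 T)) (ht : t ∈ Icc 0 T) :
    ∀ᵐ s, s ∈ uIcc 0 t → HasDerivAt (fun s => ∫ u in (0 : ℝ)..s, a u) (a s) s := by
  filter_upwards [(ha.intervalIntegrable_zero ht).ae_hasDerivAt_integral] with s hs hs'
  exact hs hs' 0 (by simp)

theorem continuousOn_primitive_zero (ha : IntegrableOn a (Icc 0 T)) :
    ContinuousOn (fun s => ∫ u in (0 : ℝ)..s, a u) (Icc 0 T) := by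
  rcases lt_or_ge T 0 with hT | hT
  · simp [Icc_eq_empty_of_lt hT]
  · have := (absolutelyContinuous_primitive ha (right_mem_Icc.2 hT)).continuousOn
    rwa [uIcc_of_le hT] at this

/-- `e^{A}` is a primitive of `e^{A} a` when `A` is the primitive of an integrable function. -/
theorem integral_exp_primitive_mul (ha : IntegrableOn a (Icc 0 T)) (ht : t ∈ Icc 0 T) :
    ∫ u in (0 : ℝ)..t, Real.exp (∫ s in (0 : ℝ)..u, a s) * a u
      = Real.exp (∫ s in (0 : ℝ)..t, a s) - 1 := by
  have h := (absolutelyContinuous_primitive ha ht).exp.integral_eq_sub_of_ae_hasDerivAt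
    (f' := fun u => Real.exp (∫ s in (0 : ℝ)..u, a s) * a u) (by
      filter_upwards [ae_hasDerivAt_primitive ha ht] with s hs hs'
      exact (hs hs').exp)
  simpa using h

/-- Product rule for `e^{A} F` with primitives `A` and `F`. -/
theorem integral_exp_primitive_mul_add {f : ℝ → ℝ} (ha : IntegrableOn a (Icc 0 T))
    (hf : IntegrableOn f (Icc 0 T)) (ht : t ∈ Icc 0 T) :
    ∫ u in (0 : ℝ)..t, (Real.exp (∫ s in (0 : ℝ)..u, a s) * a u * (∫ s in (0 : ℝ)..u, f s)
        + Real.exp (∫ s in (0 : ℝ)..u, a s) * f u)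
      = Real.exp (∫ s in (0 : ℝ)..t, a s) * ∫ s in (0 : ℝ)..t, f s := by
  have h := ((absolutelyContinuous_primitive ha ht).exp.fun_mul
    (absolutelyContinuous_primitive hf ht)).integral_eq_sub_of_ae_hasDerivAt
    (f' := fun u => Real.exp (∫ s in (0 : ℝ)..u, a s) * a u * (∫ s in (0 : ℝ)..u, f s)
        + Real.exp (∫ s in (0 : ℝ)..u, a s) * f u) (by
      filter_upwards [ae_hasDerivAt_primitive ha ht, ae_hasDerivAt_primitive hf ht] with s hs hs2 hs'
      exact (hs hs').exp.mul (hs2 hs'))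
  simpa using h

/-- Variation of constants for `D = J + ∫ D a`. -/
theorem exp_neg_primitive_mul_eq {D J : ℝ → ℝ} (ha : IntegrableOn a (Icc 0 T))
    (hD : ContinuousOn D (Icc 0 T))
    (hDJ : ∀ t ∈ Icc 0 T, D t = J t + ∫ u in (0 : ℝ)..t, D u * a u) (ht : t ∈ Icc 0 T) :
    Real.exp (-∫ s in (0 : ℝ)..t, a s) * D t
      = Real.exp (-∫ s in (0 : ℝ)..t, a s) * J t
        - ∫ u in (0 : ℝ)..t, J u * (Real.exp (-∫ s in (0 : ℝ)..u, a s) * (-a u)) := by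
  have hna : IntegrableOn (fun u => -a u) (Icc 0 T) := ha.neg
  have hDa : IntegrableOn (fun u => D u * a u) (Icc 0 T) :=
    ha.continuousOn_mul hD isCompact_Icc
  have hsub : uIcc 0 t ⊆ Icc 0 T := by rw [uIcc_of_le ht.1]; exact Icc_subset_Icc_right ht.2
  have h := integral_exp_primitive_mul_add hna hDa ht
  simp only [intervalIntegral.integral_neg] at h
  have hE : ContinuousOn (fun u => Real.exp (-∫ s in (0 : ℝ)..u, a s)) (Icc 0 T) :=
    (continuousOn_primitive_zero ha).neg.rexp
  have hF : ContinuousOn (fun u => ∫ s in (0 : ℝ)..u, D s * a s) (Icc 0 T) :=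
    continuousOn_primitive_zero hDa
  have hi1 : IntegrableOn (fun u => (Real.exp (-∫ s in (0 : ℝ)..u, a s) *
      ∫ s in (0 : ℝ)..u, D s * a s) * (-a u)) (Icc 0 T) :=
    hna.continuousOn_mul (hE.mul hF) isCompact_Icc
  have hi2 : IntegrableOn (fun u => (Real.exp (-∫ s in (0 : ℝ)..u, a s) * D u) * (a u)) (Icc 0 T) :=
    ha.continuousOn_mul (hE.mul hD) isCompact_Icc
  -- Since J = D - F with F the primitive of D a, the integrand is minus the derivative of e^{-A} F,
  -- where A is the primitive of a.
  have h2 : ∫ u in (0 : ℝ)..t, J u * (Real.exp (-∫ s in (0 : ℝ)..u, a s) * (-a u))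
      = - ∫ u in (0 : ℝ)..t, (Real.exp (-∫ s in (0 : ℝ)..u, a s) * -a u * (∫ s in (0 : ℝ)..u, D s * a s)
        + Real.exp (-∫ s in (0 : ℝ)..u, a s) * (D u * a u)) := by
    rw [← intervalIntegral.integral_neg]
    refine intervalIntegral.integral_congr fun u hu => ?_
    have := hDJ u (hsub hu)
    rw [show J u = D u - ∫ s in (0 : ℝ)..u, D s * a s by linarith]
    ring
  rw [h2, h, hDJ t ht]
  ring

end Primitive

/-- Grönwall's inequality with an integrable kernel, in the homogeneous case. -/
theorem eq_zero_of_le_integral_mul {T C : ℝ} {φ g : ℝ → ℝ} (hg : IntegrableOn g (Icc 0 T))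
    (hg0 : ∀ u, 0 ≤ g u) (hφ0 : ∀ u ∈ Icc 0 T, 0 ≤ φ u) (hφC : ∀ u ∈ Icc 0 T, φ u ≤ C)
    (hφg : IntegrableOn (fun u => φ u * g u) (Icc 0 T))
    (h : ∀ t ∈ Icc 0 T, φ t ≤ ∫ u in (0 : ℝ)..t, φ u * g u) :
    ∀ t ∈ Icc 0 T, φ t = 0 := by
  rcases lt_or_ge T 0 with hT | hT
  · simp [Icc_eq_empty_of_lt hT]
  have h2g : IntegrableOn (fun u => 2 * g u) (Icc 0 T) := hg.const_mul 2
  -- The doubled kernel makes the inequality a contraction: for K = sup φ e^{-G}, integrating K e^G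
  -- g yields (K/2)(e^G - 1), so K ≤ K/2. Only boundedness of φ is needed for K to exist.
  set G : ℝ → ℝ := fun t => ∫ u in (0 : ℝ)..t, 2 * g u with hG
  have hG0 : ∀ t ∈ Icc 0 T, 0 ≤ G t := fun t ht =>
    intervalIntegral.integral_nonneg ht.1 fun u _ => by have := hg0 u; positivity
  set S : Set ℝ := (fun t => φ t * Real.exp (-G t)) '' Icc 0 T with hS
  have hne : S.Nonempty := ⟨_, 0, ⟨le_rfl, hT⟩, rfl⟩
  have hbdd : BddAbove S := by
    refine ⟨C, ?_⟩
    rintro _ ⟨t, ht, rfl⟩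
    have h1 : Real.exp (-G t) ≤ 1 := Real.exp_le_one_iff.2 (by linarith [hG0 t ht])
    calc φ t * Real.exp (-G t) ≤ φ t * 1 := mul_le_mul_of_nonneg_left h1 (hφ0 t ht)
      _ ≤ C := by linarith [hφC t ht]
  set K := sSup S with hK
  have hle : ∀ t ∈ Icc 0 T, φ t ≤ K * Real.exp (G t) := by
    intro t ht
    have h1 : φ t * Real.exp (-G t) ≤ K := le_csSup hbdd ⟨t, ht, rfl⟩
    have := mul_le_mul_of_nonneg_right h1 (Real.exp_pos (G t)).le
    rwa [mul_assoc, ← Real.exp_add, neg_add_cancel, Real.exp_zero, mul_one] at this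
  have hK0 : 0 ≤ K := by
    have := le_csSup hbdd ⟨0, ⟨le_rfl, hT⟩, rfl⟩
    exact (mul_nonneg (hφ0 0 ⟨le_rfl, hT⟩) (Real.exp_pos _).le).trans this
  have hhalf : K ≤ K / 2 := by
    refine csSup_le hne ?_
    rintro _ ⟨t, ht, rfl⟩
    have hsub : Icc 0 t ⊆ Icc 0 T := Icc_subset_Icc_right ht.2
    have hcont : ContinuousOn (fun u => K / 2 * Real.exp (G u)) (Icc 0 T) :=
      continuousOn_const.mul (continuousOn_primitive_zero h2g).rexp
    have h1 : φ t ≤ K / 2 * (Real.exp (G t) - 1) := by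
      rw [← integral_exp_primitive_mul h2g ht, ← intervalIntegral.integral_const_mul]
      refine (h t ht).trans (intervalIntegral.integral_mono_on ht.1
        (hφg.intervalIntegrable_zero ht) ?_ fun u hu => ?_)
      · have := (h2g.continuousOn_mul hcont isCompact_Icc).intervalIntegrable_zero ht
        simpa only [mul_assoc] using this
      · have := mul_le_mul_of_nonneg_right (hle u (hsub hu)) (hg0 u)
        simp only [hG] at this ⊢
        linarith
    have h2 : φ t ≤ K / 2 * Real.exp (G t) := by nlinarith
    calc φ t * Real.exp (-G t) ≤ K / 2 * Real.exp (G t) * Real.exp (-G t) := by gcongr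
      _ = K / 2 := by rw [mul_assoc, ← Real.exp_add]; simp
  have hK00 : K = 0 := by linarith
  intro t ht
  refine le_antisymm ?_ (hφ0 t ht)
  simpa [hK00] using hle t ht

/-! ### Càdlàg functions -/

/-- Measurability: f(t) is the limit of the values of f at the grid points (⌊(n+1)t⌋ + 1)/(n+1),
which approach t from the right. Boundedness: the two one-sided limits bound f near each point, and
compactness of [0, T] does the rest. -/
theorem IsCadlag.integrableOn {f : ℝ → ℝ} (hf : IsCadlag f) (T : ℝ) :
    IntegrableOn f (Icc 0 T) := by
  have hmeas : AEMeasurable f (volume.restrict (Icc 0 T)) := by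
    refine aemeasurable_of_tendsto_metrizable_ae (f := fun (n : ℕ) t =>
      f ((⌊(n + 1 : ℝ) * t⌋ + 1 : ℝ) / (n + 1))) atTop (fun n => ?_) ?_
    · have : Measurable fun k : ℤ => f ((k + 1 : ℝ) / (n + 1)) := measurable_from_top
      exact (this.comp (Int.measurable_floor.comp (measurable_const_mul (n + 1 : ℝ)))).aemeasurable
    · filter_upwards [ae_restrict_mem measurableSet_Icc] with t ht
      refine (hf.1 t ht.1).tendsto.comp (tendsto_nhdsWithin_iff.2 ⟨?_, Eventually.of_forall fun n => ?_⟩)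
      · have h1 : Tendsto (fun n : ℕ => t + 1 / ((n : ℝ) + 1)) atTop (𝓝 (t + 0)) :=
          tendsto_const_nhds.add tendsto_one_div_add_atTop_nhds_zero_nat
        rw [add_zero] at h1
        refine tendsto_of_tendsto_of_tendsto_of_le_of_le tendsto_const_nhds h1 (fun n => ?_) fun n => ?_
        · have := Int.lt_floor_add_one ((n + 1 : ℝ) * t)
          simp only
          rw [le_div_iff₀ (by positivity)]
          linarith
        · have := Int.floor_le ((n + 1 : ℝ) * t)
          simp only
          rw [div_le_iff₀ (by positivity)]
          field_simp
          linarith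
      · have := Int.lt_floor_add_one ((n + 1 : ℝ) * t)
        simp only [mem_Ici]
        rw [le_div_iff₀ (by positivity)]
        linarith
  have hbdd : ∃ C, ∀ t ∈ Icc 0 T, ‖f t‖ ≤ C := by
    refine isCompact_Icc.induction_on (p := fun s => ∃ C, ∀ t ∈ s, ‖f t‖ ≤ C) ⟨0, by simp⟩
      (fun s t hst ⟨C, hC⟩ => ⟨C, fun x hx => hC x (hst hx)⟩)
      (fun s t ⟨C, hC⟩ ⟨C', hC'⟩ => ⟨max C C', fun x hx => hx.elim
        (fun h => (hC x h).trans (le_max_left _ _)) fun h => (hC' x h).trans (le_max_right _ _)⟩) ?_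
    intro t ht
    have hr : ∃ C, ∀ᶠ s in 𝓝[≥] t, ‖f s‖ ≤ C :=
      ⟨‖f t‖ + 1, ((hf.1 t ht.1).norm.eventually (eventually_lt_nhds (lt_add_one _))).mono
        fun _ h => h.le⟩
    obtain ⟨C, hC⟩ := hr
    rcases ht.1.eq_or_lt with rfl | h0
    · exact ⟨{s | ‖f s‖ ≤ C}, nhdsWithin_mono _ (fun x hx => hx.1) hC, C, fun x hx => hx⟩
    · obtain ⟨l, hl⟩ := hf.2 t h0
      have hl' : ∀ᶠ s in 𝓝[<] t, ‖f s‖ ≤ ‖l‖ + 1 :=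
        (hl.norm.eventually (eventually_lt_nhds (lt_add_one _))).mono fun _ h => h.le
      refine ⟨{s | ‖f s‖ ≤ max C (‖l‖ + 1)}, mem_nhdsWithin_of_mem_nhds ?_, _, fun x hx => hx⟩
      rw [← nhdsLT_sup_nhdsGE]
      exact mem_sup.2 ⟨hl'.mono fun _ h => h.trans (le_max_right _ _),
        hC.mono fun _ h => h.trans (le_max_left _ _)⟩
  obtain ⟨C, hC⟩ := hbdd
  refine IntegrableOn.of_bound measure_Icc_lt_top hmeas.aestronglyMeasurable C ?_
  filter_upwards [ae_restrict_mem measurableSet_Icc] with t ht using hC t ht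

/-! ### Uniform grids and step functions -/

/-- The point `i T / N` of the uniform grid. -/
noncomputable def gridTime (T : ℝ) (N i : ℕ) : ℝ≥0 := i * (T.toNNReal / N)

theorem gridTime_mono (T : ℝ) (N : ℕ) : Monotone (gridTime T N) := fun i j hij => by
  unfold gridTime; gcongr

@[simp] theorem gridTime_zero (T : ℝ) (N : ℕ) : gridTime T N 0 = 0 := by simp [gridTime]

theorem coe_gridTime {T : ℝ} (hT : 0 ≤ T) (N i : ℕ) : (gridTime T N i : ℝ) = i * (T / N) := by
  simp [gridTime, Real.coe_toNNReal _ hT]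

theorem coe_gridTime_self {T : ℝ} (hT : 0 ≤ T) {N : ℕ} (hN : N ≠ 0) : (gridTime T N N : ℝ) = T := by
  rw [coe_gridTime hT]; field_simp

theorem coe_gridTime_succ {T : ℝ} (hT : 0 ≤ T) (N i : ℕ) :
    (gridTime T N (i + 1) : ℝ) = gridTime T N i + T / N := by
  rw [coe_gridTime hT, coe_gridTime hT]; push_cast; ring

theorem gridTime_mem_Icc {T : ℝ} (hT : 0 ≤ T) {N i : ℕ} (hi : i ≤ N) (hN : N ≠ 0) :
    (gridTime T N i : ℝ) ∈ Icc 0 T :=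
  ⟨NNReal.coe_nonneg _, (NNReal.coe_le_coe.2 (gridTime_mono T N hi)).trans_eq
    (coe_gridTime_self hT hN)⟩

theorem exists_mem_gridCell {T : ℝ} (hT : 0 ≤ T) {N : ℕ} (hN : N ≠ 0) {u : ℝ} (hu : u ∈ Ioc 0 T) :
    ∃ i < N, u ∈ Ioc (gridTime T N i : ℝ) (gridTime T N (i + 1)) := by
  classical
  have hex : ∃ k, u ≤ gridTime T N k := ⟨N, by rw [coe_gridTime_self hT hN]; exact hu.2⟩
  have hpos : Nat.find hex ≠ 0 := by
    intro h0
    have := Nat.find_spec hex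
    rw [h0] at this
    simp at this
    linarith [hu.1]
  obtain ⟨i, hi⟩ := Nat.exists_eq_succ_of_ne_zero hpos
  refine ⟨i, ?_, not_le.1 (Nat.find_min hex (by omega)), ?_⟩
  · have : Nat.find hex ≤ N := Nat.find_min' hex (by rw [coe_gridTime_self hT hN]; exact hu.2)
    omega
  · have := Nat.find_spec hex
    rwa [hi] at this

theorem sum_indicator_Ioc_eq {E : Type*} [AddCommMonoid E] {τ : ℕ → ℝ≥0} (hτ : Monotone τ)
    (β : ℕ → E) {n i : ℕ} (hi : i < n) {u : ℝ} (hu : u ∈ Ioc (τ i : ℝ) (τ (i + 1))) :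
    ∑ k ∈ Finset.range n, (Ioc (τ k : ℝ) (τ (k + 1))).indicator (fun _ => β k) u = β i := by
  rw [Finset.sum_eq_single i]
  · rw [indicator_of_mem hu]
  · intro k _ hk
    refine indicator_of_notMem (fun hku => ?_) _
    rcases lt_or_gt_of_ne hk with h | h
    · have : (τ (k + 1) : ℝ) ≤ τ i := hτ h
      linarith [hku.2, hu.1]
    · have : (τ (i + 1) : ℝ) ≤ τ k := hτ h
      linarith [hku.1, hu.2]
  · intro h; exact absurd (Finset.mem_range.2 hi) h

/-- The step function with value `β i` on `(i T / N, (i + 1) T / N]`. -/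
noncomputable def gridStep {E : Type*} [AddCommMonoid E] (T : ℝ) (N : ℕ) (β : ℕ → E) (u : ℝ) : E :=
  ∑ i ∈ Finset.range N,
    (Ioc (gridTime T N i : ℝ) (gridTime T N (i + 1))).indicator (fun _ => β i) u

theorem gridStep_eq {E : Type*} [AddCommMonoid E] {T : ℝ} {N i : ℕ} (hi : i < N) (β : ℕ → E)
    {u : ℝ} (hu : u ∈ Ioc (gridTime T N i : ℝ) (gridTime T N (i + 1))) :
    gridStep T N β u = β i :=
  sum_indicator_Ioc_eq (gridTime_mono T N) β hi hu

theorem stronglyMeasurable_gridStep {E : Type*} [NormedAddCommGroup E] (T : ℝ) (N : ℕ)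
    (β : ℕ → E) : StronglyMeasurable (gridStep T N β) := by
  unfold gridStep
  exact Finset.stronglyMeasurable_fun_sum _ fun i _ =>
    stronglyMeasurable_const.indicator measurableSet_Ioc

theorem ae_mem_Ioc_restrict_Icc (T : ℝ) : ∀ᵐ u ∂(volume.restrict (Icc 0 T)), u ∈ Ioc 0 T := by
  rw [Measure.restrict_congr_set Ioc_ae_eq_Icc.symm]
  exact ae_restrict_mem measurableSet_Ioc

theorem norm_gridStep_sub_le {E : Type*} [NormedAddCommGroup E] {T ε : ℝ} (hT : 0 ≤ T) {N : ℕ}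
    (hN : N ≠ 0) {g : ℝ → E}
    (hg : ∀ s ∈ Icc 0 T, ∀ u ∈ Icc 0 T, |s - u| ≤ T / N → ‖g s - g u‖ ≤ ε) {u : ℝ} (hu : u ∈ Ioc 0 T) :
    ‖gridStep T N (fun i => g (gridTime T N i)) u - g u‖ ≤ ε := by
  obtain ⟨i, hi, hui⟩ := exists_mem_gridCell hT hN hu
  rw [gridStep_eq hi _ hui]
  refine hg _ (gridTime_mem_Icc hT hi.le hN) _ ⟨hu.1.le, hu.2⟩ ?_
  have h2 := hui.2
  rw [coe_gridTime_succ hT] at h2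
  rw [abs_sub_comm, abs_of_pos (by linarith [hui.1])]
  linarith

theorem eventually_mesh_lt {T δ : ℝ} (hδ : 0 < δ) :
    ∀ᶠ N : ℕ in atTop, N ≠ 0 ∧ T / N < δ :=
  (eventually_ne_atTop 0).and
    ((tendsto_const_div_atTop_nhds_zero_nat T).eventually (gt_mem_nhds hδ))

/-- Step functions on uniform grids are dense in `L²`, with control of the cells. -/
theorem exists_gridStep_approx {E : Type*} [NormedAddCommGroup E] [NormedSpace ℝ E] {T : ℝ}
    (hT : 0 ≤ T) {b : ℝ → E} (hb : MemLp b 2 (volume.restrict (Icc 0 T))) {ε : ℝ} (hε : 0 < ε) :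
    ∃ (N : ℕ) (β : ℕ → E), N ≠ 0 ∧ T / N ≤ ε ∧ (∀ i, ‖β i‖ ^ 2 * (T / N) ≤ ε) ∧
      eLpNorm (gridStep T N β - b) 2 (volume.restrict (Icc 0 T)) ≤ ENNReal.ofReal ε := by
  -- A continuous g of compact support is sampled instead of b: it is uniformly continuous, and its
  -- bound C gives the smallness of |β_i|² T/N. The grid must be fine for three reasons: the modulus
  -- of g, the mesh itself, and C² T/N.
  obtain ⟨g, hgs, hgb, hgc, hgm⟩ := hb.exists_hasCompactSupport_eLpNorm_sub_le (by simp)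
    (ε := ENNReal.ofReal (ε / 2)) (by simpa using hε)
  obtain ⟨C, hC⟩ := hgs.exists_bound_of_continuous hgc
  have hC0 : 0 ≤ C := (norm_nonneg _).trans (hC 0)
  have huc := hgc.uniformContinuous_of_tendsto_cocompact hgs.is_zero_at_infty
  -- A uniform error η on [0, T] costs √T η ≤ ε/2 in L²; the summand 1 covers T = 0.
  set η : ℝ := ε / 2 / (√T + 1) with hη
  have hη0 : 0 < η := by positivity
  obtain ⟨δ, hδ, hδg⟩ := Metric.uniformContinuous_iff.1 huc η hη0
  obtain ⟨N, ⟨⟨hN, h1⟩, -, h2⟩, -, h3⟩ :=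
    (((eventually_mesh_lt (T := T) hδ).and (eventually_mesh_lt (T := T) hε)).and
    (eventually_mesh_lt (T := T) (δ := ε / (C ^ 2 + 1)) (by positivity))).exists
  refine ⟨N, fun i => g (gridTime T N i), hN, h2.le, fun i => ?_, ?_⟩
  · have hTN : 0 ≤ T / N := by positivity
    calc ‖g (gridTime T N i)‖ ^ 2 * (T / N) ≤ (C ^ 2 + 1) * (ε / (C ^ 2 + 1)) := by
          have : ‖g (gridTime T N i)‖ ^ 2 ≤ C ^ 2 := by gcongr; exact hC _
          gcongr
          linarith
      _ = ε := by field_simp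
  · have hst : eLpNorm (gridStep T N (fun i => g (gridTime T N i)) - g) 2 (volume.restrict (Icc 0 T))
        ≤ ENNReal.ofReal (ε / 2) := by
      refine (eLpNorm_le_of_ae_bound (C := η) ?_).trans ?_
      · filter_upwards [ae_mem_Ioc_restrict_Icc T] with u hu
        refine norm_gridStep_sub_le hT hN (fun s _ u _ hsu => ?_) hu
        rw [← dist_eq_norm]
        exact (hδg (by rw [Real.dist_eq]; exact hsu.trans_lt h1)).le
      · rw [Measure.restrict_apply_univ, Real.volume_Icc, sub_zero,
          ENNReal.ofReal_rpow_of_nonneg hT (by norm_num), ← ENNReal.ofReal_mul (by positivity)]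
        refine ENNReal.ofReal_le_ofReal ?_
        have : T ^ (ENNReal.toReal 2)⁻¹ = √T := by rw [Real.sqrt_eq_rpow]; norm_num
        rw [this, hη, mul_div_assoc', div_le_iff₀ (by positivity)]
        nlinarith [Real.sqrt_nonneg T]
    calc eLpNorm (gridStep T N (fun i => g (gridTime T N i)) - b) 2 (volume.restrict (Icc 0 T))
        = eLpNorm ((gridStep T N (fun i => g (gridTime T N i)) - g) + (g - b)) 2
            (volume.restrict (Icc 0 T)) := by rw [sub_add_sub_cancel]
      _ ≤ _ := eLpNorm_add_le ((stronglyMeasurable_gridStep _ _ _).aestronglyMeasurable.sub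
            hgm.1) (hgm.1.sub hb.1) (by norm_num)
      _ ≤ ENNReal.ofReal (ε / 2) + ENNReal.ofReal (ε / 2) := by
          rw [eLpNorm_sub_comm g b]; gcongr
      _ = ENNReal.ofReal ε := by rw [← ENNReal.ofReal_add (by positivity) (by positivity)]; ring_nf

/-- Convergence of Riemann–Stieltjes sums, integrated by parts. -/
theorem tendsto_sum_mul_sub_grid {T : ℝ} (hT : 0 ≤ T) {h h' Q : ℝ → ℝ}
    (hh' : IntegrableOn h' (Icc 0 T)) (hh : ∀ t ∈ Icc 0 T, h t = h 0 + ∫ u in (0 : ℝ)..t, h' u)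
    (hQ : ContinuousOn Q (Icc 0 T)) (hQ0 : Q 0 = 0) {t : ℝ} (ht : t ∈ Icc 0 T) :
    Tendsto (fun N : ℕ => ∑ i ∈ Finset.range N, h (gridTime T N i) *
        (Q (min t (gridTime T N (i + 1))) - Q (min t (gridTime T N i)))) atTop
      (𝓝 (h t * Q t - ∫ u in (0 : ℝ)..t, Q u * h' u)) := by
  set L := ∫ u in (0 : ℝ)..t, |h' u| with hL
  have hL0 : 0 ≤ L := intervalIntegral.integral_nonneg ht.1 fun _ _ => abs_nonneg _
  have huc := isCompact_Icc.uniformContinuousOn_of_continuous hQ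
  rw [Metric.tendsto_atTop]
  intro ε hε
  obtain ⟨δ, hδ, hδQ⟩ := Metric.uniformContinuousOn_iff.1 huc (ε / (L + 1)) (by positivity)
  obtain ⟨N₀, hN₀⟩ := eventually_atTop.1 (eventually_mesh_lt (T := T) hδ)
  refine ⟨N₀, fun N hNN => ?_⟩
  obtain ⟨hN, hmesh⟩ := hN₀ N hNN
  set τ : ℕ → ℝ := fun i => min t (gridTime T N i) with hτ
  have hτmono : Monotone τ := fun i j hij => min_le_min_left _ (by exact_mod_cast gridTime_mono T N hij)
  have hτ0 : τ 0 = 0 := by simp [hτ, ht.1]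
  have hτN : τ N = t := by simp [hτ, coe_gridTime_self hT hN, ht.2]
  have hτm : ∀ i, τ i ∈ Icc 0 t := fun i => ⟨le_min ht.1 (NNReal.coe_nonneg _), min_le_left _ _⟩
  have hτT : ∀ i, τ i ∈ Icc 0 T := fun i => ⟨(hτm i).1, (hτm i).2.trans ht.2⟩
  have hτs : ∀ i, τ (i + 1) - τ i ≤ T / N := fun i => by
    have h1 := coe_gridTime_succ hT N i
    have h2 : 0 ≤ T / N := by positivity
    simp only [hτ, h1]
    rcases le_total t (gridTime T N i) with h | h
    · rw [min_eq_left h, min_eq_left (by linarith)]; linarith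
    · rw [min_eq_right h]; have := min_le_right t (gridTime T N i + T / N); linarith
  -- Beyond t the stopped increments of Q vanish, so h may be evaluated at the stopped grid points.
  have hsum : ∑ i ∈ Finset.range N, h (gridTime T N i) *
        (Q (min t (gridTime T N (i + 1))) - Q (min t (gridTime T N i)))
      = ∑ i ∈ Finset.range N, h (τ i) * (Q (τ (i + 1)) - Q (τ i)) := by
    refine Finset.sum_congr rfl fun i _ => ?_
    rcases le_total t (gridTime T N i) with h | h
    · have h2 : t ≤ gridTime T N (i + 1) := h.trans (by exact_mod_cast gridTime_mono T N i.le_succ)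
      simp [hτ, min_eq_left h, min_eq_left h2]
    · simp [hτ, min_eq_right h]
  have hint : ∀ i, IntervalIntegrable (fun u => Q u * h' u) volume (τ i) (τ (i + 1)) := fun i =>
    ((hh'.continuousOn_mul hQ isCompact_Icc).mono_set (by
      rw [uIcc_of_le (hτmono i.le_succ)]
      exact Icc_subset_Icc (hτT i).1 (hτT _).2)).intervalIntegrable
  have hinth : ∀ i, IntervalIntegrable h' volume (τ i) (τ (i + 1)) := fun i =>
    (hh'.mono_set (by
      rw [uIcc_of_le (hτmono i.le_succ)]
      exact Icc_subset_Icc (hτT i).1 (hτT _).2)).intervalIntegrable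
  have hdiff : ∀ i, h (τ (i + 1)) - h (τ i) = ∫ u in (τ i)..(τ (i + 1)), h' u := fun i => by
    rw [hh _ (hτT _), hh _ (hτT i), ← intervalIntegral.integral_interval_sub_left
      (hh'.intervalIntegrable_zero (hτT _)) (hh'.intervalIntegrable_zero (hτT _))]
    ring
  -- Summation by parts moves the differences onto h, which has finite variation; Q is only
  -- continuous.
  have habel : ∀ k, ∑ i ∈ Finset.range k, h (τ i) * (Q (τ (i + 1)) - Q (τ i))
      = h (τ k) * Q (τ k) - ∑ i ∈ Finset.range k, Q (τ (i + 1)) * (h (τ (i + 1)) - h (τ i)) := by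
    intro k
    induction k with
    | zero => simp [hτ0, hQ0]
    | succ k ih => rw [Finset.sum_range_succ, ih, Finset.sum_range_succ]; ring
  have hI : ∫ u in (0 : ℝ)..t, Q u * h' u
      = ∑ i ∈ Finset.range N, ∫ u in (τ i)..(τ (i + 1)), Q u * h' u := by
    rw [intervalIntegral.sum_integral_adjacent_intervals fun i _ => hint i, hτ0, hτN]
  have hLs : L = ∑ i ∈ Finset.range N, ∫ u in (τ i)..(τ (i + 1)), |h' u| := by
    rw [intervalIntegral.sum_integral_adjacent_intervals fun i _ => (hinth i).abs, hτ0, hτN]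
  have hterm : ∀ i, |Q (τ (i + 1)) * (h (τ (i + 1)) - h (τ i)) - ∫ u in (τ i)..(τ (i + 1)), Q u * h' u|
      ≤ ε / (L + 1) * ∫ u in (τ i)..(τ (i + 1)), |h' u| := by
    intro i
    rw [hdiff, ← intervalIntegral.integral_const_mul, ← intervalIntegral.integral_const_mul,
      ← intervalIntegral.integral_sub ((hinth i).const_mul _) (hint i)]
    refine (intervalIntegral.abs_integral_le_integral_abs (hτmono i.le_succ)).trans
      (intervalIntegral.integral_mono_on (hτmono i.le_succ)
        (((hinth i).const_mul _).sub (hint i)).abs ((hinth i).abs.const_mul _) fun u hu => ?_)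
    rw [← sub_mul, abs_mul]
    gcongr
    have := hδQ _ (hτT (i + 1)) u ⟨(hτT i).1.trans hu.1, hu.2.trans (hτT _).2⟩ (by
      rw [Real.dist_eq, abs_of_nonneg (by linarith [hu.2])]
      linarith [hτs i, hu.1])
    rw [Real.dist_eq] at this
    exact this.le
  rw [hsum, habel N, hτN, hI, Real.dist_eq]
  have : h t * Q t - ∑ i ∈ Finset.range N, Q (τ (i + 1)) * (h (τ (i + 1)) - h (τ i)) -
      (h t * Q t - ∑ i ∈ Finset.range N, ∫ u in (τ i)..(τ (i + 1)), Q u * h' u)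
      = -∑ i ∈ Finset.range N, (Q (τ (i + 1)) * (h (τ (i + 1)) - h (τ i))
        - ∫ u in (τ i)..(τ (i + 1)), Q u * h' u) := by
    rw [Finset.sum_sub_distrib]; ring
  rw [this, abs_neg]
  calc _ ≤ ∑ i ∈ Finset.range N, ε / (L + 1) * ∫ u in (τ i)..(τ (i + 1)), |h' u| :=
        (Finset.abs_sum_le_sum_abs _ _).trans (Finset.sum_le_sum fun i _ => hterm i)
    _ = ε / (L + 1) * L := by rw [← Finset.mul_sum, ← hLs]
    _ < ε := by rw [div_mul_eq_mul_div, div_lt_iff₀ (by positivity)]; nlinarith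

/-- A process with almost surely continuous paths is jointly measurable. -/
theorem aemeasurable_uncurry_of_ae_continuousOn {Ω : Type*} [MeasurableSpace Ω] {P : Measure Ω}
    [SFinite P] {T : ℝ} (hT : 0 ≤ T) {X : ℝ → Ω → ℝ} (hX : ∀ t ∈ Icc 0 T, AEMeasurable (X t) P)
    (hc : ∀ᵐ ω ∂P, ContinuousOn (fun t => X t ω) (Icc 0 T)) :
    AEMeasurable (fun p : ℝ × Ω => X p.1 p.2) ((volume.restrict (Icc 0 T)).prod P) := by
  have hg : ∀ n i : ℕ, i < n + 1 → AEMeasurable (X (gridTime T (n + 1) i)) P := fun n i hi =>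
    hX _ (gridTime_mem_Icc hT (by omega) (by omega))
  -- The variables X_t are only almost everywhere measurable; the countably many grid values are
  -- replaced by measurable versions, so that the step processes are jointly measurable.
  let Y : ℕ → ℕ → Ω → ℝ := fun n i => if hi : i < n + 1 then (hg n i hi).mk else 0
  have hY : ∀ n i, Measurable (Y n i) := fun n i => by
    by_cases hi : i < n + 1
    · simp only [Y, dif_pos hi]; exact (hg n i hi).measurable_mk
    · simp only [Y, dif_neg hi]; exact measurable_zero
  have hYX : ∀ᵐ ω ∂P, ∀ n i, i < n + 1 → Y n i ω = X (gridTime T (n + 1) i) ω := by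
    refine ae_all_iff.2 fun n => ae_all_iff.2 fun i => ?_
    by_cases hi : i < n + 1
    · filter_upwards [(hg n i hi).ae_eq_mk] with ω hω
      simp only [Y, dif_pos hi, hω, implies_true]
    · exact Eventually.of_forall fun ω h => absurd h hi
  refine aemeasurable_of_tendsto_metrizable_ae (f := fun (n : ℕ) (p : ℝ × Ω) =>
    gridStep T (n + 1) (fun i => Y n i p.2) p.1) atTop (fun n => ?_) ?_
  · unfold gridStep
    refine (Finset.measurable_fun_sum _ fun i _ => ?_).aemeasurable
    have : (fun p : ℝ × Ω => (Ioc (gridTime T (n + 1) i : ℝ) (gridTime T (n + 1) (i + 1))).indicator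
        (fun _ => Y n i p.2) p.1) = (Prod.fst ⁻¹' Ioc (gridTime T (n + 1) i : ℝ)
          (gridTime T (n + 1) (i + 1))).indicator (fun p => Y n i p.2) := by
      ext p; simp [indicator]
    rw [this]
    exact ((hY n i).comp measurable_snd).indicator (measurable_fst measurableSet_Ioc)
  · filter_upwards [Measure.quasiMeasurePreserving_snd.ae hc,
      Measure.quasiMeasurePreserving_snd.ae hYX,
      Measure.quasiMeasurePreserving_fst.ae (ae_mem_Ioc_restrict_Icc T)] with p h1 h2 h3
    have huc := isCompact_Icc.uniformContinuousOn_of_continuous h1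
    rw [Metric.tendsto_atTop]
    intro ε hε
    obtain ⟨δ, hδ, hδX⟩ := Metric.uniformContinuousOn_iff.1 huc (ε / 2) (by positivity)
    obtain ⟨N₀, hN₀⟩ := eventually_atTop.1 (eventually_mesh_lt (T := T) hδ)
    refine ⟨N₀, fun n hn => ?_⟩
    obtain ⟨-, hm⟩ := hN₀ (n + 1) (by omega)
    obtain ⟨i, hi, hui⟩ := exists_mem_gridCell hT (N := n + 1) (by omega) h3
    have := norm_gridStep_sub_le hT (N := n + 1) (by omega) (g := fun t => X t p.2) (ε := ε / 2)
      (fun s hs u hu hsu => by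
        rw [← dist_eq_norm]
        exact (hδX s hs u hu (by rw [Real.dist_eq]; exact hsu.trans_lt hm)).le) h3
    rw [gridStep_eq hi _ hui] at this ⊢
    rw [h2 n i hi, dist_eq_norm]
    linarith

/-! ### Multidimensional Brownian motion -/

section

variable {Ω : Type*} {d : ℕ}

theorem pastSigma_mono (W : ℝ≥0 → Ω → EuclideanSpace ℝ (Fin d)) {s t : ℝ≥0} (h : s ≤ t) :
    pastSigma W s ≤ pastSigma W t :=
  iSup_le fun r => le_iSup_of_le (⟨r, r.2.trans h⟩ : {r : ℝ≥0 // r ≤ t}) le_rfl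

theorem measurable_pastSigma (W : ℝ≥0 → Ω → EuclideanSpace ℝ (Fin d)) {s t : ℝ≥0}
    (h : s ≤ t) : Measurable[pastSigma W t] (W s) :=
  Measurable.mono (comap_measurable (W s))
    (le_iSup_of_le (⟨s, h⟩ : {r : ℝ≥0 // r ≤ t}) le_rfl) le_rfl

theorem measurable_pastSigma_coord (W : ℝ≥0 → Ω → EuclideanSpace ℝ (Fin d)) {s t : ℝ≥0}
    (h : s ≤ t) (j : Fin d) : Measurable[pastSigma W t] fun ω => W s ω j :=
  ((EuclideanSpace.proj j : EuclideanSpace ℝ (Fin d) →L[ℝ] ℝ).continuous.measurable).comp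
    (measurable_pastSigma W h)

end

namespace IsStandardBrownian

variable {Ω : Type*} [MeasurableSpace Ω] {P : Measure Ω} {d : ℕ}
  {W : ℝ≥0 → Ω → EuclideanSpace ℝ (Fin d)}

theorem measurable_coord (hW : IsStandardBrownian W P) (t : ℝ≥0) (j : Fin d) :
    Measurable fun ω => W t ω j :=
  ((EuclideanSpace.proj j : EuclideanSpace ℝ (Fin d) →L[ℝ] ℝ).continuous.measurable).comp
    (hW.measurable t)

theorem pastSigma_le (hW : IsStandardBrownian W P) (t : ℝ≥0) :
    pastSigma W t ≤ ‹MeasurableSpace Ω› :=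
  iSup_le fun s => (hW.measurable s).comap_le

theorem ae_continuous (hW : IsStandardBrownian W P) :
    ∀ᵐ ω ∂P, Continuous fun t => W t ω := by
  have h : ∀ᵐ ω ∂P, ∀ j, Continuous fun t => W t ω j := ae_all_iff.2 fun j => (hW.coord j).cont
  filter_upwards [h] with ω hω
  have : (fun t => W t ω) = fun t => WithLp.toLp 2 fun j => W t ω j := rfl
  rw [this]
  exact (PiLp.continuous_toLp 2 _).comp (continuous_pi hω)

/-- A finite family of variables W_t^j is a linear image of the coordinate paths restricted to one
common finite set of times, and these are independent Gaussian vectors. -/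
theorem isGaussianProcess [IsProbabilityMeasure P] (hW : IsStandardBrownian W P) :
    IsGaussianProcess (fun (p : Fin d × ℝ≥0) ω => W p.2 ω p.1) P where
  hasGaussianLaw I := by
    classical
    set J : Finset ℝ≥0 := I.image Prod.snd with hJ
    have h1 : ∀ j, HasGaussianLaw (fun ω => J.restrict fun t => W t ω j) P := fun j => by
      have hB := hW.coord j
      have hG := hB.isGaussianProcess
      exact hG.hasGaussianLaw J
    have h2 : iIndepFun (fun j ω => J.restrict fun t => W t ω j) P :=
      hW.indep.comp (fun _ f => J.restrict f) fun _ => Finset.measurable_restrict _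
    have h3 := iIndepFun.hasGaussianLaw h1 h2
    have hm : ∀ p : I, p.1.2 ∈ J := fun p => Finset.mem_image_of_mem _ p.2
    let L : (Fin d → J → ℝ) →L[ℝ] (I → ℝ) :=
      { toFun := fun f p => f p.1.1 ⟨p.1.2, hm p⟩
        map_add' := fun _ _ => rfl
        map_smul' := fun _ _ => rfl
        cont := by fun_prop }
    exact h3.map L

theorem memLp_coord (hW : IsStandardBrownian W P) (t : ℝ≥0) (j : Fin d) :
    MemLp (fun ω => W t ω j) 2 P := by
  have hB := hW.coord j
  have hG := hB.isGaussianProcess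
  exact (hG.hasGaussianLaw_eval t).memLp_two

theorem integral_coord (hW : IsStandardBrownian W P) (t : ℝ≥0) (j : Fin d) :
    ∫ ω, W t ω j ∂P = 0 := (hW.coord j).integral_eval t

theorem memLp_increment (hW : IsStandardBrownian W P) (s u : ℝ≥0) (j : Fin d) :
    MemLp (fun ω => W u ω j - W s ω j) 2 P :=
  (hW.memLp_coord u j).sub (hW.memLp_coord s j)

theorem covariance_coord (hW : IsStandardBrownian W P) (s t : ℝ≥0) (j k : Fin d) :
    cov[fun ω => W s ω j, fun ω => W t ω k; P] = if j = k then ((min s t : ℝ≥0) : ℝ) else 0 := by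
  split_ifs with h
  · subst h; exact (hW.coord j).covariance_fun_eval s t
  · have h1 := (hW.indep.indepFun h).comp (measurable_pi_apply s) (measurable_pi_apply t)
    exact h1.covariance_eq_zero (hW.memLp_coord s j) (hW.memLp_coord t k)

variable [IsProbabilityMeasure P]

/-- Increments are independent of the past. -/
theorem indep_increment (hW : IsStandardBrownian W P) (s : ℝ≥0) :
    IndepFun (fun ω (p : Fin d × {u : ℝ≥0 // s ≤ u}) => W p.2 ω p.1 - W s ω p.1)
      (fun ω (p : Fin d × {u : ℝ≥0 // u ≤ s}) => W p.2 ω p.1) P := by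
  classical
  -- In a jointly Gaussian family uncorrelated means independent, and min(u, v) - min(s, v) = 0 for
  -- v ≤ s ≤ u.
  apply IsGaussianProcess.indepFun_of_covariance_eq_zero
  · apply hW.isGaussianProcess.of_isGaussianProcess
    rintro (⟨j, u, hu⟩ | ⟨j, u, hu⟩)
    · exact ⟨{(j, s), (j, u)},
        { toFun x := x ⟨(j, u), by simp⟩ - x ⟨(j, s), by simp⟩
          map_add' x y := by simp; abel
          map_smul' c x := by simp; ring }, by simp⟩
    · exact ⟨{(j, u)},
        { toFun x := x ⟨(j, u), by simp⟩
          map_add' x y := by simp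
          map_smul' c x := by simp }, by simp⟩
  · exact fun p => ((hW.measurable_coord p.2 p.1).sub (hW.measurable_coord s p.1)).aemeasurable
  · exact fun p => (hW.measurable_coord _ _).aemeasurable
  · rintro ⟨j, u, hu⟩ ⟨k, v, hv⟩
    rw [covariance_fun_sub_left (hW.memLp_coord _ _) (hW.memLp_coord _ _) (hW.memLp_coord _ _),
      hW.covariance_coord, hW.covariance_coord, min_eq_right (hv.trans hu), min_eq_right hv, sub_self]

/-- Augmenting by null sets costs nothing: X agrees almost surely with a variable measurable for the
raw past, and independence is insensitive to null sets. -/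
theorem indepFun_increment (hW : IsStandardBrownian W P) {s u : ℝ≥0} (hsu : s ≤ u) {β : Type*}
    [TopologicalSpace β] [TopologicalSpace.PseudoMetrizableSpace β] [MeasurableSpace β]
    [BorelSpace β] {X : Ω → β} (hX : AEStronglyMeasurable[pastSigma W s] X P) :
    IndepFun X (fun ω => W u ω - W s ω) P := by
  have h1 := hW.indep_increment s
  obtain ⟨X', hX', hXX'⟩ := hX
  refine IndepFun.congr (f := X') (g := fun ω => W u ω - W s ω) ?_ hXX'.symm .rfl
  rw [IndepFun_iff_Indep] at h1 ⊢
  refine (indep_of_indep_of_le_left (indep_of_indep_of_le_right h1.symm ?_) ?_)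
  · have : (fun ω => W u ω - W s ω) = (fun f : Fin d × {u : ℝ≥0 // s ≤ u} → ℝ =>
        WithLp.toLp 2 fun j => f (j, ⟨u, hsu⟩)) ∘
        (fun ω (p : Fin d × {u : ℝ≥0 // s ≤ u}) => W p.2 ω p.1 - W s ω p.1) := by
      ext ω j; simp
    rw [this, ← MeasurableSpace.comap_comp]
    refine MeasurableSpace.comap_mono (Measurable.comap_le ?_)
    exact (PiLp.continuous_toLp 2 _).measurable.comp (measurable_pi_lambda _ fun j =>
      measurable_pi_apply _)
  · refine hX'.measurable.comap_le.trans (iSup_le fun r => ?_)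
    have : W r = (fun f : Fin d × {u : ℝ≥0 // u ≤ s} → ℝ =>
        WithLp.toLp 2 fun j => f (j, r)) ∘
        (fun ω (p : Fin d × {u : ℝ≥0 // u ≤ s}) => W p.2 ω p.1) := by
      ext ω j; simp
    conv_lhs => rw [this, ← MeasurableSpace.comap_comp]
    refine MeasurableSpace.comap_mono (Measurable.comap_le ?_)
    exact (PiLp.continuous_toLp 2 _).measurable.comp (measurable_pi_lambda _ fun j =>
      measurable_pi_apply _)

theorem indepFun_increment_coord (hW : IsStandardBrownian W P) {s u : ℝ≥0} (hsu : s ≤ u) {β : Type*}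
    [TopologicalSpace β] [TopologicalSpace.PseudoMetrizableSpace β] [MeasurableSpace β]
    [BorelSpace β] {X : Ω → β} (hX : AEStronglyMeasurable[pastSigma W s] X P) (j : Fin d) :
    IndepFun X (fun ω => W u ω j - W s ω j) P :=
  (hW.indepFun_increment hsu hX).comp measurable_id
    (EuclideanSpace.proj j : EuclideanSpace ℝ (Fin d) →L[ℝ] ℝ).continuous.measurable

theorem integral_increment (hW : IsStandardBrownian W P) (s u : ℝ≥0) (j : Fin d) :
    ∫ ω, (W u ω j - W s ω j) ∂P = 0 := by
  rw [integral_sub ((hW.memLp_coord u j).integrable (by norm_num))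
    ((hW.memLp_coord s j).integrable (by norm_num)), hW.integral_coord, hW.integral_coord, sub_zero]

theorem integral_increment_mul (hW : IsStandardBrownian W P) {s u : ℝ≥0} (hsu : s ≤ u)
    (j k : Fin d) :
    ∫ ω, (W u ω j - W s ω j) * (W u ω k - W s ω k) ∂P = if j = k then (u : ℝ) - s else 0 := by
  have h := covariance_eq_sub (hW.memLp_increment s u j) (hW.memLp_increment s u k)
  rw [hW.integral_increment, hW.integral_increment, mul_zero, sub_zero] at h
  simp only [Pi.mul_apply] at h
  rw [← h, covariance_fun_sub_left (hW.memLp_coord _ _) (hW.memLp_coord _ _)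
    (hW.memLp_increment _ _ _),
    covariance_fun_sub_right (hW.memLp_coord _ _) (hW.memLp_coord _ _) (hW.memLp_coord _ _),
    covariance_fun_sub_right (hW.memLp_coord _ _) (hW.memLp_coord _ _) (hW.memLp_coord _ _)]
  simp only [hW.covariance_coord]
  split_ifs with hjk
  · simp [min_eq_left hsu, min_eq_right hsu]
  · simp

/-- The product of a square integrable past variable with an increment is square integrable. -/
theorem memLp_mul_increment (hW : IsStandardBrownian W P) {s u : ℝ≥0} (hsu : s ≤ u) {X : Ω → ℝ}
    (hX : AEStronglyMeasurable[pastSigma W s] X P) (hX2 : MemLp X 2 P) (j : Fin d) :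
    MemLp (fun ω => X ω * (W u ω j - W s ω j)) 2 P := by
  have hD := hW.memLp_increment s u j
  -- Hölder's inequality would only give L¹; by independence of the squares the second moment
  -- factorises.
  have h := (hW.indepFun_increment_coord hsu hX j).comp (measurable_id.pow_const 2)
    (measurable_id.pow_const 2)
  have h2 := h.integrable_mul hX2.integrable_sq hD.integrable_sq
  refine (memLp_two_iff_integrable_sq (hX2.1.mul hD.1)).2 (h2.congr (ae_of_all _ fun ω => ?_))
  simp [mul_pow]

theorem integral_mul_increment (hW : IsStandardBrownian W P) {s u : ℝ≥0} (hsu : s ≤ u) {X : Ω → ℝ}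
    (hX : AEStronglyMeasurable[pastSigma W s] X P) (j : Fin d) :
    ∫ ω, X ω * (W u ω j - W s ω j) ∂P = 0 := by
  have h := (hW.indepFun_increment_coord hsu hX j).integral_fun_mul_eq_mul_integral
    (hX.mono (hW.pastSigma_le s)) (hW.memLp_increment s u j).1
  rw [h, hW.integral_increment, mul_zero]

theorem integral_mul_increment_mul (hW : IsStandardBrownian W P) {s u : ℝ≥0} (hsu : s ≤ u)
    {X : Ω → ℝ} (hX : AEStronglyMeasurable[pastSigma W s] X P) (j k : Fin d) :
    ∫ ω, X ω * ((W u ω j - W s ω j) * (W u ω k - W s ω k)) ∂P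
      = (∫ ω, X ω ∂P) * if j = k then (u : ℝ) - s else 0 := by
  have h1 : Measurable fun x : EuclideanSpace ℝ (Fin d) => x j * x k := by fun_prop
  have h := ((hW.indepFun_increment hsu hX).comp measurable_id h1).integral_fun_mul_eq_mul_integral
    (hX.mono (hW.pastSigma_le s))
    ((hW.memLp_increment s u j).1.mul (hW.memLp_increment s u k).1)
  rw [← hW.integral_increment_mul hsu]
  exact h

end IsStandardBrownian

/-! ### The closed space of pairs (integrand, Itô integral) -/

namespace IsStandardBrownian

variable {Ω : Type*} [MeasurableSpace Ω] {P : Measure Ω} {d : ℕ}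
  {W : ℝ≥0 → Ω → EuclideanSpace ℝ (Fin d)}

theorem aestronglyMeasurable_mul_increment {s u r : ℝ≥0}
    (hsu : s ≤ u) (hur : u ≤ r) {X : Ω → ℝ} (hX : AEStronglyMeasurable[pastSigma W s] X P)
    (j : Fin d) :
    AEStronglyMeasurable[pastSigma W r] (fun ω => X ω * (W u ω j - W s ω j)) P :=
  (hX.mono (pastSigma_mono W (hsu.trans hur))).mul
    (((measurable_pastSigma_coord W hur j).stronglyMeasurable.sub
      (measurable_pastSigma_coord W (hsu.trans hur) j).stronglyMeasurable).aestronglyMeasurable)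

variable [IsProbabilityMeasure P]

/-- Split the longer increment at u: over [s, u] the product of the two increments is independent of
the past at s, and the increment over [u, u'] has mean zero and is independent of everything before
u. -/
theorem integral_mul_increment_mul_mul_increment_of_eq (hW : IsStandardBrownian W P)
    {s u u' : ℝ≥0} (hsu : s ≤ u) (huu' : u ≤ u') {ξ η : Ω → ℝ}
    (hξ : AEStronglyMeasurable[pastSigma W s] ξ P) (hξ2 : MemLp ξ 2 P)
    (hη : AEStronglyMeasurable[pastSigma W s] η P) (hη2 : MemLp η 2 P) (j k : Fin d) :
    ∫ ω, (ξ ω * (W u ω j - W s ω j)) * (η ω * (W u' ω k - W s ω k)) ∂P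
      = (if j = k then (u : ℝ) - s else 0) * ∫ ω, ξ ω * η ω ∂P := by
  have h1 : ∀ ω, (ξ ω * (W u ω j - W s ω j)) * (η ω * (W u' ω k - W s ω k))
      = (ξ ω * η ω) * ((W u ω j - W s ω j) * (W u ω k - W s ω k))
        + (η ω * (ξ ω * (W u ω j - W s ω j))) * (W u' ω k - W u ω k) := fun ω => by ring
  have hi1 : Integrable (fun ω => (ξ ω * (W u ω j - W s ω j)) * (η ω * (W u ω k - W s ω k))) P :=
    (hW.memLp_mul_increment hsu hξ hξ2 j).integrable_mul (hW.memLp_mul_increment hsu hη hη2 k)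
  have hi3 : Integrable (fun ω => (ξ ω * (W u ω j - W s ω j)) * (η ω * (W u' ω k - W s ω k))) P :=
    (hW.memLp_mul_increment hsu hξ hξ2 j).integrable_mul
      (hW.memLp_mul_increment (hsu.trans huu') hη hη2 k)
  have hi1' : Integrable (fun ω => (ξ ω * η ω) * ((W u ω j - W s ω j) * (W u ω k - W s ω k))) P :=
    hi1.congr (ae_of_all _ fun ω => by ring)
  have hi2 : Integrable (fun ω => (η ω * (ξ ω * (W u ω j - W s ω j))) * (W u' ω k - W u ω k)) P :=
    (hi3.sub hi1).congr (ae_of_all _ fun ω => by simp only [Pi.sub_apply]; ring)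
  simp_rw [h1]
  rw [integral_add hi1' hi2,
    hW.integral_mul_increment_mul (X := fun ω => ξ ω * η ω) hsu (hξ.mul hη),
    hW.integral_mul_increment (X := fun ω => η ω * (ξ ω * (W u ω j - W s ω j))) huu'
      ((hη.mono (pastSigma_mono W hsu)).mul
      (aestronglyMeasurable_mul_increment hsu le_rfl hξ j)), add_zero, mul_comm]

/-- Cut the earlier interval at s'. The part before s' belongs to the past of the second increment
and contributes nothing; the rest starts at s', which is the case of a common left endpoint. -/
theorem integral_mul_increment_mul_mul_increment_of_le (hW : IsStandardBrownian W P)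
    {s u s' u' : ℝ≥0} (hsu : s ≤ u) (hsu' : s' ≤ u') (hss' : s ≤ s') {ξ η : Ω → ℝ}
    (hξ : AEStronglyMeasurable[pastSigma W s] ξ P) (hξ2 : MemLp ξ 2 P)
    (hη : AEStronglyMeasurable[pastSigma W s'] η P) (hη2 : MemLp η 2 P) (j k : Fin d) :
    ∫ ω, (ξ ω * (W u ω j - W s ω j)) * (η ω * (W u' ω k - W s' ω k)) ∂P
      = (if j = k then max 0 (min (u : ℝ) u' - max (s : ℝ) s') else 0) * ∫ ω, ξ ω * η ω ∂P := by
  have hR : ∀ r : ℝ≥0, r ≤ s' → s ≤ r →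
      ∫ ω, (ξ ω * (W r ω j - W s ω j)) * (η ω * (W u' ω k - W s' ω k)) ∂P = 0 := by
    intro r hr hsr
    have := hW.integral_mul_increment hsu' (X := fun ω => (ξ ω * (W r ω j - W s ω j)) * η ω)
      ((aestronglyMeasurable_mul_increment hsr hr hξ j).mul hη) k
    simpa only [mul_assoc] using this
  have hss'R : max (s : ℝ) s' = s' := max_eq_right (by exact_mod_cast hss')
  rcases le_total u s' with h | h
  · rw [hR u h hsu]
    have : max 0 (min (u : ℝ) u' - max (s : ℝ) s') = 0 := by
      rw [hss'R]
      refine max_eq_left ?_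
      have h1 : (u : ℝ) ≤ s' := by exact_mod_cast h
      linarith [min_le_left (u : ℝ) u']
    simp [this]
  · have h1 : ∀ ω, (ξ ω * (W u ω j - W s ω j)) * (η ω * (W u' ω k - W s' ω k))
      = (ξ ω * (W u ω j - W s' ω j)) * (η ω * (W u' ω k - W s' ω k))
        + (ξ ω * (W s' ω j - W s ω j)) * (η ω * (W u' ω k - W s' ω k)) := fun ω => by ring
    have hξ' := hξ.mono (pastSigma_mono W hss')
    have hd := hW.memLp_mul_increment hsu' hη hη2 k
    simp_rw [h1]
    have hi1 : Integrable (fun ω => (ξ ω * (W u ω j - W s' ω j)) * (η ω * (W u' ω k - W s' ω k))) P :=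
      (hW.memLp_mul_increment h hξ' hξ2 j).integrable_mul hd
    have hi2 : Integrable (fun ω => (ξ ω * (W s' ω j - W s ω j)) * (η ω * (W u' ω k - W s' ω k))) P :=
      (hW.memLp_mul_increment hss' hξ hξ2 j).integrable_mul hd
    rw [integral_add hi1 hi2, hR s' le_rfl hss', add_zero, hss'R]
    rcases le_total u u' with h2 | h2
    · rw [hW.integral_mul_increment_mul_mul_increment_of_eq h h2 hξ' hξ2 hη hη2,
        min_eq_left (by exact_mod_cast h2), max_eq_right (sub_nonneg.2 (by exact_mod_cast h))]
    · have h3 := hW.integral_mul_increment_mul_mul_increment_of_eq hsu' h2 hη hη2 hξ' hξ2 k j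
      rw [min_eq_right (by exact_mod_cast h2), max_eq_right (sub_nonneg.2 (by exact_mod_cast hsu'))]
      simp only [mul_comm (η _) (ξ _), eq_comm (a := k) (b := j)] at h3
      rw [← h3]
      exact integral_congr_ae (ae_of_all _ fun ω => mul_comm _ _)

theorem integral_mul_increment_mul_mul_increment (hW : IsStandardBrownian W P)
    {s u s' u' : ℝ≥0} (hsu : s ≤ u) (hsu' : s' ≤ u') {ξ η : Ω → ℝ}
    (hξ : AEStronglyMeasurable[pastSigma W s] ξ P) (hξ2 : MemLp ξ 2 P)
    (hη : AEStronglyMeasurable[pastSigma W s'] η P) (hη2 : MemLp η 2 P) (j k : Fin d) :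
    ∫ ω, (ξ ω * (W u ω j - W s ω j)) * (η ω * (W u' ω k - W s' ω k)) ∂P
      = (if j = k then max 0 (min (u : ℝ) u' - max (s : ℝ) s') else 0) * ∫ ω, ξ ω * η ω ∂P := by
  rcases le_total s s' with h | h
  · exact hW.integral_mul_increment_mul_mul_increment_of_le hsu hsu' h hξ hξ2 hη hη2 j k
  · have h3 := hW.integral_mul_increment_mul_mul_increment_of_le hsu' hsu h hη hη2 hξ hξ2 k j
    simp only [mul_comm (η _) (ξ _), eq_comm (a := k) (b := j), min_comm (u' : ℝ) u,
      max_comm (s' : ℝ) s] at h3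
    rw [← h3]
    exact integral_congr_ae (ae_of_all _ fun ω => mul_comm _ _)

end IsStandardBrownian

section ItoPair

variable {Ω : Type*} [MeasurableSpace Ω] {d : ℕ}

/-- The integrand `ξ e_j 1_{(s, u]}`. -/
noncomputable def itoStep (s u : ℝ≥0) (j : Fin d) (ξ : Ω → ℝ) (p : ℝ × Ω) :
    EuclideanSpace ℝ (Fin d) :=
  (Ioc (s : ℝ) u).indicator (fun _ => EuclideanSpace.single j (ξ p.2)) p.1

/-- The pairs of an integrand `ξ e_j 1_{(s, u]}` and its integral `ξ (W_u^j - W_s^j)`. -/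
def itoGenerators (W : ℝ≥0 → Ω → EuclideanSpace ℝ (Fin d)) (P : Measure Ω) (T : ℝ) :
    Set (Lp (EuclideanSpace ℝ (Fin d)) 2 ((volume.restrict (Icc 0 T)).prod P) × Lp ℝ 2 P) :=
  {q | ∃ (s u : ℝ≥0) (j : Fin d) (ξ : Ω → ℝ), s ≤ u ∧ (u : ℝ) ≤ T ∧
    AEStronglyMeasurable[pastSigma W s] ξ P ∧ MemLp ξ 2 P ∧
    q.1 =ᵐ[(volume.restrict (Icc 0 T)).prod P] itoStep s u j ξ ∧
    q.2 =ᵐ[P] fun ω => ξ ω * (W u ω j - W s ω j)}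

/-- The closed linear span of the elementary pairs. -/
noncomputable def itoSpace (W : ℝ≥0 → Ω → EuclideanSpace ℝ (Fin d)) (P : Measure Ω) (T : ℝ) :
    Submodule ℝ (Lp (EuclideanSpace ℝ (Fin d)) 2 ((volume.restrict (Icc 0 T)).prod P) × Lp ℝ 2 P) :=
  (Submodule.span ℝ (itoGenerators W P T)).topologicalClosure

/-- `Z` is the stochastic integral over `[0, T]` of the square integrable integrand `F`. -/
def IsItoPair (W : ℝ≥0 → Ω → EuclideanSpace ℝ (Fin d)) (P : Measure Ω) (T : ℝ)
    (F : ℝ × Ω → EuclideanSpace ℝ (Fin d)) (Z : Ω → ℝ) : Prop :=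
  ∃ q ∈ itoSpace W P T, q.1 =ᵐ[(volume.restrict (Icc 0 T)).prod P] F ∧ q.2 =ᵐ[P] Z

variable {W : ℝ≥0 → Ω → EuclideanSpace ℝ (Fin d)} {P : Measure Ω} {T : ℝ}

theorem itoStep_eq_smul (s u : ℝ≥0) (j : Fin d) (ξ : Ω → ℝ) (p : ℝ × Ω) :
    itoStep s u j ξ p = ((Ioc (s : ℝ) u).indicator (fun _ => (1 : ℝ)) p.1 * ξ p.2) •
      EuclideanSpace.single j (1 : ℝ) := by
  by_cases h : p.1 ∈ Ioc (s : ℝ) u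
  · ext i
    by_cases hi : i = j <;> simp [itoStep, h, hi]
  · simp [itoStep, h]

theorem memLp_itoStep [IsProbabilityMeasure P] {ξ : Ω → ℝ} (hξ : MemLp ξ 2 P) (s u : ℝ≥0)
    (j : Fin d) : MemLp (itoStep s u j ξ) 2 ((volume.restrict (Icc 0 T)).prod P) := by
  have h1 : MemLp (fun p : ℝ × Ω => ξ p.2) 2 ((volume.restrict (Icc 0 T)).prod P) :=
    hξ.comp_snd _
  have h2 : MemLp (fun p : ℝ × Ω => (Prod.fst ⁻¹' Ioc (s : ℝ) u).indicator (fun p => ξ p.2) p) 2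
      ((volume.restrict (Icc 0 T)).prod P) := h1.indicator (measurable_fst measurableSet_Ioc)
  refine MemLp.of_le_mul (c := 1) h2 ?_ (ae_of_all _ fun p => ?_)
  · have : itoStep s u j ξ = fun p : ℝ × Ω => ((Prod.fst ⁻¹' Ioc (s : ℝ) u).indicator
        (fun p => ξ p.2) p) • EuclideanSpace.single j (1 : ℝ) := by
      ext1 p
      rw [itoStep_eq_smul]
      by_cases h : p.1 ∈ Ioc (s : ℝ) u <;> simp [h]
    rw [this]
    exact h2.1.smul_const _
  · by_cases h : p.1 ∈ Ioc (s : ℝ) u <;> simp [itoStep, h]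

theorem volume_real_Ioc_inter {s u s' u' : ℝ≥0} (hu : (u : ℝ) ≤ T) :
    ∫ x, (Ioc (s : ℝ) u).indicator (fun _ => (1 : ℝ)) x * (Ioc (s' : ℝ) u').indicator (fun _ => (1 : ℝ)) x
      ∂(volume.restrict (Icc 0 T)) = max 0 (min (u : ℝ) u' - max (s : ℝ) s') := by
  have h1 : (fun x : ℝ => (Ioc (s : ℝ) u).indicator (fun _ => (1 : ℝ)) x *
      (Ioc (s' : ℝ) u').indicator (fun _ => (1 : ℝ)) x)
      = (Ioc (max (s : ℝ) s') (min (u : ℝ) u')).indicator fun _ => (1 : ℝ) := by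
    rw [← Ioc_inter_Ioc]
    ext x
    by_cases h : x ∈ Ioc (s : ℝ) u <;> by_cases h' : x ∈ Ioc (s' : ℝ) u' <;> simp [h, h']
  rw [h1, integral_indicator measurableSet_Ioc, Measure.restrict_restrict measurableSet_Ioc,
    inter_eq_left.2, setIntegral_const, smul_eq_mul, mul_one, Measure.real, Real.volume_Ioc,
    ENNReal.toReal_ofReal', max_comm]
  exact fun x hx => ⟨(NNReal.coe_nonneg _).trans ((le_max_left _ _).trans hx.1.le),
    (hx.2.trans (min_le_left _ _)).trans hu⟩

/-- The Itô isometry for one-step integrands: both sides equal the length of the overlap of the two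
time intervals times E[ξη] when j = k, and vanish otherwise. -/
theorem inner_fst_eq_inner_snd_of_mem_itoGenerators [IsProbabilityMeasure P]
    (hW : IsStandardBrownian W P)
    {q q' : Lp (EuclideanSpace ℝ (Fin d)) 2 ((volume.restrict (Icc 0 T)).prod P) × Lp ℝ 2 P}
    (hq : q ∈ itoGenerators W P T) (hq' : q' ∈ itoGenerators W P T) :
    inner ℝ q.1 q'.1 = inner ℝ q.2 q'.2 := by
  obtain ⟨s, u, j, ξ, hsu, huT, hξ, hξ2, h1, h2⟩ := hq
  obtain ⟨s', u', k, η, hsu', huT', hη, hη2, h1', h2'⟩ := hq'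
  rw [L2.inner_def, L2.inner_def]
  have hR : ∫ ω, inner ℝ (q.2 ω) (q'.2 ω) ∂P
      = ∫ ω, (ξ ω * (W u ω j - W s ω j)) * (η ω * (W u' ω k - W s' ω k)) ∂P := by
    refine integral_congr_ae ?_
    filter_upwards [h2, h2'] with ω e1 e2
    rw [e1, e2]; simp [mul_comm]
  have hL : ∫ p, inner ℝ (q.1 p) (q'.1 p) ∂((volume.restrict (Icc 0 T)).prod P)
      = ∫ p : ℝ × Ω, ((Ioc (s : ℝ) u).indicator (fun _ => (1 : ℝ)) p.1 *
          (Ioc (s' : ℝ) u').indicator (fun _ => (1 : ℝ)) p.1) *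
          ((if j = k then 1 else 0) * (ξ p.2 * η p.2)) ∂((volume.restrict (Icc 0 T)).prod P) := by
    refine integral_congr_ae ?_
    filter_upwards [h1, h1'] with p e1 e2
    rw [e1, e2, itoStep_eq_smul, itoStep_eq_smul, inner_smul_left, inner_smul_right]
    have : inner ℝ (EuclideanSpace.single j (1 : ℝ)) (EuclideanSpace.single k (1 : ℝ))
        = if j = k then (1 : ℝ) else 0 := by
      simp [EuclideanSpace.inner_single_left]
    rw [this]
    simp only [RCLike.conj_to_real]
    ring
  rw [hR, hL, integral_prod_mul (fun x => (Ioc (s : ℝ) u).indicator (fun _ => (1 : ℝ)) x *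
      (Ioc (s' : ℝ) u').indicator (fun _ => (1 : ℝ)) x)
    (fun ω => (if j = k then 1 else 0) * (ξ ω * η ω)), volume_real_Ioc_inter huT, integral_const_mul,
    hW.integral_mul_increment_mul_mul_increment hsu hsu' hξ hξ2 hη hη2]
  split_ifs <;> ring

/-- For fixed q the difference of the two inner products is a continuous linear functional of the
other pair, so its vanishing on generators extends to the closed span. This is done once in each
variable, with symmetry in between. -/
theorem inner_fst_eq_inner_snd [IsProbabilityMeasure P] (hW : IsStandardBrownian W P)
    {q q' : Lp (EuclideanSpace ℝ (Fin d)) 2 ((volume.restrict (Icc 0 T)).prod P) × Lp ℝ 2 P}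
    (hq : q ∈ itoSpace W P T) (hq' : q' ∈ itoSpace W P T) :
    inner ℝ q.1 q'.1 = inner ℝ q.2 q'.2 := by
  let φ : (Lp (EuclideanSpace ℝ (Fin d)) 2 ((volume.restrict (Icc 0 T)).prod P) × Lp ℝ 2 P) →
      (Lp (EuclideanSpace ℝ (Fin d)) 2 ((volume.restrict (Icc 0 T)).prod P) × Lp ℝ 2 P) →L[ℝ] ℝ :=
    fun q => (innerSL ℝ q.1).comp (ContinuousLinearMap.fst ℝ _ _) -
      (innerSL ℝ q.2).comp (ContinuousLinearMap.snd ℝ _ _)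
  have hφ : ∀ q r, φ q r = inner ℝ q.1 r.1 - inner ℝ q.2 r.2 := fun q r => rfl
  have key : ∀ q, (∀ r ∈ itoGenerators W P T, φ q r = 0) → ∀ r ∈ itoSpace W P T, φ q r = 0 := by
    intro q hq r hr
    have : itoSpace W P T ≤ LinearMap.ker (φ q : _ →ₗ[ℝ] ℝ) :=
      Submodule.topologicalClosure_minimal _ (Submodule.span_le.2 fun r hr => hq r hr)
        (ContinuousLinearMap.isClosed_ker (φ q))
    exact this hr
  have h1 : ∀ q ∈ itoGenerators W P T, ∀ r ∈ itoSpace W P T, φ q r = 0 := fun q hq =>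
    key q fun r hr => by
      rw [hφ, inner_fst_eq_inner_snd_of_mem_itoGenerators hW hq hr, sub_self]
  have h2 := key q (fun r hr => by
    rw [hφ, real_inner_comm, real_inner_comm r.2]; exact h1 r hr q hq) q' hq'
  rw [hφ] at h2
  linarith

theorem norm_fst_eq_norm_snd [IsProbabilityMeasure P] (hW : IsStandardBrownian W P)
    {q : Lp (EuclideanSpace ℝ (Fin d)) 2 ((volume.restrict (Icc 0 T)).prod P) × Lp ℝ 2 P}
    (hq : q ∈ itoSpace W P T) : ‖q.1‖ = ‖q.2‖ := by
  have := inner_fst_eq_inner_snd hW hq hq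
  rw [real_inner_self_eq_norm_sq, real_inner_self_eq_norm_sq] at this
  exact (sq_eq_sq₀ (norm_nonneg _) (norm_nonneg _)).1 this

namespace IsItoPair

variable {F G : ℝ × Ω → EuclideanSpace ℝ (Fin d)} {Z Y : Ω → ℝ}

theorem memLp_fst (h : IsItoPair W P T F Z) : MemLp F 2 ((volume.restrict (Icc 0 T)).prod P) := by
  obtain ⟨q, -, h1, -⟩ := h
  exact (memLp_congr_ae h1).1 (Lp.memLp q.1)

theorem memLp_snd (h : IsItoPair W P T F Z) : MemLp Z 2 P := by
  obtain ⟨q, -, -, h1⟩ := h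
  exact (memLp_congr_ae h1).1 (Lp.memLp q.2)

theorem congr (h : IsItoPair W P T F Z) (hF : F =ᵐ[(volume.restrict (Icc 0 T)).prod P] G)
    (hZ : Z =ᵐ[P] Y) : IsItoPair W P T G Y := by
  obtain ⟨q, hq, h1, h2⟩ := h
  exact ⟨q, hq, h1.trans hF, h2.trans hZ⟩

theorem add (h : IsItoPair W P T F Z) (h' : IsItoPair W P T G Y) :
    IsItoPair W P T (F + G) (Z + Y) := by
  obtain ⟨q, hq, h1, h2⟩ := h
  obtain ⟨q', hq', h1', h2'⟩ := h'
  exact ⟨q + q', Submodule.add_mem _ hq hq', (Lp.coeFn_add _ _).trans (h1.add h1'),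
    (Lp.coeFn_add _ _).trans (h2.add h2')⟩

theorem sub (h : IsItoPair W P T F Z) (h' : IsItoPair W P T G Y) :
    IsItoPair W P T (F - G) (Z - Y) := by
  obtain ⟨q, hq, h1, h2⟩ := h
  obtain ⟨q', hq', h1', h2'⟩ := h'
  exact ⟨q - q', Submodule.sub_mem _ hq hq', (Lp.coeFn_sub _ _).trans (h1.sub h1'),
    (Lp.coeFn_sub _ _).trans (h2.sub h2')⟩

theorem const_smul (c : ℝ) (h : IsItoPair W P T F Z) : IsItoPair W P T (c • F) (c • Z) := by
  obtain ⟨q, hq, h1, h2⟩ := h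
  exact ⟨c • q, Submodule.smul_mem _ c hq, (Lp.coeFn_smul c _).trans (h1.const_smul c),
    (Lp.coeFn_smul c _).trans (h2.const_smul c)⟩

theorem zero : IsItoPair W P T (0 : ℝ × Ω → EuclideanSpace ℝ (Fin d)) 0 :=
  ⟨0, Submodule.zero_mem _, Lp.coeFn_zero _ _ _, Lp.coeFn_zero _ _ _⟩

theorem sum {ι : Type*} (s : Finset ι) {F : ι → ℝ × Ω → EuclideanSpace ℝ (Fin d)}
    {Z : ι → Ω → ℝ} (h : ∀ i ∈ s, IsItoPair W P T (F i) (Z i)) :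
    IsItoPair W P T (∑ i ∈ s, F i) (∑ i ∈ s, Z i) := by
  classical
  induction s using Finset.induction_on with
  | empty => simpa using zero
  | insert i s hi ih =>
    rw [Finset.sum_insert hi, Finset.sum_insert hi]
    exact (h i (Finset.mem_insert_self _ _)).add (ih fun k hk => h k (Finset.mem_insert_of_mem hk))

theorem itoStep [IsProbabilityMeasure P] (hW : IsStandardBrownian W P) {s u : ℝ≥0} (hsu : s ≤ u)
    (hu : (u : ℝ) ≤ T) (j : Fin d) {ξ : Ω → ℝ} (hξ : AEStronglyMeasurable[pastSigma W s] ξ P)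
    (hξ2 : MemLp ξ 2 P) :
    IsItoPair W P T (itoStep s u j ξ) (fun ω => ξ ω * (W u ω j - W s ω j)) :=
  ⟨((memLp_itoStep hξ2 s u j).toLp _, (hW.memLp_mul_increment hsu hξ hξ2 j).toLp _),
    Submodule.le_topologicalClosure _ (Submodule.subset_span
      ⟨s, u, j, ξ, hsu, hu, hξ, hξ2, MemLp.coeFn_toLp (memLp_itoStep hξ2 s u j),
        MemLp.coeFn_toLp (hW.memLp_mul_increment hsu hξ hξ2 j)⟩),
    MemLp.coeFn_toLp (memLp_itoStep hξ2 s u j),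
    MemLp.coeFn_toLp (hW.memLp_mul_increment hsu hξ hξ2 j)⟩

/-- The Itô isometry. -/
theorem eLpNorm_eq [IsProbabilityMeasure P] (hW : IsStandardBrownian W P)
    (h : IsItoPair W P T F Z) :
    eLpNorm Z 2 P = eLpNorm F 2 ((volume.restrict (Icc 0 T)).prod P) := by
  obtain ⟨q, hq, h1, h2⟩ := h
  rw [← eLpNorm_congr_ae h1, ← eLpNorm_congr_ae h2, ← Lp.enorm_def, ← Lp.enorm_def,
    ← ofReal_norm, ← ofReal_norm, norm_fst_eq_norm_snd hW hq]

/-- Stochastic integrals depend continuously on the integrand. -/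
theorem of_tendsto [IsProbabilityMeasure P] (hW : IsStandardBrownian W P)
    {Fn : ℕ → ℝ × Ω → EuclideanSpace ℝ (Fin d)} {Zn : ℕ → Ω → ℝ}
    (h : ∀ n, IsItoPair W P T (Fn n) (Zn n))
    (hF : MemLp F 2 ((volume.restrict (Icc 0 T)).prod P))
    (hFn : Tendsto (fun n => eLpNorm (Fn n - F) 2 ((volume.restrict (Icc 0 T)).prod P)) atTop (𝓝 0))
    (hZ : ∀ᵐ ω ∂P, Tendsto (fun n => Zn n ω) atTop (𝓝 (Z ω))) : IsItoPair W P T F Z := by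
  choose q hq h1 h2 using h
  have hq1 : Tendsto (fun n => (q n).1) atTop (𝓝 (hF.toLp F)) := by
    rw [Lp.tendsto_Lp_iff_tendsto_eLpNorm']
    refine hFn.congr fun n => eLpNorm_congr_ae ?_
    exact ((h1 n).sub hF.coeFn_toLp).symm
  -- By the isometry, convergence of the integrands makes the integrals Cauchy in L²; an almost
  -- surely convergent subsequence then identifies their limit with Z.
  have hc : CauchySeq fun n => (q n).2 := by
    have hc1 := hq1.cauchySeq
    rw [Metric.cauchySeq_iff] at hc1 ⊢
    intro ε hε
    obtain ⟨N, hN⟩ := hc1 ε hε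
    refine ⟨N, fun m hm n hn => ?_⟩
    have := norm_fst_eq_norm_snd hW (Submodule.sub_mem _ (hq m) (hq n))
    rw [dist_eq_norm]
    simp only [Prod.fst_sub, Prod.snd_sub] at this
    rw [← this, ← dist_eq_norm]
    exact hN m hm n hn
  obtain ⟨z, hz⟩ := cauchySeq_tendsto_of_complete hc
  have hmem : (hF.toLp F, z) ∈ itoSpace W P T :=
    (Submodule.isClosed_topologicalClosure _).mem_of_tendsto (hq1.prodMk_nhds hz)
      (Eventually.of_forall hq)
  refine ⟨_, hmem, hF.coeFn_toLp, ?_⟩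
  obtain ⟨ns, hns, hae⟩ := (tendstoInMeasure_of_tendsto_Lp hz).exists_seq_tendsto_ae
  have h2' : ∀ᵐ ω ∂P, ∀ n, (q n).2 ω = Zn n ω := ae_all_iff.2 h2
  filter_upwards [hae, hZ, h2'] with ω e1 e2 e3
  refine tendsto_nhds_unique e1 ?_
  simp_rw [e3]
  exact e2.comp hns.tendsto_atTop

end IsItoPair

end ItoPair

/-! ### Truncation of integrands at a time, and integration by parts -/

section UpTo

variable {Ω : Type*} {E : Type*} [NormedAddCommGroup E]

/-- The integrand `H 1_{(0, t]}`, as a function of the pair `(u, ω)`. -/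
noncomputable def upTo (t : ℝ) (H : ℝ → Ω → E) (p : ℝ × Ω) : E :=
  (Ioc 0 t).indicator (fun u => H u p.2) p.1

theorem upTo_eq_indicator (t : ℝ) (H : ℝ → Ω → E) :
    upTo t H = (Prod.fst ⁻¹' Ioc 0 t).indicator fun p : ℝ × Ω => H p.1 p.2 := by
  ext p
  by_cases h : p.1 ∈ Ioc 0 t <;> simp [upTo, h]

theorem upTo_sub (t : ℝ) (H H' : ℝ → Ω → E) :
    upTo t (fun u ω => H u ω - H' u ω) = upTo t H - upTo t H' := by
  ext p
  by_cases h : p.1 ∈ Ioc 0 t <;> simp [upTo, h]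

theorem upTo_sum {ι : Type*} (s : Finset ι) (t : ℝ) (H : ι → ℝ → Ω → E) :
    upTo t (fun u ω => ∑ i ∈ s, H i u ω) = ∑ i ∈ s, upTo t (H i) := by
  ext p
  by_cases h : p.1 ∈ Ioc 0 t <;> simp [upTo, h]

theorem norm_upTo_le (t : ℝ) (H : ℝ → Ω → E) (p : ℝ × Ω) : ‖upTo t H p‖ ≤ ‖H p.1 p.2‖ := by
  by_cases h : p.1 ∈ Ioc 0 t <;> simp [upTo, h]

theorem memLp_upTo [MeasurableSpace Ω] {μ : Measure (ℝ × Ω)} {H : ℝ → Ω → E}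
    (hH : MemLp (fun p : ℝ × Ω => H p.1 p.2) 2 μ) (t : ℝ) : MemLp (upTo t H) 2 μ := by
  rw [upTo_eq_indicator]
  exact hH.indicator (measurable_fst measurableSet_Ioc)

theorem eLpNorm_upTo_sub_le [MeasurableSpace Ω] {μ : Measure (ℝ × Ω)} (H H' : ℝ → Ω → E) (t : ℝ) :
    eLpNorm (upTo t H - upTo t H') 2 μ ≤ eLpNorm (fun p : ℝ × Ω => H p.1 p.2 - H' p.1 p.2) 2 μ := by
  rw [← upTo_sub]
  exact eLpNorm_mono fun p => norm_upTo_le t _ p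

end UpTo

theorem exists_pos_ofReal_mul_le {C δ : ℝ≥0∞} (hC : C ≠ ∞) (hδ : 0 < δ) :
    ∃ ε : ℝ, 0 < ε ∧ ENNReal.ofReal ε * C ≤ δ := by
  rcases eq_or_ne δ ∞ with rfl | hδt
  · exact ⟨1, one_pos, le_top⟩
  have h1 : 0 < δ.toReal := ENNReal.toReal_pos hδ.ne' hδt
  refine ⟨δ.toReal / (C.toReal + 1), by positivity, ?_⟩
  rw [← ENNReal.ofReal_toReal hC, ← ENNReal.ofReal_mul (by positivity)]
  refine ENNReal.ofReal_le_of_le_toReal ?_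
  rw [ENNReal.toReal_ofReal ENNReal.toReal_nonneg, div_mul_eq_mul_div, div_le_iff₀ (by positivity)]
  nlinarith

section

variable {Ω : Type*} [MeasurableSpace Ω] {d : ℕ} {W : ℝ≥0 → Ω → EuclideanSpace ℝ (Fin d)}
  {P : Measure Ω} [IsProbabilityMeasure P] {T : ℝ}

theorem IsItoPair.indicator_Ioc (hW : IsStandardBrownian W P) {s u : ℝ≥0} (hsu : s ≤ u)
    (hu : (u : ℝ) ≤ T) {ξ : Ω → EuclideanSpace ℝ (Fin d)}
    (hξ : AEStronglyMeasurable[pastSigma W s] ξ P) (hξ2 : MemLp ξ 2 P) :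
    IsItoPair W P T (fun p => (Ioc (s : ℝ) u).indicator (fun _ => ξ p.2) p.1)
      (fun ω => inner ℝ (ξ ω) (W u ω - W s ω)) := by
  have h1 : ∀ j : Fin d, AEStronglyMeasurable[pastSigma W s] (fun ω => ξ ω j) P := fun j =>
    (EuclideanSpace.proj j : EuclideanSpace ℝ (Fin d) →L[ℝ] ℝ).continuous.comp_aestronglyMeasurable
      hξ
  have h2 : ∀ j : Fin d, MemLp (fun ω => ξ ω j) 2 P := fun j =>
    (EuclideanSpace.proj j : EuclideanSpace ℝ (Fin d) →L[ℝ] ℝ).comp_memLp' hξ2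
  have h := IsItoPair.sum Finset.univ fun j _ => IsItoPair.itoStep hW hsu hu j (h1 j) (h2 j)
  convert! h using 1
  · ext p i
    by_cases hp : p.1 ∈ Ioc (s : ℝ) u
    · simp [_root_.itoStep, hp, Finset.sum_apply, Pi.single_apply]
    · simp [_root_.itoStep, hp, Finset.sum_apply]
  · ext ω
    simp [PiLp.inner_apply, Finset.sum_apply, mul_comm]

/-- Links the elementary integrals of the definition to `itoSpace`. The grid of an elementary
process may run beyond T, but stopping at t ≤ T shortens each cell to one inside [0, T], or empties
it. -/
theorem ElementaryProcess.isItoPair (hW : IsStandardBrownian W P) (H : ElementaryProcess W P)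
    {t : ℝ} (ht : t ∈ Icc 0 T) :
    IsItoPair W P T (upTo t H.val) (H.integral t.toNNReal) := by
  have htc : (t.toNNReal : ℝ) = t := Real.coe_toNNReal _ ht.1
  have h1 : upTo t H.val = ∑ i ∈ Finset.range H.n, upTo t fun u ω =>
      (Ioc (H.time i : ℝ) (H.time (i + 1))).indicator (fun _ => H.ξ i ω) u := by
    rw [← upTo_sum]; rfl
  have h2 : H.integral t.toNNReal = ∑ i ∈ Finset.range H.n, fun ω =>
      inner ℝ (H.ξ i ω) (W (min t.toNNReal (H.time (i + 1))) ω - W (min t.toNNReal (H.time i)) ω) := by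
    ext ω; simp [ElementaryProcess.integral]
  rw [h1, h2]
  refine IsItoPair.sum _ fun i _ => ?_
  rcases le_total (H.time i) t.toNNReal with h | h
  · rw [min_eq_right h]
    have hle : (H.time i : ℝ) ≤ t := by rw [← htc]; exact_mod_cast h
    have := IsItoPair.indicator_Ioc (T := T) hW (s := H.time i) (u := min t.toNNReal (H.time (i + 1)))
      (le_min h (H.time_mono i.le_succ)) (by rw [NNReal.coe_min, htc]; exact (min_le_left _ _).trans ht.2)
      (H.ξ_adapted i) (H.ξ_sq i)
    convert! this using 1
    ext1 p
    simp only [upTo, NNReal.coe_min, htc]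
    have h0 : (0 : ℝ) ≤ H.time i := NNReal.coe_nonneg _
    by_cases hp : p.1 ∈ Ioc (H.time i : ℝ) (min t (H.time (i + 1)))
    · have hp1 : p.1 ∈ Ioc 0 t := ⟨h0.trans_lt hp.1, hp.2.trans (min_le_left _ _)⟩
      have hp2 : p.1 ∈ Ioc (H.time i : ℝ) (H.time (i + 1)) := ⟨hp.1, hp.2.trans (min_le_right _ _)⟩
      rw [indicator_of_mem hp, indicator_of_mem hp1, indicator_of_mem hp2]
    · rw [indicator_of_notMem hp]
      by_cases hp1 : p.1 ∈ Ioc 0 t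
      · rw [indicator_of_mem hp1, indicator_of_notMem fun hp2 => hp ⟨hp2.1, le_min hp1.2 hp2.2⟩]
      · rw [indicator_of_notMem hp1]
  · rw [min_eq_left h, min_eq_left (h.trans (H.time_mono i.le_succ))]
    have hle : t ≤ (H.time i : ℝ) := by rw [← htc]; exact_mod_cast h
    convert! IsItoPair.zero using 1
    · ext1 p
      by_cases hp1 : p.1 ∈ Ioc 0 t
      · simp only [upTo, indicator_of_mem hp1, Pi.zero_apply]
        exact indicator_of_notMem (fun hp2 => absurd hp2.1 (by have := hp1.2; linarith)) _
      · simp [upTo, indicator_of_notMem hp1]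
    · ext ω; simp

theorem IsItoPair.of_tendsto_eLpNorm (hW : IsStandardBrownian W P)
    {Fn : ℕ → ℝ × Ω → EuclideanSpace ℝ (Fin d)} {Zn : ℕ → Ω → ℝ}
    {F : ℝ × Ω → EuclideanSpace ℝ (Fin d)} {Z : Ω → ℝ}
    (h : ∀ n, IsItoPair W P T (Fn n) (Zn n))
    (hF : MemLp F 2 ((volume.restrict (Icc 0 T)).prod P))
    (hFn : Tendsto (fun n => eLpNorm (Fn n - F) 2 ((volume.restrict (Icc 0 T)).prod P)) atTop (𝓝 0))
    (hZ : MemLp Z 2 P) (hZn : Tendsto (fun n => eLpNorm (Zn n - Z) 2 P) atTop (𝓝 0)) :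
    IsItoPair W P T F Z := by
  obtain ⟨ns, hns, hae⟩ := (tendstoInMeasure_of_tendsto_eLpNorm (by norm_num)
    (fun n => (h n).memLp_snd.1) hZ.1 hZn).exists_seq_tendsto_ae
  exact IsItoPair.of_tendsto hW (fun n => h (ns n)) hF (hFn.comp hns.tendsto_atTop) hae

/-- For the uniqueness argument this is all that is retained of an Itô integral: at each fixed time
it is paired with its truncated integrand, hence linear and isometric in it. -/
theorem IsItoIntegral.isItoPair (hW : IsStandardBrownian W P)
    {H : ℝ → Ω → EuclideanSpace ℝ (Fin d)} {I : ℝ → Ω → ℝ} (h : IsItoIntegral W P T H I)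
    {t : ℝ} (ht : t ∈ Icc 0 T) : IsItoPair W P T (upTo t H) (I t) := by
  obtain ⟨hH, hI, Hn, h1, h2⟩ := h
  refine IsItoPair.of_tendsto_eLpNorm hW (fun n => (Hn n).isItoPair hW ht) (memLp_upTo hH t) ?_
    (hI t ht) (h2 t ht)
  exact tendsto_of_tendsto_of_tendsto_of_le_of_le tendsto_const_nhds h1 (fun _ => zero_le)
    fun n => eLpNorm_upTo_sub_le _ _ t

/-- Integration by parts of a stochastic integral against a deterministic absolutely continuous
function. -/
theorem IsItoPair.integration_by_parts (hT : 0 ≤ T) (hW : IsStandardBrownian W P)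
    {H : ℝ → Ω → EuclideanSpace ℝ (Fin d)} {I : ℝ → Ω → ℝ}
    (hp : ∀ t ∈ Icc 0 T, IsItoPair W P T (upTo t H) (I t))
    (hc : ∀ᵐ ω ∂P, ContinuousOn (fun t => I t ω) (Icc 0 T)) {h h' : ℝ → ℝ}
    (hh' : IntegrableOn h' (Icc 0 T)) (hh : ∀ t ∈ Icc 0 T, h t = h 0 + ∫ u in (0 : ℝ)..t, h' u)
    {t : ℝ} (ht : t ∈ Icc 0 T) :
    IsItoPair W P T (upTo t fun u ω => h u • H u ω)
      (fun ω => h t * I t ω - ∫ u in (0 : ℝ)..t, I u ω * h' u) := by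
  have hhc : ContinuousOn h (Icc 0 T) :=
    (continuousOn_const.add (continuousOn_primitive_zero hh')).congr hh
  have hI0 : ∀ᵐ ω ∂P, I 0 ω = 0 := by
    have h0 := (hp 0 ⟨le_rfl, hT⟩)
    have h1 := h0.eLpNorm_eq hW
    have h2 : upTo 0 H = 0 := by ext1 p; simp [upTo]
    rw [h2, eLpNorm_zero, eLpNorm_eq_zero_iff h0.memLp_snd.1 (by norm_num)] at h1
    exact h1
  have hHT := (hp T ⟨hT, le_rfl⟩).memLp_fst
  have hmin : ∀ N i, N ≠ 0 → i < N + 1 → min t (gridTime T N i : ℝ) ∈ Icc 0 T := fun N i _ _ =>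
    ⟨le_min ht.1 (NNReal.coe_nonneg _), (min_le_left _ _).trans ht.2⟩
  have hbd : ∀ ε > 0, ∀ᶠ N : ℕ in atTop, ∀ u ∈ Ioc 0 T,
      ‖gridStep T N (fun i => h (gridTime T N i)) u - h u‖ ≤ ε := by
    intro ε hε
    obtain ⟨δ, hδ, hδh⟩ := Metric.uniformContinuousOn_iff.1
      (isCompact_Icc.uniformContinuousOn_of_continuous hhc) ε hε
    filter_upwards [eventually_mesh_lt (T := T) hδ] with N hN u hu
    exact norm_gridStep_sub_le hT hN.1 (fun s hs u hu hsu => by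
      rw [← dist_eq_norm]
      exact (hδh s hs u hu (by rw [Real.dist_eq]; exact hsu.trans_lt hN.2)).le) hu
  -- The integrand belonging to the Riemann sum of h against I is H on (0, t], with h replaced by
  -- its left-endpoint step function.
  have hpt : ∀ (N : ℕ) (p : ℝ × Ω),
      (∑ i ∈ Finset.range N, h (gridTime T N i) • (upTo (min t (gridTime T N (i + 1))) H
        - upTo (min t (gridTime T N i)) H)) p
      = (Ioc 0 t).indicator (fun u => gridStep T N (fun i => h (gridTime T N i)) u • H u p.2) p.1 := by
    intro N p
    simp only [Finset.sum_apply, Pi.smul_apply, Pi.sub_apply, gridStep]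
    have hterm : ∀ i, h (gridTime T N i) • (upTo (min t (gridTime T N (i + 1))) H p
        - upTo (min t (gridTime T N i)) H p) = (Ioc 0 t).indicator (fun u =>
          (Ioc (gridTime T N i : ℝ) (gridTime T N (i + 1))).indicator
            (fun _ => h (gridTime T N i)) u • H u p.2) p.1 := by
      intro i
      have hm : (gridTime T N i : ℝ) ≤ gridTime T N (i + 1) := gridTime_mono T N i.le_succ
      have h0 : (0 : ℝ) ≤ gridTime T N i := NNReal.coe_nonneg _
      simp only [upTo, indicator, mem_Ioc, le_min_iff]
      split_ifs <;> first | (exfalso; grind) | simp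
    rw [Finset.sum_congr rfl fun i _ => hterm i]
    by_cases hp1 : p.1 ∈ Ioc 0 t
    · simp [hp1, Finset.sum_smul]
    · simp [hp1]
  have hFm : MemLp (upTo t fun u ω => h u • H u ω) 2 ((volume.restrict (Icc 0 T)).prod P) := by
    obtain ⟨C, hC⟩ := isCompact_Icc.exists_bound_of_continuousOn hhc
    have hm : AEStronglyMeasurable (fun p : ℝ × Ω => h p.1) ((volume.restrict (Icc 0 T)).prod P) :=
      (hhc.aestronglyMeasurable measurableSet_Icc).comp_fst
    have heq : (upTo t fun u ω => h u • H u ω)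
        = (Prod.fst ⁻¹' Ioc 0 t).indicator fun p : ℝ × Ω => h p.1 • upTo T H p := by
      ext1 p
      by_cases hp1 : p.1 ∈ Ioc 0 t
      · have hp2 : p.1 ∈ Ioc 0 T := ⟨hp1.1, hp1.2.trans ht.2⟩
        simp [upTo, indicator_of_mem hp2, hp1]
      · simp [upTo, hp1]
    rw [heq]
    refine MemLp.indicator (measurable_fst measurableSet_Ioc) ?_
    refine hHT.of_le_mul (c := C) (hm.smul hHT.1) ?_
    filter_upwards [Measure.quasiMeasurePreserving_fst.ae (ae_mem_Ioc_restrict_Icc T)] with p hp1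
    rw [norm_smul]
    gcongr
    exact hC _ ⟨hp1.1.le, hp1.2⟩
  -- The integrands converge in L² because the step functions converge to h uniformly on (0, T]; the
  -- integrals converge pathwise by `tendsto_sum_mul_sub_grid`.
  refine IsItoPair.of_tendsto hW (Fn := fun N => ∑ i ∈ Finset.range N, h (gridTime T N i) •
      (upTo (min t (gridTime T N (i + 1))) H - upTo (min t (gridTime T N i)) H))
    (Zn := fun N => ∑ i ∈ Finset.range N, h (gridTime T N i) •
      (I (min t (gridTime T N (i + 1))) - I (min t (gridTime T N i)))) (fun N => ?_) hFm ?_ ?_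
  · rcases eq_or_ne N 0 with rfl | hN
    · simpa using IsItoPair.zero
    refine IsItoPair.sum _ fun i hi => ?_
    have hi' := Finset.mem_range.1 hi
    exact ((hp _ (hmin N _ hN (by omega))).sub (hp _ (hmin N _ hN (by omega)))).const_smul _
  · rw [ENNReal.tendsto_nhds_zero]
    intro δ hδ
    obtain ⟨ε, hε, hεδ⟩ := exists_pos_ofReal_mul_le hHT.2.ne hδ
    filter_upwards [hbd ε hε] with N hN
    refine le_trans ?_ hεδ
    refine eLpNorm_le_mul_eLpNorm_of_ae_le_mul ?_ 2
    filter_upwards [Measure.quasiMeasurePreserving_fst.ae (ae_mem_Ioc_restrict_Icc T)] with p hp1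
    rw [Pi.sub_apply, hpt]
    by_cases hp2 : p.1 ∈ Ioc 0 t
    · simp only [upTo, indicator_of_mem hp2, indicator_of_mem hp1]
      rw [← sub_smul, norm_smul]
      gcongr
      exact hN _ hp1
    · simp only [upTo, indicator_of_notMem hp2, sub_zero, norm_zero]
      positivity
  · filter_upwards [hc, hI0] with ω h1 h2
    refine (tendsto_sum_mul_sub_grid hT hh' hh h1 h2 ht).congr fun N => ?_
    simp [Finset.sum_apply]

end

/-! ### Wiener integrals of deterministic functions are Gaussian -/

section GaussianSpace

variable {Ω : Type*} [MeasurableSpace Ω] {d : ℕ} {W : ℝ≥0 → Ω → EuclideanSpace ℝ (Fin d)}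
  {P : Measure Ω} [IsProbabilityMeasure P] {T : ℝ}

/-- The Gaussian Hilbert space generated by the Brownian motion. -/
noncomputable def gaussianSpace (hW : IsStandardBrownian W P) : Submodule ℝ (Lp ℝ 2 P) :=
  (Submodule.span ℝ (range fun p : Fin d × ℝ≥0 =>
    (hW.memLp_coord p.2 p.1).toLp (fun ω => W p.2 ω p.1))).topologicalClosure

theorem map_eq_gaussianReal_of_mem_span (hW : IsStandardBrownian W P) {q : Lp ℝ 2 P}
    (hq : q ∈ Submodule.span ℝ (range fun p : Fin d × ℝ≥0 =>
      (hW.memLp_coord p.2 p.1).toLp (fun ω => W p.2 ω p.1))) :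
    P.map q = gaussianReal 0 (‖q‖ ^ 2).toNNReal := by
  obtain ⟨c, rfl⟩ := Finsupp.mem_span_range_iff_exists_finsupp.1 hq
  set q := c.sum fun i a => a • (hW.memLp_coord i.2 i.1).toLp (fun ω => W i.2 ω i.1) with hqdef
  have hae : q =ᵐ[P] fun ω => ∑ p ∈ c.support, c p • W p.2 ω p.1 := by
    have h1 : ∀ᵐ ω ∂P, ∀ p ∈ c.support,
        (c p • (hW.memLp_coord p.2 p.1).toLp (fun ω => W p.2 ω p.1) : Lp ℝ 2 P) ω
          = c p • W p.2 ω p.1 := by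
      refine (ae_ball_iff (Finset.countable_toSet _)).2 fun p _ => ?_
      filter_upwards [Lp.coeFn_smul (c p) ((hW.memLp_coord p.2 p.1).toLp (fun ω => W p.2 ω p.1)),
        (hW.memLp_coord p.2 p.1).coeFn_toLp] with ω e1 e2
      rw [e1, Pi.smul_apply, e2]
    have h2 : (q : Ω → ℝ) =ᵐ[P] fun ω => ∑ p ∈ c.support,
        (c p • (hW.memLp_coord p.2 p.1).toLp (fun ω => W p.2 ω p.1) : Lp ℝ 2 P) ω := by
      rw [hqdef, Finsupp.sum]
      filter_upwards [Lp.coeFn_finsetSum c.support fun p =>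
        (c p • (hW.memLp_coord p.2 p.1).toLp (fun ω => W p.2 ω p.1) : Lp ℝ 2 P)] with ω e
      rw [e, Finset.sum_apply]
    filter_upwards [h1, h2] with ω e1 e2
    rw [e2]
    exact Finset.sum_congr rfl e1
  have hG : HasGaussianLaw (fun ω => ∑ p ∈ c.support, c p • W p.2 ω p.1) P :=
    (hW.isGaussianProcess.smul c).hasGaussianLaw_fun_sum
  have hmean : ∫ ω, ∑ p ∈ c.support, c p • W p.2 ω p.1 ∂P = 0 := by
    have hi : ∀ p ∈ c.support, Integrable (fun ω => c p • W p.2 ω p.1) P := fun p _ =>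
      ((hW.memLp_coord p.2 p.1).integrable (by norm_num)).smul (c p)
    rw [integral_finsetSum _ hi]
    refine Finset.sum_eq_zero fun p _ => ?_
    rw [integral_smul, hW.integral_coord, smul_zero]
  rw [Measure.map_congr hae, hG.map_eq_gaussianReal, hmean]
  congr 2
  rw [variance_of_integral_eq_zero hG.aemeasurable hmean, ← real_inner_self_eq_norm_sq, L2.inner_def]
  refine integral_congr_ae ?_
  filter_upwards [hae] with ω hω
  rw [hω]
  simp [sq]

/-- Centred Gaussian laws are stable under L² limits: along an almost surely convergent subsequence
the characteristic functions converge by dominated convergence, and in the Gaussian case they depend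
continuously on the L² norm. -/
theorem map_eq_gaussianReal_of_mem_gaussianSpace (hW : IsStandardBrownian W P) {q : Lp ℝ 2 P}
    (hq : q ∈ gaussianSpace hW) : P.map q = gaussianReal 0 (‖q‖ ^ 2).toNNReal := by
  obtain ⟨qn, hqn, hlim⟩ := mem_closure_iff_seq_limit.1 hq
  obtain ⟨ns, hns, hae⟩ := (tendstoInMeasure_of_tendsto_Lp hlim).exists_seq_tendsto_ae
  have hm : ∀ q : Lp ℝ 2 P, AEMeasurable q P := fun q => (Lp.aestronglyMeasurable q).aemeasurable
  have : IsProbabilityMeasure (P.map q) := Measure.isProbabilityMeasure_map (hm q)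
  have hcf : ∀ (q : Lp ℝ 2 P) (t : ℝ), charFun (P.map q) t
      = ∫ ω, Complex.exp (t * q ω * Complex.I) ∂P := fun q t => by
    rw [charFun_apply_real, integral_map (hm q) (by fun_prop)]
  refine Measure.ext_of_charFun (funext fun t => ?_)
  have h1 : Tendsto (fun n => charFun (P.map (qn (ns n))) t) atTop (𝓝 (charFun (P.map q) t)) := by
    simp_rw [hcf]
    refine tendsto_integral_of_dominated_convergence (fun _ => 1) (fun n => ?_)
      (integrable_const _) (fun n => ae_of_all _ fun ω => ?_) ?_
    · have := Lp.aestronglyMeasurable (qn (ns n))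
      have hc : Continuous fun x : ℝ => Complex.exp (t * x * Complex.I) := by fun_prop
      exact hc.comp_aestronglyMeasurable this
    · rw [← Complex.ofReal_mul, Complex.norm_exp_ofReal_mul_I]
    · filter_upwards [hae] with ω hω
      have hc : Continuous fun x : ℝ => Complex.exp (t * x * Complex.I) := by fun_prop
      exact (hc.tendsto _).comp hω
  have h2 : Tendsto (fun n => charFun (P.map (qn (ns n))) t) atTop
      (𝓝 (charFun (gaussianReal 0 (‖q‖ ^ 2).toNNReal) t)) := by
    have h3 : ∀ q : Lp ℝ 2 P, charFun (gaussianReal 0 (‖q‖ ^ 2).toNNReal) t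
        = Complex.exp (-((‖q‖ ^ 2 : ℝ) * t ^ 2 / 2)) := fun q => by
      rw [charFun_gaussianReal, Real.coe_toNNReal _ (by positivity)]
      simp
    have h4 : ∀ n, charFun (P.map (qn (ns n))) t = Complex.exp (-((‖qn (ns n)‖ ^ 2 : ℝ) * t ^ 2 / 2)) :=
      fun n => by rw [map_eq_gaussianReal_of_mem_span hW (hqn _), h3]
    simp_rw [h4, h3]
    have hc : Continuous fun x : ℝ => Complex.exp (-((x ^ 2 : ℝ) * t ^ 2 / 2)) := by fun_prop
    exact (hc.tendsto _).comp (hlim.norm.comp hns.tendsto_atTop)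
  exact tendsto_nhds_unique h1 h2

/-- `Z` is the Wiener integral over `[0, T]` of the deterministic square integrable `f`. -/
def IsWienerPair (hW : IsStandardBrownian W P) (T : ℝ) (f : ℝ → EuclideanSpace ℝ (Fin d))
    (Z : Ω → ℝ) : Prop :=
  IsItoPair W P T (fun p => f p.1) Z ∧ ∃ q ∈ gaussianSpace hW, q =ᵐ[P] Z

variable {hW : IsStandardBrownian W P}

theorem memLp_of_comp_fst {E : Type*} [NormedAddCommGroup E] {f : ℝ → E}
    (h : MemLp (fun p : ℝ × Ω => f p.1) 2 ((volume.restrict (Icc 0 T)).prod P)) :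
    MemLp f 2 (volume.restrict (Icc 0 T)) := by
  have h1 : (volume.restrict (Icc 0 T)) =
      ((volume.restrict (Icc 0 T)).prod P).map Prod.fst := by
    rw [Measure.map_fst_prod]; simp
  have hasm : AEStronglyMeasurable f (volume.restrict (Icc 0 T)) := by
    obtain ⟨ω, hω⟩ := (h.1.prodMk_right).exists
    exact hω
  rw [h1] at hasm ⊢
  exact (memLp_map_measure_iff hasm measurable_fst.aemeasurable).2 h

theorem eLpNorm_comp_fst {E : Type*} [NormedAddCommGroup E] {f : ℝ → E}
    (h : AEStronglyMeasurable f (volume.restrict (Icc 0 T))) :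
    eLpNorm (fun p : ℝ × Ω => f p.1) 2 ((volume.restrict (Icc 0 T)).prod P)
      = eLpNorm f 2 (volume.restrict (Icc 0 T)) := by
  have h1 : (volume.restrict (Icc 0 T)) =
      ((volume.restrict (Icc 0 T)).prod P).map Prod.fst := by
    rw [Measure.map_fst_prod]; simp
  conv_rhs => rw [h1]
  rw [eLpNorm_map_measure (by rw [← h1]; exact h) measurable_fst.aemeasurable]
  rfl

theorem integral_norm_sq_eq_of_eLpNorm_eq {α β E F : Type*} [MeasurableSpace α] [MeasurableSpace β]
    [NormedAddCommGroup E] [NormedAddCommGroup F] {μ : Measure α} {ν : Measure β} {f : α → E}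
    {g : β → F} (hf : MemLp f 2 μ) (hg : MemLp g 2 ν) (h : eLpNorm f 2 μ = eLpNorm g 2 ν) :
    ∫ x, ‖f x‖ ^ 2 ∂μ = ∫ y, ‖g y‖ ^ 2 ∂ν := by
  have h1 := hf.eLpNorm_eq_integral_rpow_norm (by norm_num) (by norm_num)
  have h2 := hg.eLpNorm_eq_integral_rpow_norm (by norm_num) (by norm_num)
  rw [h, h2] at h1
  simp only [ENNReal.toReal_ofNat, Real.rpow_ofNat] at h1
  have hf0 : 0 ≤ ∫ x, ‖f x‖ ^ 2 ∂μ := integral_nonneg fun _ => by positivity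
  have hg0 : 0 ≤ ∫ x, ‖g x‖ ^ 2 ∂ν := integral_nonneg fun _ => by positivity
  rw [ENNReal.ofReal_eq_ofReal_iff (by positivity) (by positivity)] at h1
  exact (Real.rpow_left_injOn (x := 2⁻¹) (by norm_num)) hf0 hg0 h1.symm

namespace IsWienerPair

variable {f g : ℝ → EuclideanSpace ℝ (Fin d)} {Z Y : Ω → ℝ}

theorem memLp_fst (h : IsWienerPair hW T f Z) : MemLp f 2 (volume.restrict (Icc 0 T)) :=
  memLp_of_comp_fst h.1.memLp_fst

theorem memLp_snd (h : IsWienerPair hW T f Z) : MemLp Z 2 P := h.1.memLp_snd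

theorem add (h : IsWienerPair hW T f Z) (h' : IsWienerPair hW T g Y) :
    IsWienerPair hW T (f + g) (Z + Y) := by
  obtain ⟨h1, q, hq, h2⟩ := h
  obtain ⟨h1', q', hq', h2'⟩ := h'
  exact ⟨h1.add h1', q + q', Submodule.add_mem _ hq hq', (Lp.coeFn_add _ _).trans (h2.add h2')⟩

theorem sub (h : IsWienerPair hW T f Z) (h' : IsWienerPair hW T g Y) :
    IsWienerPair hW T (f - g) (Z - Y) := by
  obtain ⟨h1, q, hq, h2⟩ := h
  obtain ⟨h1', q', hq', h2'⟩ := h'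
  exact ⟨h1.sub h1', q - q', Submodule.sub_mem _ hq hq', (Lp.coeFn_sub _ _).trans (h2.sub h2')⟩

theorem eLpNorm_eq (h : IsWienerPair hW T f Z) :
    eLpNorm Z 2 P = eLpNorm f 2 (volume.restrict (Icc 0 T)) := by
  rw [h.1.eLpNorm_eq hW, eLpNorm_comp_fst h.memLp_fst.1]

theorem integral_sq_eq (h : IsWienerPair hW T f Z) :
    ∫ ω, Z ω ^ 2 ∂P = ∫ u in Icc 0 T, ‖f u‖ ^ 2 := by
  simpa using integral_norm_sq_eq_of_eLpNorm_eq h.memLp_snd h.memLp_fst h.eLpNorm_eq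

theorem map_eq_gaussianReal (h : IsWienerPair hW T f Z) :
    P.map Z = gaussianReal 0 (∫ u in Icc 0 T, ‖f u‖ ^ 2).toNNReal := by
  rw [← h.integral_sq_eq]
  obtain ⟨h1, q, hq, h2⟩ := h
  rw [← Measure.map_congr h2, map_eq_gaussianReal_of_mem_gaussianSpace hW hq]
  congr 2
  rw [← real_inner_self_eq_norm_sq, L2.inner_def]
  refine integral_congr_ae ?_
  filter_upwards [h2] with ω hω
  rw [hω]
  simp [sq]

theorem of_tendsto {fn : ℕ → ℝ → EuclideanSpace ℝ (Fin d)} {Zn : ℕ → Ω → ℝ}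
    (h : ∀ n, IsWienerPair hW T (fn n) (Zn n)) (hf : MemLp f 2 (volume.restrict (Icc 0 T)))
    (hfn : Tendsto (fun n => eLpNorm (fn n - f) 2 (volume.restrict (Icc 0 T))) atTop (𝓝 0))
    (hZ : ∀ᵐ ω ∂P, Tendsto (fun n => Zn n ω) atTop (𝓝 (Z ω))) : IsWienerPair hW T f Z := by
  have hF : MemLp (fun p : ℝ × Ω => f p.1) 2 ((volume.restrict (Icc 0 T)).prod P) := hf.comp_fst _
  have hFn : Tendsto (fun n => eLpNorm ((fun p : ℝ × Ω => fn n p.1) - fun p => f p.1) 2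
      ((volume.restrict (Icc 0 T)).prod P)) atTop (𝓝 0) :=
    hfn.congr fun n => (eLpNorm_comp_fst ((h n).memLp_fst.1.sub hf.1)).symm
  have hp := IsItoPair.of_tendsto hW (fun n => (h n).1) hF hFn hZ
  refine ⟨hp, hp.memLp_snd.toLp Z, ?_, hp.memLp_snd.coeFn_toLp⟩
  choose q hq hqZ using fun n => (h n).2
  refine (Submodule.isClosed_topologicalClosure _).mem_of_tendsto (b := atTop) (f := q) ?_
    (Eventually.of_forall hq)
  rw [Lp.tendsto_Lp_iff_tendsto_eLpNorm']
  refine hFn.congr fun n => ?_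
  rw [← ((h n).1.sub hp).eLpNorm_eq hW]
  exact eLpNorm_congr_ae ((hqZ n).sub hp.memLp_snd.coeFn_toLp).symm

theorem sum {ι : Type*} (s : Finset ι) {f : ι → ℝ → EuclideanSpace ℝ (Fin d)}
    {Z : ι → Ω → ℝ} (h : ∀ i ∈ s, IsWienerPair hW T (f i) (Z i)) :
    IsWienerPair hW T (∑ i ∈ s, f i) (∑ i ∈ s, Z i) := by
  classical
  induction s using Finset.induction_on with
  | empty =>
    simp only [Finset.sum_empty]
    exact ⟨IsItoPair.zero, 0, Submodule.zero_mem _, Lp.coeFn_zero _ _ _⟩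
  | insert i s hi ih =>
    rw [Finset.sum_insert hi, Finset.sum_insert hi]
    exact (h i (Finset.mem_insert_self _ _)).add (ih fun k hk => h k (Finset.mem_insert_of_mem hk))

theorem indicator_Ioc (hW : IsStandardBrownian W P) {s u : ℝ≥0} (hsu : s ≤ u)
    (hu : (u : ℝ) ≤ T) (β : EuclideanSpace ℝ (Fin d)) :
    IsWienerPair hW T ((Ioc (s : ℝ) u).indicator fun _ => β)
      (fun ω => inner ℝ β (W u ω - W s ω)) := by
  refine ⟨IsItoPair.indicator_Ioc (ξ := fun _ => β) hW hsu hu aestronglyMeasurable_const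
    (memLp_const β), ?_⟩
  refine ⟨∑ j, β j • ((hW.memLp_coord u j).toLp (fun ω => W u ω j) -
    (hW.memLp_coord s j).toLp (fun ω => W s ω j)), ?_, ?_⟩
  · refine Submodule.le_topologicalClosure _ (Submodule.sum_mem _ fun j _ =>
      Submodule.smul_mem _ _ (Submodule.sub_mem _ ?_ ?_))
    · exact Submodule.subset_span ⟨(j, u), rfl⟩
    · exact Submodule.subset_span ⟨(j, s), rfl⟩
  · have h1 : ∀ᵐ ω ∂P, ∀ j ∈ Finset.univ,
        (β j • ((hW.memLp_coord u j).toLp (fun ω => W u ω j) -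
          (hW.memLp_coord s j).toLp (fun ω => W s ω j)) : Lp ℝ 2 P) ω
          = β j * (W u ω j - W s ω j) := by
      refine (ae_ball_iff (Finset.countable_toSet _)).2 fun j _ => ?_
      filter_upwards [Lp.coeFn_smul (β j) ((hW.memLp_coord u j).toLp (fun ω => W u ω j) -
          (hW.memLp_coord s j).toLp (fun ω => W s ω j)),
        Lp.coeFn_sub ((hW.memLp_coord u j).toLp (fun ω => W u ω j))
          ((hW.memLp_coord s j).toLp (fun ω => W s ω j)),
        (hW.memLp_coord u j).coeFn_toLp, (hW.memLp_coord s j).coeFn_toLp] with ω e1 e2 e3 e4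
      rw [e1, Pi.smul_apply, e2, Pi.sub_apply, e3, e4, smul_eq_mul]
    filter_upwards [h1, Lp.coeFn_finsetSum Finset.univ fun j => (β j •
      ((hW.memLp_coord u j).toLp (fun ω => W u ω j) -
          (hW.memLp_coord s j).toLp (fun ω => W s ω j)) : Lp ℝ 2 P)] with ω e1 e2
    rw [e2, Finset.sum_apply, Finset.sum_congr rfl e1]
    simp [PiLp.inner_apply, mul_comm]

theorem integrable_exp (h : IsWienerPair hW T f Z) (c : ℝ) :
    Integrable (fun ω => Real.exp (c * Z ω)) P := by
  have h1 := integrable_exp_mul_gaussianReal (μ := 0)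
    (v := (∫ u in Icc 0 T, ‖f u‖ ^ 2).toNNReal) c
  rw [← h.map_eq_gaussianReal] at h1
  exact h1.comp_aemeasurable h.memLp_snd.1.aemeasurable

theorem integral_exp (h : IsWienerPair hW T f Z) (c : ℝ) :
    ∫ ω, Real.exp (c * Z ω) ∂P = Real.exp ((∫ u in Icc 0 T, ‖f u‖ ^ 2) * c ^ 2 / 2) := by
  have h1 := mgf_gaussianReal h.map_eq_gaussianReal c
  rw [mgf] at h1
  rw [h1, Real.coe_toNNReal _ (integral_nonneg fun _ => by positivity)]
  simp

end IsWienerPair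

end GaussianSpace

/-! ### Exponentials of Wiener integrals and their Itô sums for step functions -/

section WickExponential

variable {Ω : Type*} [MeasurableSpace Ω] {d : ℕ} {W : ℝ≥0 → Ω → EuclideanSpace ℝ (Fin d)}
  {P : Measure Ω} [IsProbabilityMeasure P] {T : ℝ} {hW : IsStandardBrownian W P}
  {f g : ℝ → EuclideanSpace ℝ (Fin d)} {Z Y : Ω → ℝ}

theorem inner_toLp_eq_integral {f g : ℝ → EuclideanSpace ℝ (Fin d)}
    (hf : MemLp f 2 (volume.restrict (Icc 0 T))) (hg : MemLp g 2 (volume.restrict (Icc 0 T))) :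
    inner ℝ (hf.toLp f) (hg.toLp g) = ∫ u in Icc 0 T, inner ℝ (f u) (g u) := by
  rw [L2.inner_def]
  refine integral_congr_ae ?_
  filter_upwards [hf.coeFn_toLp, hg.coeFn_toLp] with u h1 h2
  rw [h1, h2]

theorem integral_norm_sq_add {f g : ℝ → EuclideanSpace ℝ (Fin d)}
    (hf : MemLp f 2 (volume.restrict (Icc 0 T))) (hg : MemLp g 2 (volume.restrict (Icc 0 T))) :
    ∫ u in Icc 0 T, ‖(f + g) u‖ ^ 2 = (∫ u in Icc 0 T, ‖f u‖ ^ 2)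
      + 2 * (∫ u in Icc 0 T, inner ℝ (f u) (g u)) + ∫ u in Icc 0 T, ‖g u‖ ^ 2 := by
  have h := norm_add_sq_real (hf.toLp f) (hg.toLp g)
  rw [← MemLp.toLp_add, ← real_inner_self_eq_norm_sq, ← real_inner_self_eq_norm_sq,
    ← real_inner_self_eq_norm_sq, inner_toLp_eq_integral, inner_toLp_eq_integral,
    inner_toLp_eq_integral, inner_toLp_eq_integral] at h
  simpa only [real_inner_self_eq_norm_sq] using h

/-- The exponential `exp (Z - |f|² / 2)`. -/
noncomputable def wickExp (T : ℝ) (f : ℝ → EuclideanSpace ℝ (Fin d)) (Z : Ω → ℝ) (ω : Ω) : ℝ :=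
  Real.exp (Z ω - (∫ u in Icc 0 T, ‖f u‖ ^ 2) / 2)

namespace IsWienerPair

theorem wickExp_mul (_ : IsWienerPair hW T f Z) (_ : IsWienerPair hW T g Y) (ω : Ω) :
    wickExp T f Z ω * wickExp T g Y ω = Real.exp (1 * (Z + Y) ω) *
      Real.exp (-((∫ u in Icc 0 T, ‖f u‖ ^ 2) + ∫ u in Icc 0 T, ‖g u‖ ^ 2) / 2) := by
  rw [wickExp, wickExp, ← Real.exp_add, ← Real.exp_add, Pi.add_apply]
  ring_nf

/-- The product is an exponential of the Gaussian variable Z + Y of variance |f + g|², and the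
normalisations cancel the two squares. All second moments of such exponentials become explicit,
hence so does their L² continuity in the integrand. -/
theorem integral_wickExp_mul (h : IsWienerPair hW T f Z) (h' : IsWienerPair hW T g Y) :
    ∫ ω, wickExp T f Z ω * wickExp T g Y ω ∂P
      = Real.exp (∫ u in Icc 0 T, inner ℝ (f u) (g u)) := by
  simp_rw [h.wickExp_mul h']
  rw [integral_mul_const, (h.add h').integral_exp, integral_norm_sq_add h.memLp_fst h'.memLp_fst,
    ← Real.exp_add]
  ring_nf

theorem memLp_wickExp (h : IsWienerPair hW T f Z) : MemLp (wickExp T f Z) 2 P := by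
  have hm : AEStronglyMeasurable (wickExp T f Z) P :=
    (Real.continuous_exp.comp (continuous_id.sub continuous_const)).comp_aestronglyMeasurable
      h.memLp_snd.1
  rw [memLp_two_iff_integrable_sq hm]
  have := ((h.add h).integrable_exp 1).mul_const
    (Real.exp (-((∫ u in Icc 0 T, ‖f u‖ ^ 2) + ∫ u in Icc 0 T, ‖f u‖ ^ 2) / 2))
  refine this.congr (ae_of_all _ fun ω => ?_)
  simp only
  rw [← h.wickExp_mul h, sq]

theorem integral_wickExp (h : IsWienerPair hW T f Z) : ∫ ω, wickExp T f Z ω ∂P = 1 := by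
  have h1 : ∀ ω, wickExp T f Z ω = Real.exp (1 * Z ω) *
      Real.exp (-(∫ u in Icc 0 T, ‖f u‖ ^ 2) / 2) := fun ω => by
    rw [wickExp, ← Real.exp_add]; ring_nf
  simp_rw [h1]
  rw [integral_mul_const, h.integral_exp, ← Real.exp_add, Real.exp_eq_one_iff]
  ring

theorem integral_wickExp_sq (h : IsWienerPair hW T f Z) :
    ∫ ω, wickExp T f Z ω ^ 2 ∂P = Real.exp (∫ u in Icc 0 T, ‖f u‖ ^ 2) := by
  simp_rw [sq (wickExp T f Z _)]
  rw [h.integral_wickExp_mul h]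
  simp_rw [real_inner_self_eq_norm_sq]

theorem integral_wickExp_sub_sq (h : IsWienerPair hW T f Z) (h' : IsWienerPair hW T g Y) :
    ∫ ω, (wickExp T f Z ω - wickExp T g Y ω) ^ 2 ∂P
      = Real.exp (∫ u in Icc 0 T, ‖f u‖ ^ 2) + Real.exp (∫ u in Icc 0 T, ‖g u‖ ^ 2)
        - 2 * Real.exp (∫ u in Icc 0 T, inner ℝ (f u) (g u)) := by
  have h1 : ∀ ω, (wickExp T f Z ω - wickExp T g Y ω) ^ 2 = wickExp T f Z ω ^ 2
      + wickExp T g Y ω ^ 2 - 2 * (wickExp T f Z ω * wickExp T g Y ω) := fun ω => by ring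
  simp_rw [h1]
  have i1 := h.memLp_wickExp.integrable_sq
  have i2 := h'.memLp_wickExp.integrable_sq
  have i3 : Integrable (fun ω => wickExp T f Z ω * wickExp T g Y ω) P :=
    h.memLp_wickExp.integrable_mul h'.memLp_wickExp
  have i12 : Integrable (fun ω => wickExp T f Z ω ^ 2 + wickExp T g Y ω ^ 2) P := i1.add i2
  rw [integral_sub i12 (i3.const_mul 2), integral_add i1 i2, integral_const_mul,
    h.integral_wickExp_sq, h'.integral_wickExp_sq, h.integral_wickExp_mul h']

/-- The exponential depends continuously on the integrand. -/
theorem tendsto_integral_wickExp_sub_sq {fn : ℕ → ℝ → EuclideanSpace ℝ (Fin d)}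
    {Zn : ℕ → Ω → ℝ} (hn : ∀ n, IsWienerPair hW T (fn n) (Zn n)) (h : IsWienerPair hW T f Z)
    (hlim : Tendsto (fun n => eLpNorm (fn n - f) 2 (volume.restrict (Icc 0 T))) atTop (𝓝 0)) :
    Tendsto (fun n => ∫ ω, (wickExp T (fn n) (Zn n) ω - wickExp T f Z ω) ^ 2 ∂P) atTop (𝓝 0) := by
  have h1 : Tendsto (fun n => (hn n).memLp_fst.toLp (fn n)) atTop (𝓝 (h.memLp_fst.toLp f)) := by
    rw [Lp.tendsto_Lp_iff_tendsto_eLpNorm']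
    refine hlim.congr fun n => eLpNorm_congr_ae ?_
    exact ((hn n).memLp_fst.coeFn_toLp.sub h.memLp_fst.coeFn_toLp).symm
  have h2 : Tendsto (fun n => ∫ u in Icc 0 T, ‖fn n u‖ ^ 2) atTop (𝓝 (∫ u in Icc 0 T, ‖f u‖ ^ 2)) := by
    have := h1.inner h1 (𝕜 := ℝ)
    simp_rw [inner_toLp_eq_integral] at this
    simpa only [real_inner_self_eq_norm_sq] using this
  have h3 : Tendsto (fun n => ∫ u in Icc 0 T, inner ℝ (fn n u) (f u)) atTop
      (𝓝 (∫ u in Icc 0 T, ‖f u‖ ^ 2)) := by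
    have := h1.inner (𝕜 := ℝ) (tendsto_const_nhds (x := h.memLp_fst.toLp f))
    simp_rw [inner_toLp_eq_integral] at this
    simpa only [real_inner_self_eq_norm_sq] using this
  simp_rw [fun n => (hn n).integral_wickExp_sub_sq h]
  have := ((Real.continuous_exp.tendsto _).comp h2).add
    (tendsto_const_nhds (x := Real.exp (∫ u in Icc 0 T, ‖f u‖ ^ 2))) |>.sub
    (((Real.continuous_exp.tendsto _).comp h3).const_mul 2)
  have h0 : ∀ e : ℝ, e + e - 2 * e = 0 := fun e => by ring
  rwa [h0] at this

/-- This is the derivative at c = 1 of the moment generating function exp(v c²/2), with v the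
variance. -/
theorem integral_mul_exp (h : IsWienerPair hW T f Z) :
    ∫ ω, Z ω * Real.exp (Z ω) ∂P
      = (∫ u in Icc 0 T, ‖f u‖ ^ 2) * Real.exp ((∫ u in Icc 0 T, ‖f u‖ ^ 2) / 2) := by
  set v := ∫ u in Icc 0 T, ‖f u‖ ^ 2
  have hmgf : mgf Z P = fun c => Real.exp (v * c ^ 2 / 2) := funext fun c => h.integral_exp c
  have hset : integrableExpSet Z P = univ := eq_univ_of_forall fun c => h.integrable_exp c
  have h1 := hasDerivAt_mgf (X := Z) (μ := P) (t := 1) (by rw [hset]; simp)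
  have h2 : HasDerivAt (mgf Z P) (v * Real.exp (v / 2)) 1 := by
    rw [hmgf]
    have h3 : HasDerivAt (fun c : ℝ => v * c ^ 2 / 2) v 1 := by
      have := ((hasDerivAt_pow 2 (1 : ℝ)).const_mul v).div_const 2
      convert! this using 1
      ring
    have h4 := h3.exp
    convert! h4 using 1
    ring_nf
  have h5 := h1.unique h2
  simpa using h5

end IsWienerPair

/-- `∑_{i < k} β_i' (W_{τ_{i+1}} - W_{τ_i})`. -/
noncomputable def brownianSum (W : ℝ≥0 → Ω → EuclideanSpace ℝ (Fin d)) (τ : ℕ → ℝ≥0)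
    (β : ℕ → EuclideanSpace ℝ (Fin d)) (k : ℕ) (ω : Ω) : ℝ :=
  ∑ i ∈ Finset.range k, inner ℝ (β i) (W (τ (i + 1)) ω - W (τ i) ω)

/-- `∑_{i < k} |β_i|² (τ_{i+1} - τ_i)`. -/
noncomputable def brownianVar (τ : ℕ → ℝ≥0) (β : ℕ → EuclideanSpace ℝ (Fin d)) (k : ℕ) : ℝ :=
  ∑ i ∈ Finset.range k, ‖β i‖ ^ 2 * ((τ (i + 1) : ℝ) - τ i)

/-- The exponential martingale of a step function. -/
noncomputable def brownianExp (W : ℝ≥0 → Ω → EuclideanSpace ℝ (Fin d)) (τ : ℕ → ℝ≥0)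
    (β : ℕ → EuclideanSpace ℝ (Fin d)) (k : ℕ) (ω : Ω) : ℝ :=
  Real.exp (brownianSum W τ β k ω - brownianVar τ β k / 2)

theorem integral_norm_sq_indicator_Ioc {s u : ℝ≥0} (hsu : s ≤ u) (hu : (u : ℝ) ≤ T)
    (β : EuclideanSpace ℝ (Fin d)) :
    ∫ x in Icc 0 T, ‖(Ioc (s : ℝ) u).indicator (fun _ => β) x‖ ^ 2 = ‖β‖ ^ 2 * ((u : ℝ) - s) := by
  have h1 := volume_real_Ioc_inter (s := s) (u := u) (s' := s) (u' := u) hu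
  rw [min_self, max_self, max_eq_right (sub_nonneg.2 (by exact_mod_cast hsu))] at h1
  rw [← h1, ← integral_const_mul]
  refine integral_congr_ae (ae_of_all _ fun x => ?_)
  by_cases hx : x ∈ Ioc (s : ℝ) u <;> simp [hx]

section

variable (W) {τ : ℕ → ℝ≥0} (hτ : Monotone τ) (β : ℕ → EuclideanSpace ℝ (Fin d))
include hτ

theorem stronglyMeasurable_brownianSum (k : ℕ) {r : ℝ≥0} (hr : τ k ≤ r) :
    StronglyMeasurable[pastSigma W r] (brownianSum W τ β k) := by
  unfold brownianSum
  refine Finset.stronglyMeasurable_fun_sum _ fun i hi => ?_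
  have hi' := Finset.mem_range.1 hi
  have h1 := (measurable_pastSigma W ((hτ (by omega : i + 1 ≤ k)).trans hr)).stronglyMeasurable.sub
    (measurable_pastSigma W ((hτ (by omega : i ≤ k)).trans hr)).stronglyMeasurable
  exact (innerSL ℝ (β i)).continuous.comp_stronglyMeasurable h1

theorem stronglyMeasurable_brownianExp (k : ℕ) {r : ℝ≥0} (hr : τ k ≤ r) :
    StronglyMeasurable[pastSigma W r] (brownianExp W τ β k) :=
  (Real.continuous_exp.comp (continuous_id.sub continuous_const)).comp_stronglyMeasurable
    (stronglyMeasurable_brownianSum W hτ β k hr)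

end

theorem brownianExp_succ (τ : ℕ → ℝ≥0) (β : ℕ → EuclideanSpace ℝ (Fin d)) (k : ℕ) (ω : Ω) :
    brownianExp W τ β (k + 1) ω = brownianExp W τ β k ω *
      Real.exp (inner ℝ (β k) (W (τ (k + 1)) ω - W (τ k) ω)
        - ‖β k‖ ^ 2 * ((τ (k + 1) : ℝ) - τ k) / 2) := by
  simp only [brownianExp, brownianSum, brownianVar, Finset.sum_range_succ]
  rw [← Real.exp_add]
  ring_nf

theorem IsStandardBrownian.integral_comp_increment_mul (hW : IsStandardBrownian W P) {s u : ℝ≥0}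
    (hsu : s ≤ u) {X : Ω → ℝ} (hX : AEStronglyMeasurable[pastSigma W s] X P)
    {φ : EuclideanSpace ℝ (Fin d) → ℝ} (hφ : Continuous φ) :
    ∫ ω, X ω * φ (W u ω - W s ω) ∂P = (∫ ω, X ω ∂P) * ∫ ω, φ (W u ω - W s ω) ∂P :=
  ((hW.indepFun_increment hsu hX).comp measurable_id hφ.measurable).integral_fun_mul_eq_mul_integral
    (hX.mono (hW.pastSigma_le s))
    (hφ.measurable.comp ((hW.measurable u).sub (hW.measurable s))).aestronglyMeasurable

theorem IsStandardBrownian.memLp_mul_comp_increment (hW : IsStandardBrownian W P) {s u : ℝ≥0}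
    (hsu : s ≤ u) {X : Ω → ℝ} (hX : AEStronglyMeasurable[pastSigma W s] X P) (hX2 : MemLp X 2 P)
    {φ : EuclideanSpace ℝ (Fin d) → ℝ} (hφ : Continuous φ)
    (hφ2 : MemLp (fun ω => φ (W u ω - W s ω)) 2 P) :
    MemLp (fun ω => X ω * φ (W u ω - W s ω)) 2 P := by
  have h := (hW.indepFun_increment hsu hX).comp (measurable_id.pow_const 2)
    (hφ.measurable.pow_const 2)
  have h2 := h.integrable_mul hX2.integrable_sq hφ2.integrable_sq
  refine (memLp_two_iff_integrable_sq (hX2.1.mul hφ2.1)).2 (h2.congr (ae_of_all _ fun ω => ?_))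
  simp [mul_pow]

/-- Mean zero and second moment of `e^{Y - κ/2} - 1 - Y` for a Brownian increment `Y`. -/
theorem IsWienerPair.integral_wickExp_sub_one_sub (h : IsWienerPair hW T f Z) :
    MemLp (fun ω => wickExp T f Z ω - 1 - Z ω) 2 P ∧
    ∫ ω, (wickExp T f Z ω - 1 - Z ω) ∂P = 0 ∧
    ∫ ω, (wickExp T f Z ω - 1 - Z ω) ^ 2 ∂P
      = Real.exp (∫ u in Icc 0 T, ‖f u‖ ^ 2) - 1 - ∫ u in Icc 0 T, ‖f u‖ ^ 2 := by
  set v := ∫ u in Icc 0 T, ‖f u‖ ^ 2 with hv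
  have hN := h.memLp_wickExp
  have hZ := h.memLp_snd
  have hNi := hN.integrable (by norm_num)
  have hZi := hZ.integrable (by norm_num)
  have hm : ∫ ω, Z ω ∂P = 0 := by
    have h1 : ∫ x, x ∂(P.map Z) = ∫ ω, Z ω ∂P :=
      integral_map hZ.1.aemeasurable (f := fun x : ℝ => x) (by fun_prop)
    rw [← h1, h.map_eq_gaussianReal, integral_id_gaussianReal]
  refine ⟨(hN.sub (memLp_const 1)).sub hZ, ?_, ?_⟩
  · have i1 : Integrable (fun ω => wickExp T f Z ω - 1) P := hNi.sub (integrable_const _)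
    rw [integral_sub i1 hZi, integral_sub hNi (integrable_const _), hm, h.integral_wickExp]
    simp
  · have e1 : ∀ ω, (wickExp T f Z ω - 1 - Z ω) ^ 2 = (wickExp T f Z ω ^ 2 + 1 + Z ω ^ 2
        + 2 * Z ω) - 2 * wickExp T f Z ω - 2 * (wickExp T f Z ω * Z ω) := fun ω => by ring
    have i3 : Integrable (fun ω => wickExp T f Z ω * Z ω) P := hN.integrable_mul hZ
    have i4 : Integrable (fun ω => wickExp T f Z ω ^ 2 + 1) P :=
      hN.integrable_sq.add (integrable_const _)
    have i5 : Integrable (fun ω => wickExp T f Z ω ^ 2 + 1 + Z ω ^ 2) P := i4.add hZ.integrable_sq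
    have i6 : Integrable (fun ω => wickExp T f Z ω ^ 2 + 1 + Z ω ^ 2 + 2 * Z ω) P :=
      i5.add (hZi.const_mul 2)
    have i7 : Integrable (fun ω => wickExp T f Z ω ^ 2 + 1 + Z ω ^ 2 + 2 * Z ω
        - 2 * wickExp T f Z ω) P := i6.sub (hNi.const_mul 2)
    have e2 : ∫ ω, wickExp T f Z ω * Z ω ∂P = v := by
      have : ∀ ω, wickExp T f Z ω * Z ω = (Z ω * Real.exp (Z ω)) * Real.exp (-(v / 2)) := fun ω => by
        rw [wickExp, sub_eq_add_neg, Real.exp_add]; ring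
      simp_rw [this]
      rw [integral_mul_const, h.integral_mul_exp, mul_assoc, ← Real.exp_add, ← hv]
      simp
    simp_rw [e1]
    rw [integral_sub i7 (i3.const_mul 2), integral_sub i6 (hNi.const_mul 2),
      integral_add i5 (hZi.const_mul 2), integral_add i4 hZ.integrable_sq,
      integral_add hN.integrable_sq (integrable_const _), integral_const_mul, integral_const_mul,
      integral_const_mul, e2, h.integral_wickExp, hm, h.integral_sq_eq, h.integral_wickExp_sq]
    simp
    ring

/-- The Itô sums of the exponential martingale of a step function are close to it. -/
theorem brownianExp_sub_sum (hW : IsStandardBrownian W P) {τ : ℕ → ℝ≥0} (hτ : Monotone τ)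
    (β : ℕ → EuclideanSpace ℝ (Fin d)) {δ : ℝ} (hδ1 : δ ≤ 1)
    (hβ : ∀ i, ‖β i‖ ^ 2 * ((τ (i + 1) : ℝ) - τ i) ≤ δ) (k : ℕ) :
    MemLp (brownianExp W τ β k) 2 P ∧
    ∫ ω, brownianExp W τ β k ω ^ 2 ∂P = Real.exp (brownianVar τ β k) ∧
    AEStronglyMeasurable[pastSigma W (τ k)] (fun ω => brownianExp W τ β k ω - 1
      - ∑ i ∈ Finset.range k, brownianExp W τ β i ω *
        inner ℝ (β i) (W (τ (i + 1)) ω - W (τ i) ω)) P ∧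
    MemLp (fun ω => brownianExp W τ β k ω - 1
      - ∑ i ∈ Finset.range k, brownianExp W τ β i ω *
        inner ℝ (β i) (W (τ (i + 1)) ω - W (τ i) ω)) 2 P ∧
    ∫ ω, (brownianExp W τ β k ω - 1
      - ∑ i ∈ Finset.range k, brownianExp W τ β i ω *
        inner ℝ (β i) (W (τ (i + 1)) ω - W (τ i) ω)) ^ 2 ∂P
      ≤ Real.exp (brownianVar τ β k) * (δ * brownianVar τ β k) := by
  -- Let E_k be the exponential and V_k = E_k - 1 minus its Itô sum. One step adds E_k ψ(ΔW), where
  -- ψ(x) = exp(β_k'x - κ/2) - 1 - β_k'x. Since ψ(ΔW) is centred and independent of the past, the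
  -- cross term with V_k vanishes and E V_k² grows by E[E_k²] (e^κ - 1 - κ).
  induction k with
  | zero =>
    have h0 : brownianExp W τ β 0 = fun _ => 1 := by
      funext ω; simp [brownianExp, brownianSum, brownianVar]
    refine ⟨by rw [h0]; exact memLp_const 1, ?_⟩
    simp [h0, brownianVar, aestronglyMeasurable_const]
  | succ k ih =>
    obtain ⟨h1, h2, h3, h4, h5⟩ := ih
    have hk := hτ k.le_succ
    set κ := ‖β k‖ ^ 2 * ((τ (k + 1) : ℝ) - τ k) with hκ
    have hκ0 : 0 ≤ κ := mul_nonneg (by positivity) (sub_nonneg.2 (by exact_mod_cast hk))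
    have hp := IsWienerPair.indicator_Ioc (T := τ (k + 1)) hW hk le_rfl (β k)
    have hn := integral_norm_sq_indicator_Ioc (T := τ (k + 1)) hk le_rfl (β k)
    rw [← hκ] at hn
    set E := brownianExp W τ β k with hE
    have hEm := (stronglyMeasurable_brownianExp W hτ β k (r := τ k) le_rfl).aestronglyMeasurable (μ := P)
    set φ : EuclideanSpace ℝ (Fin d) → ℝ := fun x => Real.exp (inner ℝ (β k) x - κ / 2) with hφ
    have hφc : Continuous φ := by fun_prop
    have hwick : ∀ ω, wickExp (τ (k + 1)) ((Ioc (τ k : ℝ) (τ (k + 1))).indicator fun _ => β k)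
        (fun ω => inner ℝ (β k) (W (τ (k + 1)) ω - W (τ k) ω)) ω
        = φ (W (τ (k + 1)) ω - W (τ k) ω) := fun ω => by rw [wickExp, hn]
    have hsucc : ∀ ω, brownianExp W τ β (k + 1) ω = E ω * φ (W (τ (k + 1)) ω - W (τ k) ω) :=
      fun ω => brownianExp_succ τ β k ω
    have hsqint : ∫ ω, φ (W (τ (k + 1)) ω - W (τ k) ω) ^ 2 ∂P = Real.exp κ := by
      have := hp.integral_wickExp_sq
      simp_rw [hwick, hn] at this
      exact this
    have hφm : MemLp (fun ω => φ (W (τ (k + 1)) ω - W (τ k) ω)) 2 P :=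
      hp.memLp_wickExp.ae_eq (ae_of_all _ hwick)
    set ψ : EuclideanSpace ℝ (Fin d) → ℝ := fun x => φ x - 1 - inner ℝ (β k) x with hψ
    have hψc : Continuous ψ := by fun_prop
    obtain ⟨c1, c2, c3⟩ := hp.integral_wickExp_sub_one_sub
    simp_rw [hwick, hn] at c1 c2 c3
    have hvar : brownianVar τ β (k + 1) = brownianVar τ β k + κ := by
      simp [brownianVar, Finset.sum_range_succ, hκ]
    have hVs : ∀ ω, brownianExp W τ β (k + 1) ω - 1 - ∑ i ∈ Finset.range (k + 1),
        brownianExp W τ β i ω * inner ℝ (β i) (W (τ (i + 1)) ω - W (τ i) ω)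
        = (E ω - 1 - ∑ i ∈ Finset.range k,
          brownianExp W τ β i ω * inner ℝ (β i) (W (τ (i + 1)) ω - W (τ i) ω))
          + E ω * ψ (W (τ (k + 1)) ω - W (τ k) ω) := fun ω => by
      rw [hsucc, Finset.sum_range_succ]; simp only [hψ, hE]; ring
    set V := fun ω => E ω - 1 - ∑ i ∈ Finset.range k,
          brownianExp W τ β i ω * inner ℝ (β i) (W (τ (i + 1)) ω - W (τ i) ω) with hV
    have hEψ : MemLp (fun ω => E ω * ψ (W (τ (k + 1)) ω - W (τ k) ω)) 2 P :=
      hW.memLp_mul_comp_increment hk hEm h1 hψc c1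
    have hvar0 : 0 ≤ brownianVar τ β k := Finset.sum_nonneg fun i _ =>
      mul_nonneg (by positivity) (sub_nonneg.2 (by exact_mod_cast hτ i.le_succ))
    refine ⟨?_, ?_, ?_, ?_, ?_⟩
    · rw [show brownianExp W τ β (k + 1) = fun ω => E ω * φ (W (τ (k + 1)) ω - W (τ k) ω) from
        funext hsucc]
      exact hW.memLp_mul_comp_increment hk hEm h1 hφc hφm
    · simp_rw [hsucc, mul_pow]
      rw [hW.integral_comp_increment_mul hk (X := fun ω => E ω ^ 2) (φ := fun x => φ x ^ 2)
        (hEm.pow 2) (hφc.pow 2), h2, hsqint, hvar, Real.exp_add]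
    · simp_rw [hVs]
      refine (h3.mono (pastSigma_mono W hk)).add ((hEm.mono (pastSigma_mono W hk)).mul ?_)
      exact (hψc.comp_stronglyMeasurable ((measurable_pastSigma W le_rfl).stronglyMeasurable.sub
        (measurable_pastSigma W hk).stronglyMeasurable)).aestronglyMeasurable
    · simp_rw [hVs]
      exact h4.add hEψ
    · simp_rw [hVs]
      have e1 : ∀ ω, (V ω + E ω * ψ (W (τ (k + 1)) ω - W (τ k) ω)) ^ 2
          = V ω ^ 2 + 2 * ((V ω * E ω) * ψ (W (τ (k + 1)) ω - W (τ k) ω))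
            + E ω ^ 2 * ψ (W (τ (k + 1)) ω - W (τ k) ω) ^ 2 := fun ω => by ring
      have i1 : Integrable (fun ω => (V ω * E ω) * ψ (W (τ (k + 1)) ω - W (τ k) ω)) P :=
        (h4.integrable_mul hEψ).congr (ae_of_all _ fun ω => by simp only [Pi.mul_apply]; ring)
      have i2 : Integrable (fun ω => E ω ^ 2 * ψ (W (τ (k + 1)) ω - W (τ k) ω) ^ 2) P :=
        hEψ.integrable_sq.congr (ae_of_all _ fun ω => mul_pow _ _ _)
      have i3 : Integrable (fun ω => V ω ^ 2 + 2 * ((V ω * E ω) * ψ (W (τ (k + 1)) ω - W (τ k) ω))) P :=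
        h4.integrable_sq.add (i1.const_mul 2)
      rw [integral_congr_ae (ae_of_all _ e1), integral_add i3 i2, integral_add h4.integrable_sq (i1.const_mul 2), integral_const_mul,
        hW.integral_comp_increment_mul hk (X := fun ω => V ω * E ω) (h3.mul hEm) hψc, c2,
        hW.integral_comp_increment_mul hk (X := fun ω => E ω ^ 2) (φ := fun x => ψ x ^ 2)
        (hEm.pow 2) (hψc.pow 2), h2, c3, hvar, mul_zero, mul_zero, add_zero, Real.exp_add]
      have hκδ : κ ≤ δ := hβ k
      -- Here κ ≤ δ ≤ 1 is used; κ² ≤ δκ then keeps the accumulated error proportional to δ.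
      have hexp : Real.exp κ - 1 - κ ≤ κ ^ 2 :=
        (le_abs_self _).trans (Real.abs_exp_sub_one_sub_id_le (by rw [abs_of_nonneg hκ0]; linarith))
      have h6 : Real.exp κ - 1 - κ ≤ δ * κ := by nlinarith
      have h7 : 1 ≤ Real.exp κ := Real.one_le_exp hκ0
      have h8 := Real.exp_pos (brownianVar τ β k)
      have hδ0 : 0 ≤ δ := hκ0.trans hκδ
      calc _ ≤ Real.exp (brownianVar τ β k) * (δ * brownianVar τ β k)
            + Real.exp (brownianVar τ β k) * (δ * κ) := by gcongr
        _ = Real.exp (brownianVar τ β k) * 1 * (δ * (brownianVar τ β k + κ)) := by ring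
        _ ≤ _ := by gcongr

end WickExponential

/-! ### Doob's maximal inequality -/

section Martingale

variable {Ω : Type*} {m : MeasurableSpace Ω} {P : Measure Ω}

theorem MeasureTheory.Martingale.finset_sum {ι κ E : Type*} [Preorder ι] [NormedAddCommGroup E]
    [NormedSpace ℝ E] [CompleteSpace E] {ℱ : Filtration ι m} (s : Finset κ) {f : κ → ι → Ω → E}
    (h : ∀ i ∈ s, Martingale (f i) ℱ P) : Martingale (∑ i ∈ s, f i) ℱ P := by
  classical
  induction s using Finset.induction_on with
  | empty => simpa using martingale_zero E ℱ P
  | insert i s hi ih =>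
    rw [Finset.sum_insert hi]
    exact (h i (Finset.mem_insert_self i s)).add
      (ih fun j hj => h j (Finset.mem_insert_of_mem hj))

/-- The restriction of a filtration to a sequence of times. -/
def MeasureTheory.Filtration.alongSeq {ι : Type*} [Preorder ι] (ℱ : Filtration ι m) {r : ℕ → ι}
    (hr : Monotone r) : Filtration ℕ m where
  seq k := ℱ (r k)
  mono' _ _ h := ℱ.mono (hr h)
  le' k := ℱ.le (r k)

/-- Doob's maximal inequality on a finite set of times. -/
theorem MeasureTheory.Martingale.measure_exists_le_abs_le [IsFiniteMeasure P] {ι : Type*} [Preorder ι]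
    {ℱ : Filtration ι m} {D : ι → Ω → ℝ} (hD : Martingale D ℱ P) {r : ℕ → ι} (hr : Monotone r)
    {ε : ℝ≥0} (hε : ε ≠ 0) (n : ℕ) :
    P {ω | ∃ k ≤ n, (ε : ℝ) ≤ |D (r k) ω|} ≤ eLpNorm (D (r n)) 1 P / ε := by
  have h1 : Martingale (fun k => D (r k)) (ℱ.alongSeq hr) P :=
    ⟨fun k => hD.1 (r k), fun i j h => hD.2 _ _ (hr h)⟩
  -- The absolute value is the supremum of the martingale and its negative.
  have h2 : Submartingale (fun k ω => |D (r k) ω|) (ℱ.alongSeq hr) P :=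
    h1.submartingale.sup h1.neg.submartingale
  have h3 := maximal_ineq h2 (fun k ω => abs_nonneg _) (ε := ε) n
  have h4 : {ω | ∃ k ≤ n, (ε : ℝ) ≤ |D (r k) ω|} = {ω | (ε : ℝ) ≤
      (Finset.range (n + 1)).sup' Finset.nonempty_range_add_one fun k => |D (r k) ω|} := by
    ext ω
    simp [Finset.le_sup'_iff]
  rw [h4, ENNReal.le_div_iff_mul_le (by simp [hε]) (by simp), mul_comm]
  refine h3.trans ?_
  have h5 : Integrable (D (r n)) P := hD.integrable _
  rw [eLpNorm_one_eq_lintegral_enorm, ← ofReal_integral_norm_eq_lintegral_enorm h5]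
  refine ENNReal.ofReal_le_ofReal ?_
  exact setIntegral_le_integral h5.abs (ae_of_all _ fun ω => abs_nonneg _)

/-- Doob's maximal inequality for a martingale with continuous paths. -/
theorem MeasureTheory.Martingale.measure_exists_lt_abs_le [IsFiniteMeasure P]
    {ℱ : Filtration ℝ≥0 m} {D : ℝ≥0 → Ω → ℝ} (hD : Martingale D ℱ P) {T : ℝ} (hT : 0 ≤ T)
    (hc : ∀ᵐ ω ∂P, ContinuousOn (fun t : ℝ => D t.toNNReal ω) (Icc 0 T)) {ε : ℝ≥0} (hε : ε ≠ 0) :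
    P {ω | ∃ t ∈ Icc 0 T, (ε : ℝ) < |D t.toNNReal ω|} ≤ eLpNorm (D T.toNNReal) 1 P / ε := by
  set A : ℕ → Set Ω := fun N => {ω | ∃ k ≤ N, (ε : ℝ) ≤ |D (gridTime T N k) ω|} with hA
  have hAN : ∀ N, N ≠ 0 → P (A N) ≤ eLpNorm (D T.toNNReal) 1 P / ε := fun N hN => by
    have h1 := hD.measure_exists_le_abs_le (gridTime_mono T N) hε N
    rwa [show gridTime T N N = T.toNNReal by
      ext; rw [coe_gridTime_self hT hN, Real.coe_toNNReal _ hT]] at h1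
  -- By continuity a strict excess at t persists at the nearest points of all fine enough grids, so
  -- the event lies in the lower limit of the grid events, each of which obeys the discrete
  -- inequality.
  have hsub : {ω | ∃ t ∈ Icc 0 T, (ε : ℝ) < |D t.toNNReal ω|} ≤ᵐ[P]
      ⋃ N : ℕ, ⋂ n ≥ N + 1, A n := by
    filter_upwards [hc] with ω hω ht
    obtain ⟨t, ht, hlt⟩ := ht
    obtain ⟨δ, hδ, hδt⟩ := Metric.continuousOn_iff.1 hω.abs t ht _ (sub_pos.2 hlt)
    obtain ⟨N, hN⟩ := eventually_atTop.1 (eventually_mesh_lt (T := T) hδ)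
    refine mem_iUnion.2 ⟨N, mem_iInter₂.2 fun n hn => ?_⟩
    obtain ⟨hn0, hnδ⟩ := hN n (by omega)
    have key : ∀ k ≤ n, dist (gridTime T n k : ℝ) t < δ → ω ∈ A n := fun k hk hd => by
      have h1 := hδt _ (gridTime_mem_Icc hT hk hn0) hd
      rw [Real.toNNReal_coe, Real.dist_eq, abs_lt] at h1
      exact ⟨k, hk, by linarith [h1.1]⟩
    rcases ht.1.eq_or_lt with h0 | h0
    · exact key 0 (Nat.zero_le _) (by simpa [← h0] using hδ)
    · obtain ⟨i, hi, hi'⟩ := exists_mem_gridCell hT hn0 ⟨h0, ht.2⟩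
      refine key i hi.le ?_
      rw [coe_gridTime_succ hT] at hi'
      rw [Real.dist_eq, abs_lt]
      constructor <;> linarith [hi'.1, hi'.2]
  refine (measure_mono_ae hsub).trans ?_
  rw [Monotone.measure_iUnion]
  · exact iSup_le fun N => (measure_mono (iInter₂_subset (N + 1) le_rfl)).trans (hAN _ (by omega))
  · intro i j hij
    exact biInter_subset_biInter_left fun n hn => le_trans (Nat.succ_le_succ hij) hn

end Martingale

/-! ### A continuous version of the Wiener integral -/

section ContinuousIntegral

variable {Ω : Type*} [MeasurableSpace Ω] {d : ℕ} {W : ℝ≥0 → Ω → EuclideanSpace ℝ (Fin d)}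
  {P : Measure Ω} [IsProbabilityMeasure P] {T : ℝ}

namespace IsStandardBrownian

/-- The natural filtration of a Brownian motion. -/
def filtration (hW : IsStandardBrownian W P) : Filtration ℝ≥0 (inferInstance : MeasurableSpace Ω) where
  seq := pastSigma W
  mono' _ _ h := pastSigma_mono W h
  le' := hW.pastSigma_le

/-- Independence from the indicator of each past event, restated for σ-algebras, the form needed to
compute conditional expectations of increments. -/
theorem indep_comap_increment (hW : IsStandardBrownian W P) {s u : ℝ≥0} (hsu : s ≤ u) :
    Indep (MeasurableSpace.comap (fun ω => W u ω - W s ω) inferInstance) (pastSigma W s) P := by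
  rw [Indep_iff]
  rintro _ B ⟨A, hA, rfl⟩ hB
  have hX : StronglyMeasurable[pastSigma W s] (B.indicator fun _ => (1 : ℝ)) :=
    (@stronglyMeasurable_const _ _ (pastSigma W s) _ (1 : ℝ)).indicator hB
  have h := (hW.indepFun_increment hsu hX.aestronglyMeasurable).symm.measure_inter_preimage_eq_mul
    A {1} hA (measurableSet_singleton 1)
  have hB' : (B.indicator fun _ => (1 : ℝ)) ⁻¹' {1} = B := by
    ext ω; by_cases hω : ω ∈ B <;> simp [hω]
  rwa [hB'] at h

theorem martingale_inner_min (hW : IsStandardBrownian W P) (β : EuclideanSpace ℝ (Fin d))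
    (u : ℝ≥0) : Martingale (fun t ω => inner ℝ β (W (min t u) ω)) hW.filtration P := by
  have hint : ∀ s, Integrable (fun ω => inner ℝ β (W s ω)) P := fun s => by
    simp only [PiLp.inner_apply]
    exact integrable_finsetSum _ fun j _ => ((hW.memLp_coord s j).integrable (by norm_num)).mul_const _
  have hmeas : ∀ s t, s ≤ t → StronglyMeasurable[pastSigma W t] fun ω => inner ℝ β (W s ω) :=
    fun s t hst => (innerSL ℝ β).continuous.comp_stronglyMeasurable
      (measurable_pastSigma W hst).stronglyMeasurable
  refine ⟨fun t => hmeas _ _ (min_le_left _ _), fun s t hst => ?_⟩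
  change P[fun ω => inner ℝ β (W (min t u) ω) | hW.filtration s]
    =ᵐ[P] fun ω => inner ℝ β (W (min s u) ω)
  have hself : P[fun ω => inner ℝ β (W (min s u) ω) | hW.filtration s]
      = fun ω => inner ℝ β (W (min s u) ω) :=
    condExp_of_stronglyMeasurable _ (hmeas _ _ (min_le_left _ _)) (hint _)
  rcases le_total u s with hus | hsu
  · rw [min_eq_right (hus.trans hst)]
    rw [min_eq_right hus] at hself ⊢
    rw [hself]
  · have hst' : s ≤ min t u := le_min hst hsu
    rw [min_eq_left hsu] at hself ⊢
    have e1 : (fun ω => inner ℝ β (W (min t u) ω)) = (fun ω => inner ℝ β (W s ω))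
        + fun ω => inner ℝ β (W (min t u) ω - W s ω) := by
      funext ω; simp [inner_sub_right]
    have i1 : Integrable (fun ω => inner ℝ β (W (min t u) ω - W s ω)) P := by
      simp_rw [inner_sub_right]; exact (hint _).sub (hint _)
    have h0 : P[fun ω => inner ℝ β (W (min t u) ω - W s ω) | hW.filtration s] =ᵐ[P] fun _ =>
        ∫ ω, inner ℝ β (W (min t u) ω - W s ω) ∂P := by
      refine condExp_indep_eq (((hW.measurable _).sub (hW.measurable _)).comap_le)
        (hW.pastSigma_le s) ?_ (hW.indep_comap_increment hst')
      exact (innerSL ℝ β).continuous.comp_stronglyMeasurable (comap_measurable _).stronglyMeasurable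
    have h00 : ∫ ω, inner ℝ β (W (min t u) ω - W s ω) ∂P = 0 := by
      simp only [PiLp.inner_apply, PiLp.sub_apply]
      rw [integral_finsetSum _ fun j _ => ?_]
      · refine Finset.sum_eq_zero fun j _ => ?_
        have := hW.integral_increment s (min t u) j
        simp only [RCLike.inner_apply, conj_trivial]
        rw [integral_mul_const, this, zero_mul]
      · exact ((hW.memLp_increment s (min t u) j).integrable (by norm_num)).mul_const _
    rw [e1]
    filter_upwards [condExp_add (hint s) i1 (hW.filtration s), h0] with ω h1 h2
    rw [h1, Pi.add_apply, hself, h2, h00, add_zero]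

theorem martingale_brownianSum (hW : IsStandardBrownian W P) (τ : ℕ → ℝ≥0)
    (β : ℕ → EuclideanSpace ℝ (Fin d)) (n : ℕ) :
    Martingale (fun t => brownianSum W (fun i => min t (τ i)) β n) hW.filtration P := by
  have h := Martingale.finset_sum (Finset.range n) fun i _ =>
    (hW.martingale_inner_min (β i) (τ (i + 1))).sub (hW.martingale_inner_min (β i) (τ i))
  convert! h using 1
  funext t ω
  simp [brownianSum, Finset.sum_apply, inner_sub_right]

theorem ae_continuous_brownianSum (hW : IsStandardBrownian W P) (τ : ℕ → ℝ≥0)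
    (β : ℕ → EuclideanSpace ℝ (Fin d)) (n : ℕ) :
    ∀ᵐ ω ∂P, Continuous fun t : ℝ => brownianSum W (fun i => min t.toNNReal (τ i)) β n ω := by
  filter_upwards [hW.ae_continuous] with ω hω
  unfold brownianSum
  have : ∀ u : ℝ≥0, Continuous fun t : ℝ => W (min t.toNNReal u) ω := fun u =>
    hω.comp (continuous_real_toNNReal.min continuous_const)
  fun_prop (disch := exact this _)

end IsStandardBrownian

theorem indicator_Ioc_gridStep {t : ℝ} (N : ℕ) (β : ℕ → EuclideanSpace ℝ (Fin d)) (ht : 0 ≤ t) :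
    (Ioc 0 t).indicator (gridStep T N β) = ∑ i ∈ Finset.range N,
      (Ioc ((min t.toNNReal (gridTime T N i) : ℝ≥0) : ℝ)
        ((min t.toNNReal (gridTime T N (i + 1)) : ℝ≥0) : ℝ)).indicator fun _ => β i := by
  funext u
  rw [Finset.sum_apply]
  by_cases hu : u ∈ Ioc 0 t
  · rw [indicator_of_mem hu, gridStep]
    refine Finset.sum_congr rfl fun i _ => ?_
    by_cases h : u ∈ Ioc (gridTime T N i : ℝ) (gridTime T N (i + 1))
    · rw [indicator_of_mem h, indicator_of_mem]
      simp only [NNReal.coe_min, Real.coe_toNNReal _ ht]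
      exact ⟨min_lt_of_right_lt h.1, le_min hu.2 h.2⟩
    · rw [indicator_of_notMem h, indicator_of_notMem]
      simp only [NNReal.coe_min, Real.coe_toNNReal _ ht]
      rintro ⟨h1, h2⟩
      refine h ⟨?_, h2.trans (min_le_right _ _)⟩
      rcases min_lt_iff.1 h1 with h3 | h3
      · exact absurd hu.2 (not_le.2 h3)
      · exact h3
  · rw [indicator_of_notMem hu]
    refine (Finset.sum_eq_zero fun i _ => indicator_of_notMem ?_ _).symm
    simp only [NNReal.coe_min, Real.coe_toNNReal _ ht]
    rintro ⟨h1, h2⟩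
    exact hu ⟨lt_of_le_of_lt (le_min ht (NNReal.coe_nonneg _)) h1, h2.trans (min_le_left _ _)⟩

/-- The Wiener integral of a step function up to time `t`. -/
theorem isWienerPair_gridStep (hW : IsStandardBrownian W P) (N : ℕ)
    (β : ℕ → EuclideanSpace ℝ (Fin d)) {t : ℝ} (ht : t ∈ Icc 0 T) :
    IsWienerPair hW T ((Ioc 0 t).indicator (gridStep T N β))
      (brownianSum W (fun i => min t.toNNReal (gridTime T N i)) β N) := by
  rw [indicator_Ioc_gridStep N β ht.1]
  have h := IsWienerPair.sum (hW := hW) (T := T) (Finset.range N) fun i _ =>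
    IsWienerPair.indicator_Ioc hW (min_le_min_left t.toNNReal (gridTime_mono T N i.le_succ))
      (u := min t.toNNReal (gridTime T N (i + 1)))
      (by simp only [NNReal.coe_min, Real.coe_toNNReal _ ht.1]; exact (min_le_left _ _).trans ht.2) (β i)
  convert! h using 1
  funext ω
  simp [brownianSum, Finset.sum_apply]


theorem tendsto_eLpNorm_indicator_sub {b : ℝ → EuclideanSpace ℝ (Fin d)}
    {s : ℕ → ℝ → EuclideanSpace ℝ (Fin d)} {μ : Measure ℝ}
    (h : Tendsto (fun n => eLpNorm (s n - b) 2 μ) atTop (𝓝 0)) (A : ℕ → Set ℝ) :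
    Tendsto (fun n => eLpNorm ((A n).indicator (s n) - (A n).indicator b) 2 μ) atTop (𝓝 0) :=
  tendsto_of_tendsto_of_tendsto_of_le_of_le tendsto_const_nhds h (fun _ => zero_le) fun n => by
    simp only
    rw [← indicator_sub']
    exact eLpNorm_indicator_le _

/-- The Wiener integral of a square integrable function has a continuous version. -/
theorem exists_continuous_wienerIntegral (hW : IsStandardBrownian W P) (hT : 0 ≤ T)
    {b : ℝ → EuclideanSpace ℝ (Fin d)} (hb : MemLp b 2 (volume.restrict (Icc 0 T))) :
    ∃ M : ℝ → Ω → ℝ,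
      (∀ t ∈ Icc 0 T, AEStronglyMeasurable[pastSigma W t.toNNReal] (M t) P) ∧
      (∀ᵐ ω ∂P, ContinuousOn (fun t => M t ω) (Icc 0 T)) ∧
      ∀ t ∈ Icc 0 T, IsWienerPair hW T ((Ioc 0 t).indicator b) (M t) := by
  set μ := volume.restrict (Icc 0 T)
  -- With errors 4⁻ⁿ, consecutive approximations differ at T by at most 2·4⁻ⁿ in L². Doob's
  -- inequality at level 2⁻ⁿ then leaves probability at most 2·2⁻ⁿ, which is summable, and
  -- Borel–Cantelli gives uniform convergence of almost every path.
  have hε : ∀ n : ℕ, (0 : ℝ) < (1 / 4) ^ n := fun n => by positivity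
  choose N β hN _ _ hNβ using fun n => exists_gridStep_approx hT hb (hε n)
  set X : ℕ → ℝ≥0 → Ω → ℝ := fun n t =>
    brownianSum W (fun i => min t (gridTime T (N n) i)) (β n) (N n) with hX
  have hXc : ∀ᵐ ω ∂P, ∀ n, Continuous fun t : ℝ => X n t.toNNReal ω :=
    ae_all_iff.2 fun n => hW.ae_continuous_brownianSum _ _ _
  have hXm : ∀ n, Martingale (X n) hW.filtration P := fun n => hW.martingale_brownianSum _ _ _
  have hXp : ∀ n, ∀ t ∈ Icc 0 T, IsWienerPair hW T ((Ioc 0 t).indicator (gridStep T (N n) (β n)))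
      (X n t.toNNReal) := fun n t ht => isWienerPair_gridStep hW _ _ ht
  have hD1 : ∀ n, eLpNorm (X (n + 1) T.toNNReal - X n T.toNNReal) 1 P
      ≤ ENNReal.ofReal (2 * (1 / 4) ^ n) := fun n => by
    have hp := (hXp (n + 1) T ⟨hT, le_rfl⟩).sub (hXp n T ⟨hT, le_rfl⟩)
    refine (eLpNorm_le_eLpNorm_of_exponent_le one_le_two hp.memLp_snd.1).trans ?_
    rw [hp.eLpNorm_eq, ← indicator_sub']
    refine (eLpNorm_indicator_le _).trans ?_
    have e : gridStep T (N (n + 1)) (β (n + 1)) - gridStep T (N n) (β n)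
      = (gridStep T (N (n + 1)) (β (n + 1)) - b) - (gridStep T (N n) (β n) - b) := by abel
    rw [e]
    refine (eLpNorm_sub_le ((stronglyMeasurable_gridStep _ _ _).aestronglyMeasurable.sub hb.1)
      ((stronglyMeasurable_gridStep _ _ _).aestronglyMeasurable.sub hb.1) one_le_two).trans ?_
    rw [two_mul, ENNReal.ofReal_add (hε n).le (hε n).le]
    refine add_le_add ((hNβ (n + 1)).trans (ENNReal.ofReal_le_ofReal ?_)) (hNβ n)
    exact pow_le_pow_of_le_one (by norm_num) (by norm_num) n.le_succ
  have hP : ∀ n, P {ω | ∃ t ∈ Icc 0 T, (((1 / 2) ^ n : ℝ≥0) : ℝ)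
      < |X (n + 1) t.toNNReal ω - X n t.toNNReal ω|} ≤ ENNReal.ofReal (2 * (1 / 2) ^ n) := fun n => by
    have h1 := ((hXm (n + 1)).sub (hXm n)).measure_exists_lt_abs_le (T := T) hT
      (hXc.mono fun ω h => ((h (n + 1)).sub (h n)).continuousOn)
      (ε := (1 / 2) ^ n) (by positivity)
    refine h1.trans ?_
    rw [ENNReal.div_le_iff_le_mul (Or.inl (by positivity)) (Or.inl ENNReal.coe_ne_top)]
    refine (hD1 n).trans (le_of_eq ?_)
    rw [← ENNReal.ofReal_coe_nnreal, ← ENNReal.ofReal_mul (by positivity)]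
    congr 1
    push_cast
    rw [mul_assoc, ← mul_pow]
    norm_num
  have hsum : ∑' n, P {ω | ∃ t ∈ Icc 0 T, (((1 / 2) ^ n : ℝ≥0) : ℝ)
      < |X (n + 1) t.toNNReal ω - X n t.toNNReal ω|} ≠ ∞ := by
    refine ne_top_of_le_ne_top ?_ (ENNReal.tsum_le_tsum hP)
    exact (summable_geometric_two.mul_left 2).tsum_ofReal_ne_top
  have hlim : ∀ᵐ ω ∂P, ∃ n₀ : ℕ, ∀ t ∈ Icc 0 T, ∀ n, dist (X (n₀ + n) t.toNNReal ω)
      (X (n₀ + (n + 1)) t.toNNReal ω) ≤ 1 * (1 / 2) ^ n := by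
    filter_upwards [ae_eventually_notMem hsum] with ω hω
    obtain ⟨n₀, hn₀⟩ := eventually_atTop.1 hω
    refine ⟨n₀, fun t ht n => ?_⟩
    have h1 := hn₀ (n₀ + n) (by omega)
    simp only [not_exists, not_and, not_lt] at h1
    rw [dist_comm, Real.dist_eq, one_mul]
    refine (h1 t ht).trans ?_
    push_cast
    exact pow_le_pow_of_le_one (by norm_num) (by norm_num) (by omega)
  -- Taking `limUnder` everywhere, with its default value where the sequence diverges, keeps the
  -- limit measurable for the raw past.
  set L : ℝ → Ω → ℝ := fun t ω => limUnder atTop fun n => X n t.toNNReal ω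
  have hL : ∀ᵐ ω ∂P, ∀ t ∈ Icc 0 T, Tendsto (fun n => X n t.toNNReal ω) atTop (𝓝 (L t ω)) := by
    filter_upwards [hlim] with ω ⟨n₀, hω⟩ t ht
    have h1 := cauchySeq_of_le_geometric (f := fun n => X (n₀ + n) t.toNNReal ω) (1 / 2) 1
      (by norm_num) (hω t ht)
    obtain ⟨a, ha⟩ := cauchySeq_tendsto_of_complete h1
    have ha' : Tendsto (fun n => X n t.toNNReal ω) atTop (𝓝 a) := by
      refine (tendsto_add_atTop_iff_nat n₀).1 (ha.congr fun n => ?_)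
      rw [add_comm]
    exact tendsto_nhds_limUnder ⟨a, ha'⟩
  refine ⟨L, fun t ht => ?_, ?_, fun t ht => ?_⟩
  · have h : @StronglyMeasurable _ _ _ (pastSigma W t.toNNReal) (L t) := by
      refine @StronglyMeasurable.limUnder _ _ _ (pastSigma W t.toNNReal) _ _ _ _ _ _ _ ?_
      exact fun n => (hXm n).1 t.toNNReal
    exact h.aestronglyMeasurable
  · filter_upwards [hlim, hL, hXc] with ω ⟨n₀, hω⟩ hLω hc
    have hunif : TendstoUniformlyOn (fun n t => X (n₀ + n) t.toNNReal ω) (fun t => L t ω) atTop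
        (Icc 0 T) := by
      have h0 : Tendsto (fun n : ℕ => 1 * (1 / 2 : ℝ) ^ n / (1 - 1 / 2)) atTop (𝓝 0) := by
        simpa using ((tendsto_pow_atTop_nhds_zero_of_lt_one (r := (1 / 2 : ℝ)) (by norm_num)
          (by norm_num)).const_mul 1).div_const (1 - 1 / 2)
      rw [Metric.tendstoUniformlyOn_iff]
      intro ε hε
      filter_upwards [h0.eventually (gt_mem_nhds hε)] with n hn t ht
      rw [dist_comm]
      refine lt_of_le_of_lt (dist_le_of_le_geometric_of_tendsto (1 / 2) 1 (by norm_num)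
        (hω t ht) ?_ n) hn
      exact ((tendsto_add_atTop_iff_nat n₀).2 (hLω t ht)).congr fun n => by rw [add_comm]
    exact hunif.continuousOn (Frequently.of_forall fun n => (hc _).continuousOn)
  · refine IsWienerPair.of_tendsto (fun n => hXp n t ht) (hb.indicator measurableSet_Ioc) ?_
      (hL.mono fun ω h => h t ht)
    refine tendsto_eLpNorm_indicator_sub ?_ fun _ => Ioc 0 t
    refine tendsto_of_tendsto_of_tendsto_of_le_of_le tendsto_const_nhds ?_ (fun _ => zero_le) hNβ
    rw [← ENNReal.ofReal_zero]
    exact ENNReal.tendsto_ofReal (tendsto_pow_atTop_nhds_zero_of_lt_one (by norm_num) (by norm_num))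

end ContinuousIntegral

/-! ### Approximation of the integrands X b by elementary ones -/

theorem eLpNorm_two_sq_eq_lintegral {α E : Type*} [MeasurableSpace α] [NormedAddCommGroup E]
    (f : α → E) (μ : Measure α) : eLpNorm f 2 μ ^ 2 = ∫⁻ x, ‖f x‖ₑ ^ 2 ∂μ := by
  have h := eLpNorm_nnreal_pow_eq_lintegral (f := f) (μ := μ) (p := 2) (by norm_num)
  simpa only [NNReal.coe_ofNat, ENNReal.coe_ofNat, ENNReal.rpow_ofNat] using h

theorem eLpNorm_two_sq_eq_ofReal {α E : Type*} [MeasurableSpace α] [NormedAddCommGroup E]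
    {f : α → E} {μ : Measure α} (hf : MemLp f 2 μ) :
    eLpNorm f 2 μ ^ 2 = ENNReal.ofReal (∫ x, ‖f x‖ ^ 2 ∂μ) := by
  rw [eLpNorm_two_sq_eq_lintegral, ofReal_integral_eq_lintegral_ofReal (MemLp.integrable_norm_pow (p := 2) hf two_ne_zero)
    (ae_of_all _ fun x => by positivity)]
  refine lintegral_congr fun x => ?_
  rw [ENNReal.ofReal_pow (norm_nonneg _), ofReal_norm]

theorem tendsto_zero_of_sq {ι : Type*} {l : Filter ι} {f : ι → ℝ≥0∞}
    (h : Tendsto (fun i => f i ^ 2) l (𝓝 0)) : Tendsto f l (𝓝 0) := by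
  have h1 := (ENNReal.continuous_rpow_const (y := 1 / 2)).tendsto 0 |>.comp h
  rw [ENNReal.zero_rpow_of_pos (by norm_num)] at h1
  refine h1.congr fun i => ?_
  simp only [Function.comp_apply]
  rw [← ENNReal.rpow_natCast, ← ENNReal.rpow_mul]
  norm_num

section Approximation

variable {Ω : Type*} [MeasurableSpace Ω] {P : Measure Ω} [IsProbabilityMeasure P] {T : ℝ} {d : ℕ}

theorem eLpNorm_smul_comp_fst_sq {E : Type*} [NormedAddCommGroup E] [NormedSpace ℝ E]
    {μ : Measure ℝ} [SFinite μ] {g : ℝ × Ω → ℝ} {f : ℝ → E}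
    (hg : AEStronglyMeasurable g (μ.prod P)) (hf : AEStronglyMeasurable f μ) :
    eLpNorm (fun p : ℝ × Ω => g p • f p.1) 2 (μ.prod P) ^ 2
      = ∫⁻ u, eLpNorm (fun ω => g (u, ω)) 2 P ^ 2 * ‖f u‖ₑ ^ 2 ∂μ := by
  rw [eLpNorm_two_sq_eq_lintegral, lintegral_prod (fun p : ℝ × Ω => ‖g p • f p.1‖ₑ ^ 2)
    ((hg.smul hf.comp_fst).enorm.pow_const 2)]
  refine lintegral_congr fun u => ?_
  rw [eLpNorm_two_sq_eq_lintegral, ← lintegral_mul_const' _ _ (by simp)]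
  simp_rw [enorm_smul, mul_pow]

theorem aemeasurable_eLpNorm_section_sq {μ : Measure ℝ} [SFinite μ] {g : ℝ × Ω → ℝ}
    (hg : AEStronglyMeasurable g (μ.prod P)) :
    AEMeasurable (fun u => eLpNorm (fun ω => g (u, ω)) 2 P ^ 2) μ := by
  simp_rw [eLpNorm_two_sq_eq_lintegral]
  exact (hg.enorm.pow_const 2).lintegral_prod_right'

/-- Elementary integrands `∑ ξ_i β_i 1_{(t_i, t_{i+1}]}` converge to `X b`. -/
theorem tendsto_eLpNorm_elementary (hT : 0 ≤ T) {b : ℝ → EuclideanSpace ℝ (Fin d)}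
    (hb : MemLp b 2 (volume.restrict (Icc 0 T))) {N : ℕ → ℕ} (hN : ∀ n, N n ≠ 0)
    {β : ℕ → ℕ → EuclideanSpace ℝ (Fin d)}
    (hβ : Tendsto (fun n => eLpNorm (gridStep T (N n) (β n) - b) 2 (volume.restrict (Icc 0 T)))
      atTop (𝓝 0))
    {ξ : ℕ → ℕ → Ω → ℝ} (hξ : ∀ n i, AEStronglyMeasurable (ξ n i) P) {X : ℝ → Ω → ℝ}
    (hX : AEStronglyMeasurable (fun p : ℝ × Ω => X p.1 p.2) ((volume.restrict (Icc 0 T)).prod P))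
    {K : ℝ≥0} (hK : ∀ n, ∀ i ≤ N n, eLpNorm (ξ n i) 2 P ≤ K)
    (hXK : ∀ u ∈ Icc 0 T, eLpNorm (X u) 2 P ≤ K)
    (hlim : ∀ u ∈ Ioc 0 T, ∀ i : ℕ → ℕ, (∀ n, i n < N n) →
      (∀ n, u ∈ Ioc (gridTime T (N n) (i n) : ℝ) (gridTime T (N n) (i n + 1))) →
      Tendsto (fun n => eLpNorm (ξ n (i n) - X u) 2 P) atTop (𝓝 0)) :
    Tendsto (fun n => eLpNorm (fun p : ℝ × Ω => (∑ i ∈ Finset.range (N n),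
        (Ioc (gridTime T (N n) i : ℝ) (gridTime T (N n) (i + 1))).indicator
          (fun _ => ξ n i p.2 • β n i) p.1) - X p.1 p.2 • b p.1) 2
      ((volume.restrict (Icc 0 T)).prod P)) atTop (𝓝 0) := by
  set μ := volume.restrict (Icc 0 T) with hμ
  set g : ℕ → ℝ × Ω → ℝ := fun n p => ∑ i ∈ Finset.range (N n),
        (Ioc (gridTime T (N n) i : ℝ) (gridTime T (N n) (i + 1))).indicator
          (fun _ => ξ n i p.2) p.1 with hg
  have hgm : ∀ n, AEStronglyMeasurable (g n) (μ.prod P) := fun n => by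
    refine Finset.aestronglyMeasurable_fun_sum _ fun i _ => ?_
    exact (AEStronglyMeasurable.comp_snd (hξ n i)).indicator (measurable_fst measurableSet_Ioc)
  have hgval : ∀ n, ∀ u ∈ Ioc 0 T, ∃ i < N n,
      u ∈ Ioc (gridTime T (N n) i : ℝ) (gridTime T (N n) (i + 1)) ∧ ∀ ω, g n (u, ω) = ξ n i ω := by
    intro n u hu
    obtain ⟨i, hi, hui⟩ := exists_mem_gridCell hT (hN n) hu
    exact ⟨i, hi, hui, fun ω => sum_indicator_Ioc_eq (gridTime_mono T (N n)) (fun i => ξ n i ω) hi hui⟩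
  have hae : ∀ᵐ p ∂(μ.prod P), p.1 ∈ Ioc 0 T :=
    Measure.quasiMeasurePreserving_fst.ae (ae_mem_Ioc_restrict_Icc T)
  have hsm : ∀ n, AEStronglyMeasurable (gridStep T (N n) (β n) - b) μ := fun n =>
    (stronglyMeasurable_gridStep _ _ _).aestronglyMeasurable.sub hb.1
  -- The error splits as ξ(β - b) + (ξ - X)b. The first part is at most K ‖β - b‖ by Tonelli; the
  -- second is handled by dominated convergence in time, with majorant (2K)²|b|².
  have hA : Tendsto (fun n => eLpNorm (fun p : ℝ × Ω => g n p • (gridStep T (N n) (β n) - b) p.1) 2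
      (μ.prod P)) atTop (𝓝 0) := by
    refine tendsto_zero_of_sq ?_
    have h2 : Tendsto (fun n => (K : ℝ≥0∞) ^ 2 * eLpNorm (gridStep T (N n) (β n) - b) 2 μ ^ 2) atTop
        (𝓝 0) := by
      have := ENNReal.Tendsto.const_mul (a := (K : ℝ≥0∞) ^ 2) (ENNReal.Tendsto.pow (n := 2) hβ)
        (Or.inr (by simp))
      simpa using this
    refine tendsto_of_tendsto_of_tendsto_of_le_of_le tendsto_const_nhds h2 (fun _ => zero_le)
      fun n => ?_
    simp only
    rw [eLpNorm_smul_comp_fst_sq (hgm n) (hsm n), eLpNorm_two_sq_eq_lintegral,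
      ← lintegral_const_mul' _ _ (by simp)]
    refine lintegral_mono_ae ?_
    filter_upwards [ae_mem_Ioc_restrict_Icc T] with u hu
    obtain ⟨i, hi, -, h⟩ := hgval n u hu
    have e : (fun ω => g n (u, ω)) = ξ n i := funext h
    rw [e]
    gcongr
    exact hK n i hi.le
  have hB : Tendsto (fun n => eLpNorm (fun p : ℝ × Ω => (g n p - X p.1 p.2) • b p.1) 2 (μ.prod P))
      atTop (𝓝 0) := by
    refine tendsto_zero_of_sq ?_
    refine (tendsto_congr fun n => eLpNorm_smul_comp_fst_sq ((hgm n).sub hX) hb.1).2 ?_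
    rw [← lintegral_zero (μ := μ)]
    refine tendsto_lintegral_of_dominated_convergence' (fun u => (2 * K : ℝ≥0∞) ^ 2 * ‖b u‖ₑ ^ 2)
      (fun n => (aemeasurable_eLpNorm_section_sq ((hgm n).sub hX)).mul (hb.1.enorm.pow_const 2))
      (fun n => ?_) ?_ ?_
    · filter_upwards [ae_mem_Ioc_restrict_Icc T, hX.prodMk_left] with u hu hXu
      obtain ⟨i, hi, -, h⟩ := hgval n u hu
      have e : (fun ω => (g n - fun p : ℝ × Ω => X p.1 p.2) (u, ω)) = ξ n i - X u := by
        funext ω; simp [h ω]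
      rw [e]
      gcongr
      rw [two_mul]
      exact (eLpNorm_sub_le (hξ n i) hXu one_le_two).trans
        (add_le_add (hK n i hi.le) (hXK u ⟨hu.1.le, hu.2⟩))
    · rw [lintegral_const_mul' _ _ (by finiteness), ← eLpNorm_two_sq_eq_lintegral]
      exact ENNReal.mul_ne_top (by finiteness) (by finiteness [hb.2.ne])
    · filter_upwards [ae_mem_Ioc_restrict_Icc T] with u hu
      choose i hi hui h using fun n => hgval n u hu
      have e : ∀ n, (fun ω => (g n - fun p : ℝ × Ω => X p.1 p.2) (u, ω)) = ξ n (i n) - X u := fun n => by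
        funext ω; simp [h n ω]
      simp_rw [e]
      have h1 := hlim u hu i hi hui
      have h2 := ENNReal.Tendsto.mul_const (b := ‖b u‖ₑ ^ 2) (ENNReal.Tendsto.pow (n := 2) h1)
        (Or.inr (by finiteness))
      simpa using h2
  have hAB := hA.add hB
  rw [add_zero] at hAB
  refine tendsto_of_tendsto_of_tendsto_of_le_of_le tendsto_const_nhds hAB (fun _ => zero_le)
      fun n => ?_
  refine le_trans (le_of_eq (eLpNorm_congr_ae ?_)) (eLpNorm_add_le
    ((hgm n).smul (hsm n).comp_fst) (((hgm n).sub hX).smul hb.1.comp_fst) one_le_two)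
  filter_upwards [hae] with p hp
  obtain ⟨i, hi, hpi⟩ := exists_mem_gridCell hT (hN n) hp
  rw [sum_indicator_Ioc_eq (gridTime_mono T (N n)) (fun i => ξ n i p.2 • β n i) hi hpi]
  have h1 : g n p = ξ n i p.2 :=
    sum_indicator_Ioc_eq (gridTime_mono T (N n)) (fun i => ξ n i p.2) hi hpi
  simp only [Pi.add_apply, Pi.sub_apply, h1, gridStep_eq hi (β n) hpi]
  module

end Approximation

/-! ### Grid approximations of the exponential martingale -/

section GridApproximation

variable {Ω : Type*} [MeasurableSpace Ω] {d : ℕ} {W : ℝ≥0 → Ω → EuclideanSpace ℝ (Fin d)}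
  {P : Measure Ω} [IsProbabilityMeasure P] {T : ℝ} {hW : IsStandardBrownian W P}
  {f : ℝ → EuclideanSpace ℝ (Fin d)} {Z : Ω → ℝ}

theorem IsWienerPair.eLpNorm_wickExp_le (h : IsWienerPair hW T f Z) {B : ℝ}
    (hB : ∫ u in Icc 0 T, ‖f u‖ ^ 2 ≤ B) :
    eLpNorm (wickExp T f Z) 2 P ≤ ENNReal.ofReal (Real.exp (B / 2)) := by
  rw [← ENNReal.pow_le_pow_left_iff two_ne_zero, eLpNorm_two_sq_eq_ofReal h.memLp_wickExp,
    ← ENNReal.ofReal_pow (Real.exp_pos _).le]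
  simp_rw [Real.norm_eq_abs, sq_abs]
  rw [h.integral_wickExp_sq, ← Real.exp_nat_mul]
  refine ENNReal.ofReal_le_ofReal (Real.exp_le_exp.2 (hB.trans (le_of_eq ?_)))
  push_cast; ring

theorem IsWienerPair.tendsto_eLpNorm_wickExp_sub {fn : ℕ → ℝ → EuclideanSpace ℝ (Fin d)}
    {Zn : ℕ → Ω → ℝ} (hn : ∀ n, IsWienerPair hW T (fn n) (Zn n)) (h : IsWienerPair hW T f Z)
    (hlim : Tendsto (fun n => eLpNorm (fn n - f) 2 (volume.restrict (Icc 0 T))) atTop (𝓝 0)) :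
    Tendsto (fun n => eLpNorm (wickExp T (fn n) (Zn n) - wickExp T f Z) 2 P) atTop (𝓝 0) := by
  refine tendsto_zero_of_sq ?_
  have h1 := ENNReal.tendsto_ofReal (IsWienerPair.tendsto_integral_wickExp_sub_sq hn h hlim)
  rw [ENNReal.ofReal_zero] at h1
  refine h1.congr fun n => ?_
  rw [eLpNorm_two_sq_eq_ofReal ((hn n).memLp_wickExp.sub h.memLp_wickExp)]
  simp_rw [Real.norm_eq_abs, sq_abs, Pi.sub_apply]

theorem brownianSum_min_of_le {τ : ℕ → ℝ≥0} (hτ : Monotone τ) (β : ℕ → EuclideanSpace ℝ (Fin d))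
    {i : ℕ} {t : ℝ≥0} (hi : τ i ≤ t) (ω : Ω) :
    brownianSum W (fun k => min t (τ k)) β i ω = brownianSum W τ β i ω := by
  refine Finset.sum_congr rfl fun k hk => ?_
  have hk' := Finset.mem_range.1 hk
  beta_reduce
  rw [min_eq_right ((hτ (by omega : k ≤ i)).trans hi),
    min_eq_right ((hτ (by omega : k + 1 ≤ i)).trans hi)]

theorem brownianVar_min_of_le {τ : ℕ → ℝ≥0} (hτ : Monotone τ) (β : ℕ → EuclideanSpace ℝ (Fin d))
    {i : ℕ} {t : ℝ≥0} (hi : τ i ≤ t) :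
    brownianVar (fun k => min t (τ k)) β i = brownianVar τ β i := by
  refine Finset.sum_congr rfl fun k hk => ?_
  have hk' := Finset.mem_range.1 hk
  beta_reduce
  rw [min_eq_right ((hτ (by omega : k ≤ i)).trans hi),
    min_eq_right ((hτ (by omega : k + 1 ≤ i)).trans hi)]

theorem brownianExp_min_of_le {τ : ℕ → ℝ≥0} (hτ : Monotone τ) (β : ℕ → EuclideanSpace ℝ (Fin d))
    {i : ℕ} {t : ℝ≥0} (hi : τ i ≤ t) :
    brownianExp W (fun k => min t (τ k)) β i = brownianExp W τ β i := by
  funext ω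
  rw [brownianExp, brownianExp, brownianSum_min_of_le hτ β hi, brownianVar_min_of_le hτ β hi]

/-- Stopping at the grid point τ_i freezes all later increments. Partial exponentials thereby become
stopped full ones, whose Wiener integrands are truncated step functions. -/
theorem brownianExp_min_eq {τ : ℕ → ℝ≥0} (hτ : Monotone τ) (β : ℕ → EuclideanSpace ℝ (Fin d))
    {i n : ℕ} (hin : i ≤ n) :
    brownianExp W (fun k => min (τ i) (τ k)) β n = brownianExp W τ β i := by
  rw [← brownianExp_min_of_le hτ β le_rfl]
  have hz : ∀ k ∈ Finset.range n, k ∉ Finset.range i →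
      min (τ i) (τ (k + 1)) = τ i ∧ min (τ i) (τ k) = τ i := fun k _ hk => by
    rw [Finset.mem_range, not_lt] at hk
    exact ⟨min_eq_left (hτ (by omega)), min_eq_left (hτ hk)⟩
  funext ω
  unfold brownianExp brownianSum brownianVar
  rw [Finset.sum_subset (Finset.range_mono hin), Finset.sum_subset (Finset.range_mono hin)]
  · intro k hk hki
    beta_reduce
    rw [(hz k hk hki).1, (hz k hk hki).2, sub_self, mul_zero]
  · intro k hk hki
    beta_reduce
    rw [(hz k hk hki).1, (hz k hk hki).2, sub_self, inner_zero_right]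

/-- Grids and step functions which approximate a square integrable function. -/
structure IsGridApprox (T : ℝ) (b : ℝ → EuclideanSpace ℝ (Fin d)) (N : ℕ → ℕ)
    (β : ℕ → ℕ → EuclideanSpace ℝ (Fin d)) : Prop where
  ne_zero : ∀ n, N n ≠ 0
  mesh : ∀ n, T / N n ≤ (1 / 2) ^ n
  small : ∀ n i, ‖β n i‖ ^ 2 * (T / N n) ≤ (1 / 2) ^ n
  close : ∀ n, eLpNorm (gridStep T (N n) (β n) - b) 2 (volume.restrict (Icc 0 T))
    ≤ ENNReal.ofReal ((1 / 2) ^ n)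

theorem exists_isGridApprox (hT : 0 ≤ T) {b : ℝ → EuclideanSpace ℝ (Fin d)}
    (hb : MemLp b 2 (volume.restrict (Icc 0 T))) : ∃ N β, IsGridApprox T b N β := by
  choose N β h1 h2 h3 h4 using fun n : ℕ =>
    exists_gridStep_approx hT hb (show (0 : ℝ) < (1 / 2) ^ n by positivity)
  exact ⟨N, β, h1, h2, h3, h4⟩

theorem tendsto_half_pow : Tendsto (fun n : ℕ => (1 / 2 : ℝ) ^ n) atTop (𝓝 0) :=
  tendsto_pow_atTop_nhds_zero_of_lt_one (by norm_num) (by norm_num)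

theorem integral_norm_sq_indicator_le {f : ℝ → EuclideanSpace ℝ (Fin d)}
    (hf : MemLp f 2 (volume.restrict (Icc 0 T))) (t : ℝ) :
    ∫ u in Icc 0 T, ‖(Ioc 0 t).indicator f u‖ ^ 2 ≤ ∫ u in Icc 0 T, ‖f u‖ ^ 2 := by
  refine integral_mono (MemLp.integrable_norm_pow (p := 2) (hf.indicator measurableSet_Ioc)
    two_ne_zero) (MemLp.integrable_norm_pow (p := 2) hf two_ne_zero) fun u => ?_
  simp only
  gcongr
  exact norm_indicator_le_norm_self _ _

namespace IsGridApprox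

variable {b : ℝ → EuclideanSpace ℝ (Fin d)} {N : ℕ → ℕ} {β : ℕ → ℕ → EuclideanSpace ℝ (Fin d)}

theorem tendsto (h : IsGridApprox T b N β) :
    Tendsto (fun n => eLpNorm (gridStep T (N n) (β n) - b) 2 (volume.restrict (Icc 0 T)))
      atTop (𝓝 0) := by
  refine tendsto_of_tendsto_of_tendsto_of_le_of_le tendsto_const_nhds ?_ (fun _ => zero_le) h.close
  rw [← ENNReal.ofReal_zero]
  exact ENNReal.tendsto_ofReal tendsto_half_pow

theorem memLp_gridStep (h : IsGridApprox T b N β) (hb : MemLp b 2 (volume.restrict (Icc 0 T)))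
    (n : ℕ) : MemLp (gridStep T (N n) (β n)) 2 (volume.restrict (Icc 0 T)) := by
  have h1 : MemLp (gridStep T (N n) (β n) - b) 2 (volume.restrict (Icc 0 T)) :=
    ⟨(stronglyMeasurable_gridStep _ _ _).aestronglyMeasurable.sub hb.1,
      (h.close n).trans_lt ENNReal.ofReal_lt_top⟩
  simpa using h1.add hb

theorem exists_bound (h : IsGridApprox T b N β) (hb : MemLp b 2 (volume.restrict (Icc 0 T))) :
    ∃ B : ℝ, (∫ u in Icc 0 T, ‖b u‖ ^ 2 ≤ B) ∧
      ∀ n, ∫ u in Icc 0 T, ‖gridStep T (N n) (β n) u‖ ^ 2 ≤ B := by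
  have hfin : (eLpNorm b 2 (volume.restrict (Icc 0 T)) + 1) ^ 2 ≠ ∞ := by finiteness [hb.2.ne]
  refine ⟨((eLpNorm b 2 (volume.restrict (Icc 0 T)) + 1) ^ 2).toReal, ?_, fun n => ?_⟩
  · rw [← ENNReal.ofReal_le_iff_le_toReal hfin, ← eLpNorm_two_sq_eq_ofReal hb]
    gcongr
    exact le_self_add
  · rw [← ENNReal.ofReal_le_iff_le_toReal hfin, ← eLpNorm_two_sq_eq_ofReal (h.memLp_gridStep hb n)]
    gcongr
    have e : gridStep T (N n) (β n) = b + (gridStep T (N n) (β n) - b) := by abel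
    rw [e]
    refine (eLpNorm_add_le hb.1 ((stronglyMeasurable_gridStep _ _ _).aestronglyMeasurable.sub hb.1)
      one_le_two).trans ?_
    gcongr
    refine (h.close n).trans ?_
    rw [ENNReal.ofReal_le_one]
    exact pow_le_one₀ (by norm_num) (by norm_num)

theorem norm_sq_mul_le (h : IsGridApprox T b N β) (hT : 0 ≤ T) (n i : ℕ) :
    ‖β n i‖ ^ 2 * ((gridTime T (N n) (i + 1) : ℝ) - gridTime T (N n) i) ≤ (1 / 2) ^ n := by
  rw [coe_gridTime_succ hT, add_sub_cancel_left]
  exact h.small n i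

theorem norm_sq_mul_min_le (h : IsGridApprox T b N β) (hT : 0 ≤ T) (n i : ℕ) (t : ℝ≥0) :
    ‖β n i‖ ^ 2 * (((min t (gridTime T (N n) (i + 1)) : ℝ≥0) : ℝ)
      - (min t (gridTime T (N n) i) : ℝ≥0)) ≤ (1 / 2) ^ n := by
  refine le_trans ?_ (h.norm_sq_mul_le hT n i)
  refine mul_le_mul_of_nonneg_left ?_ (by positivity)
  have h1 : (gridTime T (N n) i : ℝ) ≤ gridTime T (N n) (i + 1) := gridTime_mono T (N n) i.le_succ
  simp only [NNReal.coe_min]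
  rcases le_total (t : ℝ) (gridTime T (N n) i) with h2 | h2
  · rw [min_eq_left h2, min_eq_left (h2.trans h1)]; linarith
  · rw [min_eq_right h2]; linarith [min_le_right (t : ℝ) (gridTime T (N n) (i + 1))]

end IsGridApprox

theorem half_pow_le_one (n : ℕ) : (1 / 2 : ℝ) ^ n ≤ 1 := pow_le_one₀ (by norm_num) (by norm_num)

/-- The variance of the Wiener integral of a step function up to time `t`. -/
theorem brownianVar_min_eq (hW : IsStandardBrownian W P) (N : ℕ)
    (β : ℕ → EuclideanSpace ℝ (Fin d)) {δ : ℝ} (hδ : δ ≤ 1) {t : ℝ} (ht : t ∈ Icc 0 T)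
    (hβ : ∀ i, ‖β i‖ ^ 2 * (((min t.toNNReal (gridTime T N (i + 1)) : ℝ≥0) : ℝ)
      - (min t.toNNReal (gridTime T N i) : ℝ≥0)) ≤ δ) :
    brownianVar (fun i => min t.toNNReal (gridTime T N i)) β N
      = ∫ u in Icc 0 T, ‖(Ioc 0 t).indicator (gridStep T N β) u‖ ^ 2 := by
  have hp := isWienerPair_gridStep hW N β ht
  set τ := fun i => min t.toNNReal (gridTime T N i) with hτ
  have hmono : Monotone τ := fun i j hij => min_le_min_left _ (gridTime_mono T N hij)
  -- The second moment of the exponential is computed twice, as e^{var} from the step recursion and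
  -- from the Gaussian moment generating function at 2; comparing exponents identifies the variance.
  have h1 := (brownianExp_sub_sum hW hmono β hδ hβ N).2.1
  have h2 : ∀ ω, brownianExp W τ β N ω ^ 2
      = Real.exp (2 * brownianSum W τ β N ω) * Real.exp (-brownianVar τ β N) := fun ω => by
    rw [brownianExp, ← Real.exp_add, ← Real.exp_nat_mul]
    congr 1; push_cast; ring
  simp_rw [h2] at h1
  rw [integral_mul_const, hp.integral_exp, ← Real.exp_add, Real.exp_eq_exp] at h1
  linarith

theorem brownianExp_min_eq_wickExp (hW : IsStandardBrownian W P) (N : ℕ)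
    (β : ℕ → EuclideanSpace ℝ (Fin d)) {δ : ℝ} (hδ : δ ≤ 1) {t : ℝ} (ht : t ∈ Icc 0 T)
    (hβ : ∀ i, ‖β i‖ ^ 2 * (((min t.toNNReal (gridTime T N (i + 1)) : ℝ≥0) : ℝ)
      - (min t.toNNReal (gridTime T N i) : ℝ≥0)) ≤ δ) :
    brownianExp W (fun i => min t.toNNReal (gridTime T N i)) β N
      = wickExp T ((Ioc 0 t).indicator (gridStep T N β))
        (brownianSum W (fun i => min t.toNNReal (gridTime T N i)) β N) := by
  funext ω
  rw [brownianExp, wickExp, brownianVar_min_eq hW N β hδ ht hβ]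

/-- The difference lives on (s_n, t], whose length tends to 0, so absolute continuity of the L² norm
applies. -/
theorem tendsto_eLpNorm_indicator_Ioc {b : ℝ → EuclideanSpace ℝ (Fin d)} {μ : Measure ℝ}
    (hμ : μ ≤ volume) (hb : MemLp b 2 μ) {s : ℕ → ℝ} {t : ℝ} (hst : ∀ n, s n ≤ t)
    (hs : Tendsto s atTop (𝓝 t)) :
    Tendsto (fun n => eLpNorm ((Ioc 0 (s n)).indicator b - (Ioc 0 t).indicator b) 2 μ) atTop
      (𝓝 0) := by
  have h1 : ∀ n, eLpNorm ((Ioc 0 (s n)).indicator b - (Ioc 0 t).indicator b) 2 μ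
      ≤ eLpNorm ((Ioc (s n) t).indicator b) 2 μ := fun n => by
    refine eLpNorm_mono fun u => ?_
    simp only [Pi.sub_apply]
    by_cases hu : u ∈ Ioc (s n) t
    · rw [indicator_of_mem hu, indicator_of_notMem (fun h => absurd h.2 (not_le.2 hu.1)), zero_sub,
        norm_neg]
      exact norm_indicator_le_norm_self _ _
    · rw [indicator_of_notMem hu]
      by_cases h0 : u ∈ Ioc 0 (s n)
      · have h0' : u ∈ Ioc 0 t := ⟨h0.1, h0.2.trans (hst n)⟩
        rw [indicator_of_mem h0, indicator_of_mem h0', sub_self]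
      · rw [indicator_of_notMem h0, indicator_of_notMem, sub_self]
        exact fun h => hu ⟨not_le.1 fun h2 => h0 ⟨h.1, h2⟩, h.2⟩
  refine tendsto_of_tendsto_of_tendsto_of_le_of_le tendsto_const_nhds ?_ (fun _ => zero_le) h1
  rw [ENNReal.tendsto_nhds_zero]
  intro ε hε
  rcases eq_or_ne ε ∞ with rfl | hε'
  · exact Eventually.of_forall fun _ => le_top
  obtain ⟨δ, hδ, hδb⟩ := hb.eLpNorm_indicator_le one_le_two (by norm_num)
    (ENNReal.toReal_pos hε.ne' hε')
  have h2 : ∀ᶠ n in atTop, t - s n < δ := by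
    have : Tendsto (fun n => t - s n) atTop (𝓝 (t - t)) := hs.const_sub t
    rw [sub_self] at this
    exact this.eventually (gt_mem_nhds hδ)
  filter_upwards [h2] with n hn
  refine (hδb _ measurableSet_Ioc ((hμ _).trans ?_)).trans_eq (ENNReal.ofReal_toReal hε')
  rw [Real.volume_Ioc]
  exact ENNReal.ofReal_le_ofReal hn.le

end GridApproximation

/-! ### The exponential martingale and its elementary approximations -/

section Existence

variable {Ω : Type*} [MeasurableSpace Ω] {d : ℕ} {W : ℝ≥0 → Ω → EuclideanSpace ℝ (Fin d)}
  {P : Measure Ω} [IsProbabilityMeasure P] {T : ℝ} {hW : IsStandardBrownian W P}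
  {b : ℝ → EuclideanSpace ℝ (Fin d)} {M : ℝ → Ω → ℝ}

/-- `M_t = ∫₀ᵗ b_u' dW_u`, with continuous paths. -/
structure IsWienerIntegral (hW : IsStandardBrownian W P) (T : ℝ)
    (b : ℝ → EuclideanSpace ℝ (Fin d)) (M : ℝ → Ω → ℝ) : Prop where
  adapted : ∀ t ∈ Icc 0 T, AEStronglyMeasurable[pastSigma W t.toNNReal] (M t) P
  cont : ∀ᵐ ω ∂P, ContinuousOn (fun t => M t ω) (Icc 0 T)
  pair : ∀ t ∈ Icc 0 T, IsWienerPair hW T ((Ioc 0 t).indicator b) (M t)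

/-- The exponential martingale `exp (M_t - ∫₀ᵗ |b_u|² du / 2)`. -/
noncomputable def doleansExp (T : ℝ) (b : ℝ → EuclideanSpace ℝ (Fin d)) (M : ℝ → Ω → ℝ) (t : ℝ) :
    Ω → ℝ :=
  wickExp T ((Ioc 0 t).indicator b) (M t)

theorem integral_Icc_norm_sq_indicator (b : ℝ → EuclideanSpace ℝ (Fin d)) {t : ℝ}
    (ht : t ∈ Icc 0 T) :
    ∫ u in Icc 0 T, ‖(Ioc 0 t).indicator b u‖ ^ 2 = ∫ u in (0 : ℝ)..t, ‖b u‖ ^ 2 := by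
  have h1 : (fun u => ‖(Ioc 0 t).indicator b u‖ ^ 2) = (Ioc 0 t).indicator fun u => ‖b u‖ ^ 2 := by
    funext u
    by_cases hu : u ∈ Ioc 0 t <;> simp [hu]
  rw [h1, integral_indicator measurableSet_Ioc, Measure.restrict_restrict measurableSet_Ioc,
    inter_eq_left.2 (Ioc_subset_Icc_self.trans (Icc_subset_Icc_right ht.2)),
    intervalIntegral.integral_of_le ht.1]

theorem doleansExp_eq (M : ℝ → Ω → ℝ) {t : ℝ} (ht : t ∈ Icc 0 T) (ω : Ω) :
    doleansExp T b M t ω = Real.exp (M t ω - (∫ u in (0 : ℝ)..t, ‖b u‖ ^ 2) / 2) := by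
  rw [doleansExp, wickExp, integral_Icc_norm_sq_indicator b ht]

theorem integrableOn_norm_sq (hb : MemLp b 2 (volume.restrict (Icc 0 T))) :
    IntegrableOn (fun u => ‖b u‖ ^ 2) (Icc 0 T) :=
  MemLp.integrable_norm_pow (p := 2) hb two_ne_zero

namespace IsWienerIntegral

theorem adapted_doleansExp (hM : IsWienerIntegral hW T b M) {t : ℝ} (ht : t ∈ Icc 0 T) :
    AEStronglyMeasurable[pastSigma W t.toNNReal] (doleansExp T b M t) P :=
  (Real.continuous_exp.comp (continuous_id.sub continuous_const)).comp_aestronglyMeasurable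
    (hM.adapted t ht)

theorem continuousOn_doleansExp (hM : IsWienerIntegral hW T b M)
    (hb : MemLp b 2 (volume.restrict (Icc 0 T))) :
    ∀ᵐ ω ∂P, ContinuousOn (fun t => doleansExp T b M t ω) (Icc 0 T) := by
  filter_upwards [hM.cont] with ω hω
  refine ContinuousOn.congr ?_ fun t ht => doleansExp_eq M ht ω
  exact (hω.sub ((continuousOn_primitive_zero (integrableOn_norm_sq hb)).div_const 2)).rexp

theorem doleansExp_zero (hM : IsWienerIntegral hW T b M) (hT : 0 ≤ T) :
    ∀ᵐ ω ∂P, doleansExp T b M 0 ω = 1 := by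
  have hp := hM.pair 0 ⟨le_rfl, hT⟩
  have h1 := hp.eLpNorm_eq
  rw [Ioc_self, indicator_empty, eLpNorm_zero', eLpNorm_eq_zero_iff hp.memLp_snd.1 two_ne_zero] at h1
  filter_upwards [h1] with ω hω
  rw [doleansExp_eq M ⟨le_rfl, hT⟩, hω]
  simp

end IsWienerIntegral

section

variable {N : ℕ → ℕ} {β : ℕ → ℕ → EuclideanSpace ℝ (Fin d)}

theorem IsGridApprox.exists_wickExp_eq (h : IsGridApprox T b N β) (hW : IsStandardBrownian W P)
    (hT : 0 ≤ T) (n : ℕ) {i : ℕ} (hi : i ≤ N n) :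
    ∃ Z, IsWienerPair hW T ((Ioc 0 (gridTime T (N n) i : ℝ)).indicator (gridStep T (N n) (β n))) Z ∧
      brownianExp W (gridTime T (N n)) (β n) i =
        wickExp T ((Ioc 0 (gridTime T (N n) i : ℝ)).indicator (gridStep T (N n) (β n))) Z := by
  have ht := gridTime_mem_Icc hT hi (h.ne_zero n)
  refine ⟨_, isWienerPair_gridStep hW (N n) (β n) ht, ?_⟩
  rw [← brownianExp_min_eq_wickExp hW (N n) (β n) (half_pow_le_one n) ht
    fun k => h.norm_sq_mul_min_le hT n k _, Real.toNNReal_coe,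
    brownianExp_min_eq (gridTime_mono T (N n)) (β n) hi]

theorem IsGridApprox.memLp_brownianExp (h : IsGridApprox T b N β) (hW : IsStandardBrownian W P)
    (hT : 0 ≤ T) (n i : ℕ) : MemLp (brownianExp W (gridTime T (N n)) (β n) i) 2 P :=
  (brownianExp_sub_sum hW (gridTime_mono T (N n)) (β n) (half_pow_le_one n)
    (h.norm_sq_mul_le hT n) i).1

/-- The elementary integrands which approximate `h N b`, where `N` is the exponential martingale
of `b`. -/
noncomputable def IsGridApprox.elementary (h : IsGridApprox T b N β) (hW : IsStandardBrownian W P)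
    (hT : 0 ≤ T) (g : ℝ → ℝ) (n : ℕ) : ElementaryProcess W P where
  n := N n
  time := gridTime T (N n)
  time_mono := gridTime_mono T (N n)
  ξ i ω := (g (gridTime T (N n) i) * brownianExp W (gridTime T (N n)) (β n) i ω) • β n i
  ξ_adapted i := ((stronglyMeasurable_brownianExp W (gridTime_mono T (N n)) (β n) i
    le_rfl).aestronglyMeasurable.const_mul _).smul_const _
  ξ_sq i := (ContinuousLinearMap.toSpanSingleton ℝ (β n i)).comp_memLp'
    ((h.memLp_brownianExp hW hT n i).const_mul _)

/-- Both the step functions and the truncation points converge, so the truncated integrands converge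
in L², and the exponential is continuous in its integrand. -/
theorem IsGridApprox.tendsto_eLpNorm_brownianExp_sub (h : IsGridApprox T b N β)
    (hT : 0 ≤ T) (hb : MemLp b 2 (volume.restrict (Icc 0 T)))
    (hM : IsWienerIntegral hW T b M) {u : ℝ} (hu : u ∈ Icc 0 T) {i : ℕ → ℕ} (hi : ∀ n, i n < N n)
    (hui : ∀ n, (gridTime T (N n) (i n) : ℝ) ≤ u)
    (hlim : Tendsto (fun n => (gridTime T (N n) (i n) : ℝ)) atTop (𝓝 u)) :
    Tendsto (fun n => eLpNorm (brownianExp W (gridTime T (N n)) (β n) (i n) - doleansExp T b M u) 2 P)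
      atTop (𝓝 0) := by
  choose Z hZ hEZ using fun n => h.exists_wickExp_eq hW hT n (hi n).le
  have h1 : Tendsto (fun n => eLpNorm ((Ioc 0 (gridTime T (N n) (i n) : ℝ)).indicator
      (gridStep T (N n) (β n)) - (Ioc 0 u).indicator b) 2 (volume.restrict (Icc 0 T)))
      atTop (𝓝 0) := by
    have h2 := (tendsto_eLpNorm_indicator_sub h.tendsto
      fun n => Ioc 0 (gridTime T (N n) (i n) : ℝ)).add
      (tendsto_eLpNorm_indicator_Ioc Measure.restrict_le_self hb hui hlim)
    rw [add_zero] at h2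
    refine tendsto_of_tendsto_of_tendsto_of_le_of_le tendsto_const_nhds h2 (fun _ => zero_le)
      fun n => ?_
    have e : (Ioc 0 (gridTime T (N n) (i n) : ℝ)).indicator (gridStep T (N n) (β n))
        - (Ioc 0 u).indicator b = ((Ioc 0 (gridTime T (N n) (i n) : ℝ)).indicator
          (gridStep T (N n) (β n)) - (Ioc 0 (gridTime T (N n) (i n) : ℝ)).indicator b)
        + ((Ioc 0 (gridTime T (N n) (i n) : ℝ)).indicator b - (Ioc 0 u).indicator b) := by abel
    rw [e]
    have hbi : ∀ t : ℝ, AEStronglyMeasurable ((Ioc 0 t).indicator b) (volume.restrict (Icc 0 T)) :=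
      fun t => hb.1.indicator measurableSet_Ioc
    exact eLpNorm_add_le (((stronglyMeasurable_gridStep _ _ _).aestronglyMeasurable.indicator
      measurableSet_Ioc).sub (hbi _)) ((hbi _).sub (hbi _)) one_le_two
  have h2 := IsWienerPair.tendsto_eLpNorm_wickExp_sub hZ (hM.pair u hu) h1
  simp_rw [hEZ]
  exact h2

theorem tendsto_eLpNorm_smul_sub_smul {c : ℕ → ℝ} {c' C : ℝ} {X : ℕ → Ω → ℝ} {Y : Ω → ℝ}
    (hX : ∀ n, MemLp (X n) 2 P) (hY : MemLp Y 2 P) (hc : Tendsto c atTop (𝓝 c'))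
    (hC : ∀ n, ‖c n‖ ≤ C) (hXY : Tendsto (fun n => eLpNorm (X n - Y) 2 P) atTop (𝓝 0)) :
    Tendsto (fun n => eLpNorm (c n • X n - c' • Y) 2 P) atTop (𝓝 0) := by
  have h3 : Tendsto (fun n => ‖c n - c'‖ₑ) atTop (𝓝 0) := by
    have h5 := ENNReal.tendsto_ofReal (tendsto_iff_norm_sub_tendsto_zero.1 hc)
    rw [ENNReal.ofReal_zero] at h5
    exact h5.congr fun n => ofReal_norm _
  have h4 := (ENNReal.Tendsto.const_mul (a := ENNReal.ofReal C) hXY (Or.inr ENNReal.ofReal_ne_top)).add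
    (ENNReal.Tendsto.mul_const (b := eLpNorm Y 2 P) h3 (Or.inr hY.2.ne))
  simp only [mul_zero, zero_mul, add_zero] at h4
  refine tendsto_of_tendsto_of_tendsto_of_le_of_le tendsto_const_nhds h4 (fun _ => zero_le)
    fun n => ?_
  have e : c n • X n - c' • Y = c n • (X n - Y) + (c n - c') • Y := by module
  beta_reduce
  rw [e]
  refine (eLpNorm_add_le (((hX n).1.sub hY.1).const_smul _) (hY.1.const_smul _) one_le_two).trans ?_
  refine add_le_add (eLpNorm_const_smul_le.trans (mul_le_mul' ?_ le_rfl)) eLpNorm_const_smul_le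
  rw [← ofReal_norm]
  exact ENNReal.ofReal_le_ofReal (hC n)

theorem IsGridApprox.val_elementary (h : IsGridApprox T b N β) (hW : IsStandardBrownian W P)
    (hT : 0 ≤ T) (g : ℝ → ℝ) (n : ℕ) (u : ℝ) (ω : Ω) :
    (h.elementary hW hT g n).val u ω = ∑ i ∈ Finset.range (N n),
      (Ioc (gridTime T (N n) i : ℝ) (gridTime T (N n) (i + 1))).indicator
        (fun _ => (g (gridTime T (N n) i) • brownianExp W (gridTime T (N n)) (β n) i) ω • β n i) u :=
  rfl

theorem IsWienerIntegral.aestronglyMeasurable_mul_doleansExp (hT : 0 ≤ T)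
    (hb : MemLp b 2 (volume.restrict (Icc 0 T)))
    (hM : IsWienerIntegral hW T b M) {g : ℝ → ℝ} (hg : ContinuousOn g (Icc 0 T)) :
    AEStronglyMeasurable (fun p : ℝ × Ω => g p.1 * doleansExp T b M p.1 p.2)
      ((volume.restrict (Icc 0 T)).prod P) :=
  (aemeasurable_uncurry_of_ae_continuousOn hT (X := fun t ω => g t * doleansExp T b M t ω)
    (fun _ ht => ((hM.adapted_doleansExp ht).mono (hW.pastSigma_le _)).aemeasurable.const_mul _)
    ((hM.continuousOn_doleansExp hb).mono fun _ hω => hg.mul hω)).aestronglyMeasurable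

/-- The hypotheses of `tendsto_eLpNorm_elementary` hold with the uniform bound K = C e^{B/2}, where
C bounds g and B bounds all the variances. The weight is g = 1 for the martingale itself and the
deterministic factor x e^{∫a} for the solution of the linear equation. -/
theorem IsGridApprox.tendsto_elementary (h : IsGridApprox T b N β)
    (hT : 0 ≤ T) (hb : MemLp b 2 (volume.restrict (Icc 0 T)))
    (hM : IsWienerIntegral hW T b M) {g : ℝ → ℝ} (hg : ContinuousOn g (Icc 0 T)) :
    Tendsto (fun n => eLpNorm (fun p : ℝ × Ω => (h.elementary hW hT g n).val p.1 p.2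
      - (g p.1 * doleansExp T b M p.1 p.2) • b p.1) 2 ((volume.restrict (Icc 0 T)).prod P))
      atTop (𝓝 0) := by
  obtain ⟨B, hB, hBn⟩ := h.exists_bound hb
  obtain ⟨C, hC⟩ := isCompact_Icc.exists_bound_of_continuousOn hg
  have hC0 : 0 ≤ C := (norm_nonneg _).trans (hC 0 ⟨le_rfl, hT⟩)
  have hCe : ∀ t ∈ Icc 0 T, ‖g t‖ₑ ≤ ENNReal.ofReal C := fun t ht => by
    rw [← ofReal_norm]; exact ENNReal.ofReal_le_ofReal (hC t ht)
  have hK : ENNReal.ofReal C * ENNReal.ofReal (Real.exp (B / 2))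
      = ((C * Real.exp (B / 2)).toNNReal : ℝ≥0∞) := by
    rw [← ENNReal.ofReal_mul hC0]; rfl
  have key := tendsto_eLpNorm_elementary (P := P) hT hb h.ne_zero h.tendsto
    (ξ := fun n i => g (gridTime T (N n) i) • brownianExp W (gridTime T (N n)) (β n) i)
    (X := fun u => g u • doleansExp T b M u)
    (fun n i => (h.memLp_brownianExp hW hT n i).1.const_smul _)
    (hM.aestronglyMeasurable_mul_doleansExp hT hb hg)
    (K := (C * Real.exp (B / 2)).toNNReal) ?_ ?_ ?_
  · simp_rw [h.val_elementary]
    exact key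
  · intro n i hi
    obtain ⟨Z, hZ, hEZ⟩ := h.exists_wickExp_eq hW hT n hi
    rw [hEZ, ← hK]
    refine eLpNorm_const_smul_le.trans (mul_le_mul' (hCe _ ?_) ?_)
    · exact gridTime_mem_Icc hT hi (h.ne_zero n)
    · exact hZ.eLpNorm_wickExp_le ((integral_norm_sq_indicator_le (h.memLp_gridStep hb n) _).trans
        (hBn n))
  · intro u hu
    rw [← hK]
    refine eLpNorm_const_smul_le.trans (mul_le_mul' (hCe _ hu) ?_)
    exact (hM.pair u hu).eLpNorm_wickExp_le ((integral_norm_sq_indicator_le hb _).trans hB)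
  · intro u hu i hi hui
    have hu' : u ∈ Icc 0 T := ⟨hu.1.le, hu.2⟩
    have hgrid : ∀ n, (gridTime T (N n) (i n) : ℝ) ∈ Icc 0 T := fun n =>
      gridTime_mem_Icc hT (hi n).le (h.ne_zero n)
    have hlim : Tendsto (fun n => (gridTime T (N n) (i n) : ℝ)) atTop (𝓝 u) := by
      have h0 : Tendsto (fun n : ℕ => u - (1 / 2 : ℝ) ^ n) atTop (𝓝 u) := by
        simpa only [sub_zero] using tendsto_half_pow.const_sub u
      refine tendsto_of_tendsto_of_tendsto_of_le_of_le h0 tendsto_const_nhds (fun n => ?_)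
        fun n => (hui n).1.le
      have h1 := (hui n).2
      rw [coe_gridTime_succ hT] at h1
      have h2 := h.mesh n
      beta_reduce
      linarith
    exact tendsto_eLpNorm_smul_sub_smul (fun n => h.memLp_brownianExp hW hT n (i n))
      (hM.pair u hu').memLp_wickExp
      ((hg u hu').tendsto.comp (tendsto_nhdsWithin_iff.2 ⟨hlim, Eventually.of_forall hgrid⟩))
      (fun n => hC _ (hgrid n))
      (h.tendsto_eLpNorm_brownianExp_sub hT hb hM hu' hi (fun n => (hui n).1.le) hlim)

end

end Existence

/-! ### Existence for the linear equation -/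

section Existence

variable {Ω : Type*} [MeasurableSpace Ω] {d : ℕ} {W : ℝ≥0 → Ω → EuclideanSpace ℝ (Fin d)}
  {P : Measure Ω} [IsProbabilityMeasure P] {T : ℝ} {hW : IsStandardBrownian W P}
  {b : ℝ → EuclideanSpace ℝ (Fin d)} {M : ℝ → Ω → ℝ}

theorem IsGridApprox.integral_elementary {N : ℕ → ℕ} {β : ℕ → ℕ → EuclideanSpace ℝ (Fin d)}
    (h : IsGridApprox T b N β) (hW : IsStandardBrownian W P) (hT : 0 ≤ T) (n : ℕ) (t : ℝ≥0) (ω : Ω) :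
    (h.elementary hW hT (fun _ => 1) n).integral t ω = ∑ i ∈ Finset.range (N n),
      brownianExp W (fun k => min t (gridTime T (N n) k)) (β n) i ω *
        inner ℝ (β n i) (W (min t (gridTime T (N n) (i + 1))) ω
          - W (min t (gridTime T (N n) i)) ω) := by
  refine Finset.sum_congr rfl fun i _ => ?_
  simp only [IsGridApprox.elementary, one_mul, real_inner_smul_left]
  rcases le_total (gridTime T (N n) i) t with h1 | h1
  · rw [brownianExp_min_of_le (gridTime_mono T (N n)) (β n) h1]
  · rw [min_eq_left h1, min_eq_left (h1.trans (gridTime_mono T (N n) i.le_succ)), sub_self,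
      inner_zero_right, mul_zero, mul_zero]

/-- Square integrability on the product space comes for free: the integrand is at finite L² distance
from an elementary one. -/
theorem memLp_mul_doleansExp_smul (hT : 0 ≤ T) (hb : MemLp b 2 (volume.restrict (Icc 0 T)))
    (hM : IsWienerIntegral hW T b M) {g : ℝ → ℝ} (hg : ContinuousOn g (Icc 0 T)) :
    MemLp (fun p : ℝ × Ω => (g p.1 * doleansExp T b M p.1 p.2) • b p.1) 2
      ((volume.restrict (Icc 0 T)).prod P) := by
  obtain ⟨N, β, h⟩ := exists_isGridApprox hT hb
  have h1 := h.tendsto_elementary hT hb hM hg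
  obtain ⟨n, hn⟩ := (h1.eventually (gt_mem_nhds ENNReal.zero_lt_top)).exists
  have hm := hM.aestronglyMeasurable_mul_doleansExp hT hb hg
  have hE : MemLp (fun p : ℝ × Ω => (h.elementary hW hT g n).val p.1 p.2) 2
      ((volume.restrict (Icc 0 T)).prod P) := by
    refine ((ElementaryProcess.isItoPair hW (h.elementary hW hT g n)
      (right_mem_Icc.2 hT)).memLp_fst).ae_eq ?_
    filter_upwards [Measure.quasiMeasurePreserving_fst.ae (ae_mem_Ioc_restrict_Icc T)] with p hp
    rw [upTo_eq_indicator]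
    exact indicator_of_mem (s := Prod.fst ⁻¹' Ioc 0 T) hp _
  have hD : MemLp (fun p : ℝ × Ω => (h.elementary hW hT g n).val p.1 p.2
      - (g p.1 * doleansExp T b M p.1 p.2) • b p.1) 2 ((volume.restrict (Icc 0 T)).prod P) :=
    ⟨hE.1.sub (hm.smul hb.1.comp_fst), hn⟩
  convert! hE.sub hD using 1
  funext p
  simp

/-- `N_t - 1 = ∫₀ᵗ N_u b_u' dW_u` for the exponential martingale `N` of `b`. -/
theorem IsWienerIntegral.isItoPair_doleansExp (hT : 0 ≤ T)
    (hb : MemLp b 2 (volume.restrict (Icc 0 T))) (hM : IsWienerIntegral hW T b M) {t : ℝ}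
    (ht : t ∈ Icc 0 T) :
    IsItoPair W P T (upTo t fun u ω => doleansExp T b M u ω • b u)
      (fun ω => doleansExp T b M t ω - 1) := by
  obtain ⟨N, β, h⟩ := exists_isGridApprox hT hb
  obtain ⟨B, hB, hBn⟩ := h.exists_bound hb
  have h1 := h.tendsto_elementary hT hb hM (g := fun _ => 1) continuousOn_const
  have hmem := memLp_mul_doleansExp_smul hT hb hM (g := fun _ => 1) continuousOn_const
  simp only [one_mul] at h1 hmem
  have hDt := (hM.pair t ht).memLp_wickExp
  refine IsItoPair.of_tendsto_eLpNorm hW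
    (fun n => ElementaryProcess.isItoPair hW (h.elementary hW hT (fun _ => 1) n) ht)
    (memLp_upTo hmem t) ?_ (hDt.sub (memLp_const 1)) ?_
  · exact tendsto_of_tendsto_of_tendsto_of_le_of_le tendsto_const_nhds h1 (fun _ => zero_le)
      fun n => eLpNorm_upTo_sub_le _ _ t
  · set τ : ℕ → ℕ → ℝ≥0 := fun n k => min t.toNNReal (gridTime T (N n) k) with hτ
    have hmono : ∀ n, Monotone (τ n) := fun n i j hij =>
      min_le_min_left _ (gridTime_mono T (N n) hij)
    have hE := fun n => brownianExp_sub_sum hW (hmono n) (β n) (half_pow_le_one n)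
      (fun i => h.norm_sq_mul_min_le hT n i t.toNNReal) (N n)
    have hvar := fun n => brownianVar_min_eq hW (N n) (β n) (half_pow_le_one n) ht
      (fun i => h.norm_sq_mul_min_le hT n i t.toNNReal)
    have hvarB : ∀ n, brownianVar (τ n) (β n) (N n) ≤ B := fun n => (hvar n).trans_le
      ((integral_norm_sq_indicator_le (h.memLp_gridStep hb n) t).trans (hBn n))
    have hB0 : 0 ≤ B := (integral_nonneg fun _ => by positivity).trans hB
    -- The elementary integral misses the step exponential minus 1 by a squared error of order 2⁻ⁿ,
    -- and the step exponentials tend to the limiting one (`hS`); together these give convergence of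
    -- the integrals.
    have hR : Tendsto (fun n => eLpNorm (fun ω => brownianExp W (τ n) (β n) (N n) ω - 1
        - (h.elementary hW hT (fun _ => 1) n).integral t.toNNReal ω) 2 P) atTop (𝓝 0) := by
      refine tendsto_zero_of_sq ?_
      have h2 : Tendsto (fun n : ℕ => ENNReal.ofReal (Real.exp B * ((1 / 2) ^ n * B))) atTop (𝓝 0) := by
        have := ENNReal.tendsto_ofReal ((tendsto_half_pow.mul_const B).const_mul (Real.exp B))
        simpa only [zero_mul, mul_zero, ENNReal.ofReal_zero] using this
      refine tendsto_of_tendsto_of_tendsto_of_le_of_le tendsto_const_nhds h2 (fun _ => zero_le)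
        fun n => ?_
      beta_reduce
      simp_rw [h.integral_elementary hW hT n]
      rw [eLpNorm_two_sq_eq_ofReal (hE n).2.2.2.1]
      simp_rw [Real.norm_eq_abs, sq_abs]
      refine ENNReal.ofReal_le_ofReal ((hE n).2.2.2.2.trans ?_)
      have hv0 : 0 ≤ brownianVar (τ n) (β n) (N n) := by
        rw [hvar n]; exact integral_nonneg fun _ => by positivity
      have := hvarB n
      gcongr
    have hS : Tendsto (fun n => eLpNorm (brownianExp W (τ n) (β n) (N n) - doleansExp T b M t) 2 P)
        atTop (𝓝 0) := by
      have h2 := IsWienerPair.tendsto_eLpNorm_wickExp_sub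
        (fun n => isWienerPair_gridStep hW (N n) (β n) ht) (hM.pair t ht)
        (tendsto_eLpNorm_indicator_sub h.tendsto fun _ => Ioc 0 t)
      refine h2.congr fun n => ?_
      rw [← brownianExp_min_eq_wickExp hW (N n) (β n) (half_pow_le_one n) ht
        (fun i => h.norm_sq_mul_min_le hT n i t.toNNReal)]
      rfl
    have hRS := hS.add hR
    rw [add_zero] at hRS
    refine tendsto_of_tendsto_of_tendsto_of_le_of_le tendsto_const_nhds hRS (fun _ => zero_le)
      fun n => ?_
    have e : ((h.elementary hW hT (fun _ => 1) n).integral t.toNNReal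
        - fun ω => doleansExp T b M t ω - 1)
        = (brownianExp W (τ n) (β n) (N n) - doleansExp T b M t)
          - fun ω => brownianExp W (τ n) (β n) (N n) ω - 1
        - (h.elementary hW hT (fun _ => 1) n).integral t.toNNReal ω := by
      funext ω; simp only [Pi.sub_apply]; ring
    beta_reduce
    rw [e]
    refine eLpNorm_sub_le ((hE n).1.1.sub hDt.1) ?_ one_le_two
    have := (hE n).2.2.2.1.1
    simp_rw [h.integral_elementary hW hT n]
    exact this

variable {a : ℝ → ℝ} {x : ℝ}

/-- The exponential `x exp (∫₀ᵗ a_u du + M_t - ∫₀ᵗ |b_u|² du / 2)`. -/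
noncomputable def linearSDESolution (T x : ℝ) (a : ℝ → ℝ) (b : ℝ → EuclideanSpace ℝ (Fin d))
    (M : ℝ → Ω → ℝ) (t : ℝ) (ω : Ω) : ℝ :=
  x * Real.exp (∫ u in (0 : ℝ)..t, a u) * doleansExp T b M t ω

/-- The candidate is hN with h = x e^{∫a} deterministic and absolutely continuous and N the
exponential martingale. Integration by parts of N - 1 = ∫ N b' dW against h produces both the drift
and the stochastic integral. -/
theorem solvesLinearSDE_linearSDESolution (hT : 0 ≤ T) (ha : IntegrableOn a (Icc 0 T))
    (hb : MemLp b 2 (volume.restrict (Icc 0 T))) (hM : IsWienerIntegral hW T b M) (x : ℝ) :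
    SolvesLinearSDE W P T x a b (linearSDESolution T x a b M) := by
  set h : ℝ → ℝ := fun t => x * Real.exp (∫ u in (0 : ℝ)..t, a u) with hh
  have hhc : ContinuousOn h (Icc 0 T) :=
    continuousOn_const.mul (continuousOn_primitive_zero ha).rexp
  have hh0 : h 0 = x := by simp [hh]
  have hh' : IntegrableOn (fun t => h t * a t) (Icc 0 T) := ha.continuousOn_mul hhc isCompact_Icc
  have hhi : ∀ t ∈ Icc 0 T, h t = h 0 + ∫ u in (0 : ℝ)..t, h u * a u := fun t ht => by
    have h1 : ∀ u, h u * a u = x * (Real.exp (∫ s in (0 : ℝ)..u, a s) * a u) := fun u =>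
      mul_assoc _ _ _
    simp_rw [h1]
    rw [intervalIntegral.integral_const_mul, integral_exp_primitive_mul ha ht, hh0]
    simp only [hh]
    ring
  have hDc := hM.continuousOn_doleansExp hb
  have hYc : ∀ᵐ ω ∂P, ContinuousOn (fun t => linearSDESolution T x a b M t ω) (Icc 0 T) :=
    hDc.mono fun ω hω => hhc.mul hω
  have hpair : ∀ t ∈ Icc 0 T, IsItoPair W P T (upTo t fun u ω => linearSDESolution T x a b M u ω • b u)
      (fun ω => linearSDESolution T x a b M t ω - x
        - ∫ u in (0 : ℝ)..t, linearSDESolution T x a b M u ω * a u) := fun t ht => by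
    have h1 := IsItoPair.integration_by_parts hT hW
      (fun t ht => hM.isItoPair_doleansExp hT hb ht)
      (hDc.mono fun ω hω => hω.sub continuousOn_const) hh' hhi ht
    refine h1.congr (ae_of_all _ fun p => ?_) ?_
    · simp only [upTo, linearSDESolution, hh, smul_smul]
    · filter_upwards [hDc] with ω hω
      have i1 : IntervalIntegrable (fun u => h u * a u) volume 0 t := hh'.intervalIntegrable_zero ht
      have i2 : IntervalIntegrable (fun u => doleansExp T b M u ω * (h u * a u)) volume 0 t :=
        (hh'.continuousOn_mul hω isCompact_Icc).intervalIntegrable_zero ht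
      have e1 : ∀ u, (doleansExp T b M u ω - 1) * (h u * a u)
          = doleansExp T b M u ω * (h u * a u) - h u * a u := fun u => by ring
      have e2 : ∀ u, linearSDESolution T x a b M u ω * a u
          = doleansExp T b M u ω * (h u * a u) := fun u => by
        simp only [linearSDESolution, hh]; ring
      simp_rw [e1, e2]
      rw [intervalIntegral.integral_sub i2 i1]
      have h3 := hhi t ht
      rw [hh0] at h3
      have h4 : linearSDESolution T x a b M t ω = h t * doleansExp T b M t ω := rfl
      rw [h4]
      linear_combination -h3
  have hmem : MemLp (fun p : ℝ × Ω => linearSDESolution T x a b M p.1 p.2 • b p.1) 2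
      ((volume.restrict (Icc 0 T)).prod P) := memLp_mul_doleansExp_smul hT hb hM hhc
  refine ⟨fun t ht => (hM.adapted_doleansExp ht).const_mul _, hYc, ?_, ?_, _,
    ⟨hmem, fun t ht => (hpair t ht).memLp_snd, ?_⟩, ae_of_all _ fun ω t _ => by ring⟩
  · filter_upwards [hM.doleansExp_zero hT] with ω hω
    simp [linearSDESolution, hω]
  · filter_upwards [hYc] with ω hω
    exact ha.continuousOn_mul hω isCompact_Icc
  -- The definition asks for a single sequence of elementary integrands serving all t. Those with
  -- weight h do, since at each t the isometry bounds the error of the integrals by the error of the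
  -- integrands on [0, T].
  · obtain ⟨N, β, hg⟩ := exists_isGridApprox hT hb
    have h1 := hg.tendsto_elementary hT hb hM hhc
    refine ⟨fun n => hg.elementary hW hT h n, h1, fun t ht => ?_⟩
    refine tendsto_of_tendsto_of_tendsto_of_le_of_le tendsto_const_nhds h1 (fun _ => zero_le)
      fun n => ?_
    have h2 := ((ElementaryProcess.isItoPair hW (hg.elementary hW hT h n) ht).sub
      (hpair t ht)).eLpNorm_eq hW
    exact h2.trans_le (eLpNorm_upTo_sub_le _ _ t)

end Existence

/-! ### Uniqueness for the linear equation, and the lognormal law -/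

section Uniqueness

variable {Ω : Type*} [MeasurableSpace Ω] {d : ℕ} {W : ℝ≥0 → Ω → EuclideanSpace ℝ (Fin d)}
  {P : Measure Ω} [IsProbabilityMeasure P] {T : ℝ}
  {b : ℝ → EuclideanSpace ℝ (Fin d)} {M : ℝ → Ω → ℝ}

/-- A continuous solution of `Z_t = ∫₀ᵗ Z_u b_u' dW_u` vanishes. -/
theorem ae_eq_zero_of_isItoPair (hW : IsStandardBrownian W P) (hT : 0 ≤ T)
    (hb : MemLp b 2 (volume.restrict (Icc 0 T))) {Z : ℝ → Ω → ℝ}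
    (hc : ∀ᵐ ω ∂P, ContinuousOn (fun t => Z t ω) (Icc 0 T))
    (hp : ∀ t ∈ Icc 0 T, IsItoPair W P T (upTo t fun u ω => Z u ω • b u) (Z t))
    {t : ℝ} (ht : t ∈ Icc 0 T) : Z t =ᵐ[P] 0 := by
  set μ := volume.restrict (Icc 0 T) with hμ
  have hm : AEStronglyMeasurable (fun p : ℝ × Ω => Z p.1 p.2) (μ.prod P) :=
    (aemeasurable_uncurry_of_ae_continuousOn hT
      (fun t ht => (hp t ht).memLp_snd.1.aemeasurable) hc).aestronglyMeasurable
  obtain ⟨ψ, hψ⟩ : ∃ ψ : ℝ → ℝ≥0∞, ∀ u, ψ u = eLpNorm (Z u) 2 P ^ 2 := ⟨_, fun _ => rfl⟩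
  have hψm : AEMeasurable ψ μ :=
    (aemeasurable_eLpNorm_section_sq hm).congr (ae_of_all _ fun u => (hψ u).symm)
  have hfin : ∀ u ∈ Icc 0 T, ψ u ≠ ∞ := fun u hu => by
    rw [hψ]; exact ENNReal.pow_ne_top (hp u hu).memLp_snd.2.ne
  have hfinae : ∀ᵐ u ∂μ, ψ u ≠ ∞ := by
    filter_upwards [ae_restrict_mem measurableSet_Icc] with u hu using hfin u hu
  have hψb : AEMeasurable (fun u => ψ u * ‖b u‖ₑ ^ 2) μ := hψm.mul (hb.1.enorm.pow_const 2)
  -- By the isometry, ψ(t) = E Z_t² solves ψ(t) = ∫₀ᵗ ψ |b|². The whole integral equals ψ(T), which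
  -- is finite, so ψ is bounded and the homogeneous Grönwall inequality applies.
  have hiso : ∀ t ∈ Icc 0 T, ψ t = ∫⁻ u in Ioc 0 t, ψ u * ‖b u‖ₑ ^ 2 := fun t ht => by
    have e : upTo t (fun u ω => Z u ω • b u) = fun p => Z p.1 p.2 • (Ioc 0 t).indicator b p.1 := by
      funext p
      by_cases h : p.1 ∈ Ioc 0 t <;> simp [upTo, h]
    have h1 := (hp t ht).eLpNorm_eq hW
    rw [e] at h1
    rw [hψ, h1, eLpNorm_smul_comp_fst_sq hm (hb.1.indicator measurableSet_Ioc)]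
    have e2 : ∀ u, eLpNorm (fun ω => Z u ω) 2 P ^ 2 * ‖(Ioc 0 t).indicator b u‖ₑ ^ 2
        = (Ioc 0 t).indicator (fun u => ψ u * ‖b u‖ₑ ^ 2) u := fun u => by
      rw [← hψ]
      by_cases h : u ∈ Ioc 0 t <;> simp [h]
    simp_rw [e2]
    rw [lintegral_indicator measurableSet_Ioc, Measure.restrict_restrict measurableSet_Ioc,
      inter_eq_left.2 (Ioc_subset_Icc_self.trans (Icc_subset_Icc_right ht.2))]
  have htop : ∫⁻ u, ψ u * ‖b u‖ₑ ^ 2 ∂μ ≠ ∞ := by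
    rw [hμ, ← restrict_Ioc_eq_restrict_Icc, ← hiso T ⟨hT, le_rfl⟩]
    exact hfin T ⟨hT, le_rfl⟩
  have hprod : ∀ u, (ψ u * ‖b u‖ₑ ^ 2).toReal = (ψ u).toReal * ‖b u‖ ^ 2 := fun u => by
    rw [ENNReal.toReal_mul, ENNReal.toReal_pow, toReal_enorm]
  have hzero := eq_zero_of_le_integral_mul (T := T) (C := (∫⁻ u, ψ u * ‖b u‖ₑ ^ 2 ∂μ).toReal)
    (φ := fun u => (ψ u).toReal) (integrableOn_norm_sq hb) (fun u => by positivity)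
    (fun u _ => ENNReal.toReal_nonneg) (fun u hu => ?_) ?_ (fun u hu => ?_) t ht
  · have h0 : ψ t = 0 := ((ENNReal.toReal_eq_zero_iff _).1 hzero).resolve_right (hfin t ht)
    rw [hψ] at h0
    exact (eLpNorm_eq_zero_iff (hp t ht).memLp_snd.1 two_ne_zero).1 ((pow_eq_zero_iff two_ne_zero).1 h0)
  · refine ENNReal.toReal_mono htop ?_
    rw [hiso u hu]
    exact lintegral_mono_set (Ioc_subset_Icc_self.trans (Icc_subset_Icc_right hu.2))
  · exact (integrable_toReal_of_lintegral_ne_top hψb htop).congr (ae_of_all _ hprod)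
  · refine le_of_eq ?_
    rw [intervalIntegral.integral_of_le hu.1]
    have hsub : Ioc 0 u ⊆ Icc 0 T := Ioc_subset_Icc_self.trans (Icc_subset_Icc_right hu.2)
    rw [hiso u hu, ← integral_toReal (hψb.mono_measure (Measure.restrict_mono hsub le_rfl))]
    · exact integral_congr_ae (ae_of_all _ hprod)
    · filter_upwards [ae_restrict_of_ae_restrict_of_subset hsub hfinae] with s hs
      exact ENNReal.mul_lt_top hs.lt_top (by finiteness)

/-- The difference of two solutions satisfies D = J + ∫ D a with J = ∫ D b' dW. Multiplication by
e^{-∫a} removes the drift: integration by parts rewrites the stochastic integral, variation of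
constants identifies it, and `ae_eq_zero_of_isItoPair` concludes. -/
theorem SolvesLinearSDE.ae_eq (hW : IsStandardBrownian W P) (hT : 0 ≤ T) {a : ℝ → ℝ} {x : ℝ}
    (ha : IntegrableOn a (Icc 0 T)) (hb : MemLp b 2 (volume.restrict (Icc 0 T)))
    {X X' : ℝ → Ω → ℝ} (h : SolvesLinearSDE W P T x a b X) (h' : SolvesLinearSDE W P T x a b X')
    {t : ℝ} (ht : t ∈ Icc 0 T) : X t =ᵐ[P] X' t := by
  obtain ⟨I, hI, hXI⟩ := h.eqn
  obtain ⟨I', hI', hXI'⟩ := h'.eqn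
  set D : ℝ → Ω → ℝ := fun t ω => X t ω - X' t ω with hD
  set J : ℝ → Ω → ℝ := fun t ω => I t ω - I' t ω with hJ
  have hDc : ∀ᵐ ω ∂P, ContinuousOn (fun t => D t ω) (Icc 0 T) := by
    filter_upwards [h.cont, h'.cont] with ω h1 h2 using h1.sub h2
  have hDJ : ∀ᵐ ω ∂P, ∀ t ∈ Icc 0 T, D t ω = J t ω + ∫ u in (0 : ℝ)..t, D u ω * a u := by
    filter_upwards [hXI, hXI', h.drift_integrable, h'.drift_integrable] with ω h1 h2 h3 h4 t ht
    simp only [hD, hJ, sub_mul]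
    rw [intervalIntegral.integral_sub (h3.intervalIntegrable_zero ht) (h4.intervalIntegrable_zero ht),
      h1 t ht, h2 t ht]
    ring
  have hJc : ∀ᵐ ω ∂P, ContinuousOn (fun t => J t ω) (Icc 0 T) := by
    filter_upwards [hDJ, hDc] with ω h1 h2
    have h3 : ContinuousOn (fun t => D t ω - ∫ u in (0 : ℝ)..t, D u ω * a u) (Icc 0 T) :=
      h2.sub (continuousOn_primitive_zero (ha.continuousOn_mul h2 isCompact_Icc))
    exact h3.congr fun t ht => by beta_reduce; rw [h1 t ht]; ring
  have hpJ : ∀ t ∈ Icc 0 T, IsItoPair W P T (upTo t fun u ω => D u ω • b u) (J t) := fun t ht => by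
    have h1 := (hI.isItoPair hW ht).sub (hI'.isItoPair hW ht)
    rw [← upTo_sub] at h1
    simp_rw [← sub_smul] at h1
    exact h1
  have hna : IntegrableOn (fun u => -a u) (Icc 0 T) := ha.neg
  set g : ℝ → ℝ := fun t => Real.exp (-∫ u in (0 : ℝ)..t, a u) with hg
  have hgc : ContinuousOn g (Icc 0 T) := (continuousOn_primitive_zero ha).neg.rexp
  have hgi : ∀ t ∈ Icc 0 T, g t = g 0 + ∫ u in (0 : ℝ)..t, g u * (-a u) := fun t ht => by
    have := integral_exp_primitive_mul hna ht
    simp only [intervalIntegral.integral_neg] at this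
    simp only [hg]
    rw [this]
    simp
  have hpZ : ∀ t ∈ Icc 0 T, IsItoPair W P T (upTo t fun u ω => (g u * D u ω) • b u)
      (fun ω => g t * D t ω) := fun t ht => by
    have h1 := IsItoPair.integration_by_parts hT hW hpJ hJc (hna.continuousOn_mul hgc isCompact_Icc)
      hgi ht
    refine h1.congr (ae_of_all _ fun p => ?_) ?_
    · simp only [upTo, smul_smul]
    · filter_upwards [hDJ, hDc] with ω h2 h3
      exact (exp_neg_primitive_mul_eq ha h3 h2 ht).symm
  have hZ := ae_eq_zero_of_isItoPair hW hT hb (Z := fun t ω => g t * D t ω)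
    (hDc.mono fun ω hω => hgc.mul hω) hpZ ht
  filter_upwards [hZ] with ω hω
  have h0 : g t ≠ 0 := (Real.exp_pos _).ne'
  have := (mul_eq_zero.1 hω).resolve_left h0
  exact sub_eq_zero.1 this

/-- The linear equation has a solution, and every solution is, at each time, lognormal. -/
theorem exists_solvesLinearSDE (hW : IsStandardBrownian W P) (hT : 0 ≤ T) {a : ℝ → ℝ} (x : ℝ)
    (ha : IntegrableOn a (Icc 0 T)) (hb : MemLp b 2 (volume.restrict (Icc 0 T))) :
    ∃ M, IsWienerIntegral hW T b M ∧ SolvesLinearSDE W P T x a b (linearSDESolution T x a b M) := by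
  obtain ⟨M, h1, h2, h3⟩ := exists_continuous_wienerIntegral hW hT hb
  have hM : IsWienerIntegral hW T b M := ⟨h1, h2, h3⟩
  exact ⟨M, hM, solvesLinearSDE_linearSDESolution hT ha hb hM x⟩

/-- Uniqueness transfers the explicit form to an arbitrary solution; the quantile needs only the law
at each fixed time. -/
theorem SolvesLinearSDE.exists_gaussian (hW : IsStandardBrownian W P) (hT : 0 ≤ T) {a : ℝ → ℝ} {x : ℝ}
    (ha : IntegrableOn a (Icc 0 T)) (hb : MemLp b 2 (volume.restrict (Icc 0 T)))
    {X : ℝ → Ω → ℝ} (h : SolvesLinearSDE W P T x a b X) {t : ℝ} (ht : t ∈ Icc 0 T) :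
    ∃ Z : Ω → ℝ, AEMeasurable Z P ∧
      P.map Z = gaussianReal 0 (∫ u in (0 : ℝ)..t, ‖b u‖ ^ 2).toNNReal ∧
      X t =ᵐ[P] fun ω => x * Real.exp (∫ u in (0 : ℝ)..t, a u)
        * Real.exp (Z ω - (∫ u in (0 : ℝ)..t, ‖b u‖ ^ 2) / 2) := by
  obtain ⟨M, hM, hS⟩ := exists_solvesLinearSDE hW hT x ha hb
  refine ⟨M t, (hM.pair t ht).memLp_snd.1.aemeasurable, ?_, ?_⟩
  · rw [(hM.pair t ht).map_eq_gaussianReal, integral_Icc_norm_sq_indicator b ht]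
  · filter_upwards [h.ae_eq hW hT ha hb hS ht] with ω hω
    rw [hω, linearSDESolution, doleansExp_eq M ht]

end Uniqueness

/-! ### Normal quantiles -/

section Quantile

variable {α : ℝ}

theorem half_le_cdf_gaussianReal_zero : 1 / 2 ≤ cdf (gaussianReal 0 1) 0 := by
  have h1 : (gaussianReal 0 1).real (Iic 0) = (gaussianReal 0 1).real (Ici 0) := by
    have h := gaussianReal_map_neg (μ := 0) (v := 1)
    rw [neg_zero] at h
    conv_lhs => rw [← h]
    rw [map_measureReal_apply measurable_neg measurableSet_Iic]
    congr 1
    ext z; simp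
  have h2 : (1 : ℝ) ≤ (gaussianReal 0 1).real (Iic 0) + (gaussianReal 0 1).real (Ici 0) := by
    rw [← probReal_univ (μ := gaussianReal 0 1), ← Iic_union_Ici (a := (0 : ℝ))]
    exact measureReal_union_le _ _
  rw [cdf_eq_real]
  linarith

/-- The tails of the distribution function make the infimum finite for 0 < α < 1, and its right
continuity makes the infimum attained. -/
theorem normalQuantile_le_iff (hα0 : 0 < α) (hα1 : α < 1) (z : ℝ) :
    normalQuantile α ≤ z ↔ α ≤ cdf (gaussianReal 0 1) z := by
  set F := cdf (gaussianReal 0 1)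
  have hne : {z : ℝ | α ≤ F z}.Nonempty := by
    obtain ⟨z, hz⟩ := ((tendsto_cdf_atTop (gaussianReal 0 1)).eventually (lt_mem_nhds hα1)).exists
    exact ⟨z, hz.le⟩
  have hbdd : BddBelow {z : ℝ | α ≤ F z} := by
    obtain ⟨w, hw⟩ := ((tendsto_cdf_atBot (gaussianReal 0 1)).eventually (gt_mem_nhds hα0)).exists
    refine ⟨w, fun z hz => ?_⟩
    by_contra hlt
    exact absurd (hz.trans (F.mono (not_le.1 hlt).le)) (not_le.2 hw)
  refine ⟨fun h => ?_, fun h => csInf_le hbdd h⟩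
  refine le_trans ?_ (F.mono h)
  have hcont : Tendsto F (𝓝[>] (normalQuantile α)) (𝓝 (F (normalQuantile α))) :=
    (F.right_continuous _).mono_left (nhdsWithin_mono _ Ioi_subset_Ici_self)
  refine ge_of_tendsto hcont ?_
  filter_upwards [self_mem_nhdsWithin] with w hw
  obtain ⟨z, hz, hzw⟩ := exists_lt_of_csInf_lt hne hw
  exact le_trans hz (F.mono hzw.le)

theorem normalQuantile_nonpos (hα0 : 0 < α) (hα : α ≤ 1 / 2) : normalQuantile α ≤ 0 :=
  (normalQuantile_le_iff hα0 (by linarith) 0).2 (hα.trans half_le_cdf_gaussianReal_zero)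

/-- Scaling by √q. The degenerate case q = 0, a point mass at 0, is included because ‖y‖_t may
vanish; both sides then say 0 ≤ c. -/
theorem ofReal_le_gaussianReal_Iic_iff (hα0 : 0 < α) (hα1 : α < 1) {q : ℝ} (hq : 0 ≤ q) (c : ℝ) :
    ENNReal.ofReal α ≤ gaussianReal 0 q.toNNReal (Iic c) ↔ √q * normalQuantile α ≤ c := by
  have hmap : gaussianReal 0 q.toNNReal = (gaussianReal 0 1).map (√q * ·) := by
    rw [gaussianReal_map_const_mul]
    congr 1
    · simp
    · ext; simp [Real.sq_sqrt hq, hq]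
  rw [hmap, Measure.map_apply (measurable_const_mul _) measurableSet_Iic]
  rcases hq.eq_or_lt with h | h
  · subst h
    simp only [Real.sqrt_zero, zero_mul]
    by_cases hc : 0 ≤ c
    · simp [preimage, hc, hα1.le]
    · simp [preimage, hc, hα0]
  · have hs := Real.sqrt_pos.2 h
    have hpre : (√q * ·) ⁻¹' Iic c = Iic (c / √q) := by
      ext z; simp [le_div_iff₀ hs, mul_comm]
    rw [hpre, mul_comm, ← le_div_iff₀ hs, normalQuantile_le_iff hα0 hα1, cdf_eq_real,
      ENNReal.ofReal_le_iff_le_toReal (measure_ne_top _ _)]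
    rfl

end Quantile

/-! ### Quantile, mean and cost of a solution -/

section Law

variable {Ω : Type*} [MeasurableSpace Ω] {d : ℕ} {W : ℝ≥0 → Ω → EuclideanSpace ℝ (Fin d)}
  {P : Measure Ω} [IsProbabilityMeasure P] {T : ℝ}
  {b : ℝ → EuclideanSpace ℝ (Fin d)} {a : ℝ → ℝ} {x α : ℝ} {X : ℝ → Ω → ℝ}

namespace SolvesLinearSDE

/-- Quantiles commute with the increasing map z ↦ x exp(A - n²/2 + z). Levels l ≤ 0 have probability
zero because the solution is almost surely positive, so the restriction l ≥ 0 in the definition has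
no effect. -/
theorem wealthQuantile_eq (hW : IsStandardBrownian W P) (hT : 0 ≤ T) (hx : 0 < x)
    (hα0 : 0 < α) (hα1 : α < 1)
    (ha : IntegrableOn a (Icc 0 T)) (hb : MemLp b 2 (volume.restrict (Icc 0 T)))
    (h : SolvesLinearSDE W P T x a b X) {t : ℝ} (ht : t ∈ Icc 0 T) :
    wealthQuantile P α X t = x * Real.exp ((∫ u in (0 : ℝ)..t, a u)
      - l2norm b t ^ 2 / 2 + l2norm b t * normalQuantile α) := by
  obtain ⟨Z, hZm, hZ, hXZ⟩ := h.exists_gaussian hW hT ha hb ht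
  have hq0 : 0 ≤ ∫ u in (0 : ℝ)..t, ‖b u‖ ^ 2 :=
    intervalIntegral.integral_nonneg ht.1 fun _ _ => by positivity
  have hl : l2norm b t ^ 2 = ∫ u in (0 : ℝ)..t, ‖b u‖ ^ 2 := Real.sq_sqrt hq0
  rw [← hl] at hZ hXZ
  set A := ∫ u in (0 : ℝ)..t, a u
  set n := l2norm b t with hn
  have hn0 : 0 ≤ n := Real.sqrt_nonneg _
  have hset : {l : ℝ | 0 ≤ l ∧ ENNReal.ofReal α ≤ P {ω | X t ω ≤ l}}
      = Ici (x * Real.exp (A - n ^ 2 / 2 + n * normalQuantile α)) := by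
    ext l
    have hP : P {ω | X t ω ≤ l} = P {ω | x * Real.exp A * Real.exp (Z ω - n ^ 2 / 2) ≤ l} := by
      refine measure_congr (eventuallyEq_set.2 ?_)
      filter_upwards [hXZ] with ω hω
      rw [hω]
    simp only [mem_ofPred_eq, mem_Ici]
    rw [hP]
    rcases le_or_gt l 0 with hl0 | hl0
    · have he : {ω | x * Real.exp A * Real.exp (Z ω - n ^ 2 / 2) ≤ l} = ∅ := by
        ext ω
        simp only [mem_ofPred_eq, mem_empty_iff_false, iff_false, not_le]
        exact hl0.trans_lt (by positivity)
      rw [he, measure_empty]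
      have h1 : ¬ (ENNReal.ofReal α ≤ 0) := by simpa using hα0
      have h2 : ¬ (x * Real.exp (A - n ^ 2 / 2 + n * normalQuantile α) ≤ l) :=
        not_le.2 (hl0.trans_lt (by positivity))
      simp [h1, h2]
    · have he : {ω | x * Real.exp A * Real.exp (Z ω - n ^ 2 / 2) ≤ l}
          = Z ⁻¹' Iic (Real.log (l / x) - A + n ^ 2 / 2) := by
        ext ω
        simp only [mem_ofPred_eq, mem_preimage, mem_Iic]
        rw [mul_assoc, ← Real.exp_add, ← le_div_iff₀' hx, ← Real.le_log_iff_exp_le (by positivity)]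
        constructor <;> intro h <;> linarith
      rw [he, ← Measure.map_apply_of_aemeasurable hZm measurableSet_Iic, hZ,
        ofReal_le_gaussianReal_Iic_iff hα0 hα1 (sq_nonneg n), Real.sqrt_sq hn0,
        ← le_div_iff₀' hx, ← Real.le_log_iff_exp_le (by positivity)]
      constructor
      · rintro ⟨-, h⟩; linarith
      · intro h; exact ⟨hl0.le, by linarith⟩
  rw [wealthQuantile, hset, csInf_Ici]

theorem aemeasurable_uncurry (hW : IsStandardBrownian W P) (hT : 0 ≤ T)
    (h : SolvesLinearSDE W P T x a b X) :
    AEMeasurable (fun p : ℝ × Ω => X p.1 p.2) ((volume.restrict (Icc 0 T)).prod P) :=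
  aemeasurable_uncurry_of_ae_continuousOn hT
    (fun t ht => ((h.adapted t ht).mono (hW.pastSigma_le _)).aemeasurable) h.cont

/-- The exponential martingale has mean one, so only the deterministic factor remains. -/
theorem lintegral_ofReal (hW : IsStandardBrownian W P) (hT : 0 ≤ T) (hx : 0 ≤ x)
    (ha : IntegrableOn a (Icc 0 T)) (hb : MemLp b 2 (volume.restrict (Icc 0 T)))
    (h : SolvesLinearSDE W P T x a b X) {t : ℝ} (ht : t ∈ Icc 0 T) :
    ∫⁻ ω, ENNReal.ofReal (X t ω) ∂P = ENNReal.ofReal (x * Real.exp (∫ u in (0 : ℝ)..t, a u)) := by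
  obtain ⟨M, hM, hS⟩ := exists_solvesLinearSDE hW hT x ha hb
  have h1 : (fun ω => ENNReal.ofReal (X t ω)) =ᵐ[P] fun ω =>
      ENNReal.ofReal (linearSDESolution T x a b M t ω) := by
    filter_upwards [h.ae_eq hW hT ha hb hS ht] with ω hω
    rw [hω]
  have h2 : Integrable (linearSDESolution T x a b M t) P :=
    ((hM.pair t ht).memLp_wickExp.integrable one_le_two).const_mul _
  rw [lintegral_congr_ae h1, ← ofReal_integral_eq_lintegral_ofReal h2
    (ae_of_all _ fun ω => by simp only [linearSDESolution, doleansExp, wickExp]; positivity)]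
  congr 1
  simp only [linearSDESolution]
  rw [integral_const_mul]
  have := (hM.pair t ht).integral_wickExp
  simp only [doleansExp]
  rw [this, mul_one]

/-- With linear utilities the cost depends on the process only through its means, by Tonelli's
theorem. -/
theorem cost_eq (hW : IsStandardBrownian W P) (hT : 0 ≤ T) (hx : 0 ≤ x)
    (ha : IntegrableOn a (Icc 0 T)) (hb : MemLp b 2 (volume.restrict (Icc 0 T)))
    (h : SolvesLinearSDE W P T x a b X) {v : ℝ → ℝ} (hv0 : ∀ t ∈ Icc 0 T, 0 ≤ v t)
    (hv : IntegrableOn v (Icc 0 T)) :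
    cost P 1 1 T v X = ENNReal.ofReal (x * ((∫ t in (0 : ℝ)..T,
      v t * Real.exp (∫ u in (0 : ℝ)..t, a u)) + Real.exp (∫ u in (0 : ℝ)..T, a u))) := by
  have hTm : T ∈ Icc 0 T := ⟨hT, le_rfl⟩
  have hXm := h.aemeasurable_uncurry hW hT
  have hXT : AEMeasurable (fun ω => ENNReal.ofReal (X T ω)) P :=
    ((h.adapted T hTm).mono (hW.pastSigma_le _)).aemeasurable.ennreal_ofReal
  have hE : ContinuousOn (fun t => Real.exp (∫ u in (0 : ℝ)..t, a u)) (Icc 0 T) :=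
    (continuousOn_primitive_zero ha).rexp
  have hvE : IntegrableOn (fun t => v t * Real.exp (∫ u in (0 : ℝ)..t, a u)) (Icc 0 T) :=
    hv.mul_continuousOn hE isCompact_Icc
  simp only [cost, powerUtility, Real.rpow_one]
  rw [lintegral_add_right' _ hXT, h.lintegral_ofReal hW hT hx ha hb hTm,
    lintegral_lintegral_swap ?_]
  · have h1 : ∫⁻ t in Icc 0 T, ∫⁻ ω, ENNReal.ofReal (v t * X t ω) ∂P
        = ∫⁻ t in Icc 0 T, ENNReal.ofReal (x * (v t * Real.exp (∫ u in (0 : ℝ)..t, a u))) := by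
      refine setLIntegral_congr_fun measurableSet_Icc fun t ht => ?_
      simp_rw [ENNReal.ofReal_mul (hv0 t ht)]
      rw [lintegral_const_mul' _ _ ENNReal.ofReal_ne_top, h.lintegral_ofReal hW hT hx ha hb ht,
        ← ENNReal.ofReal_mul (hv0 t ht)]
      congr 1; ring
    have hpos : ∀ᵐ t ∂(volume.restrict (Icc 0 T)),
        0 ≤ x * (v t * Real.exp (∫ u in (0 : ℝ)..t, a u)) := by
      filter_upwards [ae_restrict_mem measurableSet_Icc] with t ht
      have := hv0 t ht
      positivity
    rw [h1, ← ofReal_integral_eq_lintegral_ofReal (hvE.const_mul x) hpos,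
      ← ENNReal.ofReal_add (integral_nonneg_of_ae hpos) (by positivity), integral_const_mul,
      integral_Icc_eq_integral_Ioc, ← intervalIntegral.integral_of_le hT, mul_add]
  · have h2 : AEMeasurable (fun p : ℝ × Ω => ENNReal.ofReal (v p.1 * X p.1 p.2))
        ((volume.restrict (Icc 0 T)).prod P) :=
      (hv.aestronglyMeasurable.aemeasurable.comp_fst.mul hXm).ennreal_ofReal
    exact h2.prod_swap

end SolvesLinearSDE

/-- The supremum is taken in `EReal`, so it is at most 1 exactly when every term is; no boundedness
is needed. -/
theorem VaRBound_iff {M : Market d} {ζ : ℝ} (hx : 0 < x) (hζ0 : 0 < ζ)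
    (X : ℝ → Ω → ℝ) : VaRBound M P T x α ζ X ↔ ∀ t ∈ Icc 0 T,
      (1 - ζ) * (x * Real.exp (M.R t)) ≤ wealthQuantile P α X t := by
  unfold VaRBound
  simp only [iSup_le_iff]
  refine forall₂_congr fun t _ => ?_
  have hr : 0 < riskLevel M x ζ t := by unfold riskLevel; positivity
  rw [show (1 : EReal) = ((1 : ℝ) : EReal) from rfl, EReal.coe_le_coe_iff, div_le_one hr]
  unfold valueAtRisk riskLevel
  constructor <;> intro h <;> linarith

end Law

/-! ### Cauchy–Schwarz for ‖·‖_t and its equality case -/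

section L2Norm

variable {d : ℕ} {T t : ℝ} {f g : ℝ → EuclideanSpace ℝ (Fin d)}

theorem l2norm_nonneg (f : ℝ → EuclideanSpace ℝ (Fin d)) (t : ℝ) : 0 ≤ l2norm f t := Real.sqrt_nonneg _

theorem l2norm_sq (f : ℝ → EuclideanSpace ℝ (Fin d)) (ht : 0 ≤ t) :
    l2norm f t ^ 2 = ∫ u in (0 : ℝ)..t, ‖f u‖ ^ 2 :=
  Real.sq_sqrt (intervalIntegral.integral_nonneg ht fun _ _ => by positivity)

theorem l2norm_mono (hf : MemLp f 2 (volume.restrict (Icc 0 T))) (ht : t ∈ Icc 0 T) :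
    l2norm f t ≤ l2norm f T :=
  Real.sqrt_le_sqrt (intervalIntegral.integral_mono_interval le_rfl ht.1 ht.2
    (ae_of_all _ fun _ => by positivity)
    ((integrableOn_norm_sq hf).intervalIntegrable_zero (right_mem_Icc.2 (ht.1.trans ht.2))))

theorem integrableOn_inner (hf : MemLp f 2 (volume.restrict (Icc 0 T)))
    (hg : MemLp g 2 (volume.restrict (Icc 0 T))) :
    IntegrableOn (fun u => inner ℝ (f u) (g u)) (Icc 0 T) :=
  (hf.norm.integrable_mul hg.norm).mono' (hf.1.inner hg.1)
    (ae_of_all _ fun _ => norm_inner_le_norm _ _)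

/-- The square of `‖f - c g‖_t`. -/
theorem integral_norm_sub_smul_sq (hf : MemLp f 2 (volume.restrict (Icc 0 T)))
    (hg : MemLp g 2 (volume.restrict (Icc 0 T))) (ht : t ∈ Icc 0 T) (c : ℝ) :
    ∫ u in (0 : ℝ)..t, ‖f u - c • g u‖ ^ 2
      = l2norm f t ^ 2 - 2 * c * (∫ u in (0 : ℝ)..t, inner ℝ (f u) (g u)) + c ^ 2 * l2norm g t ^ 2 := by
  have e : ∀ u, ‖f u - c • g u‖ ^ 2
      = ‖f u‖ ^ 2 - 2 * c * inner ℝ (f u) (g u) + c ^ 2 * ‖g u‖ ^ 2 := fun u => by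
    rw [norm_sub_sq_real, real_inner_smul_right, norm_smul, mul_pow, Real.norm_eq_abs, sq_abs]
    ring
  have i1 := (integrableOn_norm_sq hf).intervalIntegrable_zero ht
  have i2 := (integrableOn_inner hf hg).intervalIntegrable_zero ht
  have i3 := (integrableOn_norm_sq hg).intervalIntegrable_zero ht
  simp_rw [e]
  rw [intervalIntegral.integral_add (i1.sub (i2.const_mul _)) (i3.const_mul _),
    intervalIntegral.integral_sub i1 (i2.const_mul _), intervalIntegral.integral_const_mul,
    intervalIntegral.integral_const_mul, l2norm_sq f ht.1, l2norm_sq g ht.1]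

/-- The quadratic polynomial c ↦ ‖f - c g‖_t² is nonnegative, so its discriminant is not positive.
-/
theorem integral_inner_le (hf : MemLp f 2 (volume.restrict (Icc 0 T)))
    (hg : MemLp g 2 (volume.restrict (Icc 0 T))) (ht : t ∈ Icc 0 T) :
    ∫ u in (0 : ℝ)..t, inner ℝ (f u) (g u) ≤ l2norm f t * l2norm g t := by
  have key : ∀ c : ℝ, 0 ≤ l2norm f t ^ 2 - 2 * c * (∫ u in (0 : ℝ)..t, inner ℝ (f u) (g u))
      + c ^ 2 * l2norm g t ^ 2 := fun c => by
    rw [← integral_norm_sub_smul_sq hf hg ht c]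
    exact intervalIntegral.integral_nonneg ht.1 fun _ _ => by positivity
  set s := ∫ u in (0 : ℝ)..t, inner ℝ (f u) (g u)
  have h1 := discrim_le_zero (a := l2norm g t ^ 2) (b := -2 * s) (c := l2norm f t ^ 2)
    fun c => by have := key c; linarith
  rw [discrim] at h1
  have h2 : s ^ 2 ≤ (l2norm f t * l2norm g t) ^ 2 := by nlinarith
  exact (le_abs_self s).trans (abs_le_of_sq_le_sq h2
    (mul_nonneg (l2norm_nonneg f t) (l2norm_nonneg g t)))

/-- Equality case of Cauchy–Schwarz: with c = ρ/‖g‖_T, the expansion gives ‖f - c g‖_T² ≤ ρ² - 2ρ² +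
ρ² = 0. -/
theorem ae_eq_smul_of_integral_inner (hf : MemLp f 2 (volume.restrict (Icc 0 T)))
    (hg : MemLp g 2 (volume.restrict (Icc 0 T))) (hT : 0 ≤ T) {ρ : ℝ} (hg0 : 0 < l2norm g T)
    (hρ : l2norm f T ≤ ρ) (h : ρ * l2norm g T ≤ ∫ u in (0 : ℝ)..T, inner ℝ (f u) (g u)) :
    f =ᵐ[volume.restrict (Icc 0 T)] fun u => (ρ / l2norm g T) • g u := by
  have hTm : T ∈ Icc 0 T := ⟨hT, le_rfl⟩
  have h1 := integral_norm_sub_smul_sq hf hg hTm (ρ / l2norm g T)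
  have hρ0 : 0 ≤ ρ := (l2norm_nonneg f T).trans hρ
  have h2 : ∫ u in (0 : ℝ)..T, ‖f u - (ρ / l2norm g T) • g u‖ ^ 2 ≤ 0 := by
    rw [h1]
    have h3 : (ρ / l2norm g T) * (ρ * l2norm g T)
        ≤ (ρ / l2norm g T) * ∫ u in (0 : ℝ)..T, inner ℝ (f u) (g u) := by gcongr
    have h4 : (ρ / l2norm g T) * (ρ * l2norm g T) = ρ ^ 2 := by field_simp
    have h5 : (ρ / l2norm g T) ^ 2 * l2norm g T ^ 2 = ρ ^ 2 := by field_simp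
    have h6 : l2norm f T ^ 2 ≤ ρ ^ 2 := by
      have := l2norm_nonneg f T
      gcongr
    rw [h5]
    linarith
  have h3 : MemLp (fun u => f u - (ρ / l2norm g T) • g u) 2 (volume.restrict (Icc 0 T)) :=
    hf.sub (hg.const_smul (ρ / l2norm g T))
  rw [intervalIntegral.integral_of_le hT, ← integral_Icc_eq_integral_Ioc] at h2
  have h4 := (integral_eq_zero_iff_of_nonneg (fun u => by positivity) (integrableOn_norm_sq h3)).1
    (le_antisymm h2 (integral_nonneg fun _ => by positivity))
  filter_upwards [h4] with u hu
  simpa [sub_eq_zero] using hu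

theorem ae_eq_zero_of_l2norm_eq_zero (hf : MemLp f 2 (volume.restrict (Icc 0 T))) (hT : 0 ≤ T)
    (h : l2norm f T = 0) : f =ᵐ[volume.restrict (Icc 0 T)] 0 := by
  have h2 := l2norm_sq f hT
  rw [h, intervalIntegral.integral_of_le hT, ← integral_Icc_eq_integral_Ioc] at h2
  have h4 := (integral_eq_zero_iff_of_nonneg (fun u => by positivity) (integrableOn_norm_sq hf)).1
    (by simpa using h2.symm)
  filter_upwards [h4] with u hu
  simpa using hu

theorem l2norm_smul (c : ℝ) (g : ℝ → EuclideanSpace ℝ (Fin d)) (t : ℝ) :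
    l2norm (fun u => c • g u) t = |c| * l2norm g t := by
  unfold l2norm
  have e : ∀ u, ‖c • g u‖ ^ 2 = c ^ 2 * ‖g u‖ ^ 2 := fun u => by
    rw [norm_smul, mul_pow, Real.norm_eq_abs, sq_abs]
  simp_rw [e]
  rw [intervalIntegral.integral_const_mul, Real.sqrt_mul (sq_nonneg c), Real.sqrt_sq_eq_abs]

end L2Norm

/-! ### Constraint and cost in terms of the control -/

section Wealth

variable {Ω : Type*} [MeasurableSpace Ω] {d : ℕ} {W : ℝ≥0 → Ω → EuclideanSpace ℝ (Fin d)}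
  {P : Measure Ω} [IsProbabilityMeasure P] {T x α ζ : ℝ} {M : Market d}
  {y : ℝ → EuclideanSpace ℝ (Fin d)} {v : ℝ → ℝ} {X : ℝ → Ω → ℝ}

theorem IsControl.integrableOn_drift (hc : IsControl T y v)
    (hθ : MemLp M.θ 2 (volume.restrict (Icc 0 T))) :
    IntegrableOn (fun t => M.r t - v t + inner ℝ (y t) (M.θ t)) (Icc 0 T) :=
  ((M.r_cadlag.integrableOn T).sub hc.v_int).add (integrableOn_inner hc.y_sq hθ)

theorem IsControl.integral_drift (hc : IsControl T y v)
    (hθ : MemLp M.θ 2 (volume.restrict (Icc 0 T))) {t : ℝ} (ht : t ∈ Icc 0 T) :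
    ∫ u in (0 : ℝ)..t, (M.r u - v u + inner ℝ (y u) (M.θ u))
      = M.R t - (∫ u in (0 : ℝ)..t, v u) + ∫ u in (0 : ℝ)..t, inner ℝ (y u) (M.θ u) := by
  have i1 := (M.r_cadlag.integrableOn T).intervalIntegrable_zero ht
  have i2 := hc.v_int.intervalIntegrable_zero ht
  have i3 := (integrableOn_inner hc.y_sq hθ).intervalIntegrable_zero ht
  rw [intervalIntegral.integral_add (i1.sub i2) i3, intervalIntegral.integral_sub i1 i2]
  rfl

theorem IsControl.exists_isWealth (hW : IsStandardBrownian W P) (hT : 0 ≤ T) (x : ℝ)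
    (hc : IsControl T y v) (hθ : MemLp M.θ 2 (volume.restrict (Icc 0 T))) :
    ∃ X, IsWealth M W P T x y v X := by
  obtain ⟨_, _, h⟩ := exists_solvesLinearSDE hW hT x (hc.integrableOn_drift hθ) hc.y_sq
  exact ⟨_, h⟩

/-- The Value-at-Risk constraint in terms of the control. -/
theorem IsWealth.varBound_iff (hW : IsStandardBrownian W P) (hT : 0 ≤ T) (hx : 0 < x)
    (hα0 : 0 < α) (hα1 : α < 1) (hζ0 : 0 < ζ) (hζ1 : ζ < 1)
    (hθ : MemLp M.θ 2 (volume.restrict (Icc 0 T))) (hc : IsControl T y v)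
    (h : IsWealth M W P T x y v X) :
    VaRBound M P T x α ζ X ↔ ∀ t ∈ Icc 0 T, Real.log (1 - ζ) ≤
      -(∫ u in (0 : ℝ)..t, v u) + (∫ u in (0 : ℝ)..t, inner ℝ (y u) (M.θ u))
        - l2norm y t ^ 2 / 2 + l2norm y t * normalQuantile α := by
  rw [VaRBound_iff hx hζ0]
  refine forall₂_congr fun t ht => ?_
  -- The factor x e^{R_t} is common to the level and the quantile, so the interest rate drops out of
  -- the constraint.
  rw [SolvesLinearSDE.wealthQuantile_eq hW hT hx hα0 hα1 (hc.integrableOn_drift hθ) hc.y_sq h ht,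
    hc.integral_drift hθ ht, mul_left_comm, mul_le_mul_iff_right₀ hx]
  have h1 : 0 < 1 - ζ := by linarith
  conv_lhs => rw [← Real.exp_log h1, ← Real.exp_add, Real.exp_le_exp]
  constructor <;> intro h <;> linarith

theorem IsWealth.cost_eq (hW : IsStandardBrownian W P) (hT : 0 ≤ T) (hx : 0 < x)
    (hθ : MemLp M.θ 2 (volume.restrict (Icc 0 T))) (hc : IsControl T y v)
    (h : IsWealth M W P T x y v X) :
    cost P 1 1 T v X = ENNReal.ofReal (x * ((∫ t in (0 : ℝ)..T,
      v t * Real.exp (M.R t - (∫ u in (0 : ℝ)..t, v u) + ∫ u in (0 : ℝ)..t, inner ℝ (y u) (M.θ u)))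
      + Real.exp (M.R T - (∫ u in (0 : ℝ)..T, v u)
        + ∫ u in (0 : ℝ)..T, inner ℝ (y u) (M.θ u)))) := by
  rw [SolvesLinearSDE.cost_eq hW hT hx.le (hc.integrableOn_drift hθ) hc.y_sq h hc.v_nonneg hc.v_int,
    hc.integral_drift hθ ⟨hT, le_rfl⟩]
  congr 3
  refine intervalIntegral.integral_congr fun t ht => ?_
  rw [uIcc_of_le hT] at ht
  rw [hc.integral_drift hθ ht]

theorem Market.R_mono (hr : ∀ t ∈ Icc 0 T, 0 ≤ M.r t) {t : ℝ} (ht : t ∈ Icc 0 T) :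
    M.R t ≤ M.R T := by
  have hTm : T ∈ Icc 0 T := ⟨ht.1.trans ht.2, le_rfl⟩
  refine intervalIntegral.integral_mono_interval le_rfl ht.1 ht.2 ?_
    ((M.r_cadlag.integrableOn T).intervalIntegrable_zero hTm)
  filter_upwards [ae_restrict_mem measurableSet_Ioc] with u hu
  exact hr u ⟨hu.1.le, hu.2⟩

theorem integral_mul_exp_neg_primitive (hv : IntegrableOn v (Icc 0 T)) (hT : 0 ≤ T) :
    ∫ t in (0 : ℝ)..T, v t * Real.exp (-∫ u in (0 : ℝ)..t, v u)
      = 1 - Real.exp (-∫ u in (0 : ℝ)..T, v u) := by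
  have h := integral_exp_primitive_mul hv.neg (right_mem_Icc.2 hT)
  simp only [Pi.neg_apply, intervalIntegral.integral_neg, mul_neg] at h
  simp_rw [mul_comm (v _)]
  linarith

/-- The consumption part of the cost. -/
theorem IsControl.integral_consumption_le (hc : IsControl T y v) (hT : 0 ≤ T)
    (hθ : MemLp M.θ 2 (volume.restrict (Icc 0 T))) {c : ℝ}
    (h : ∀ t ∈ Icc 0 T, M.R t + (∫ u in (0 : ℝ)..t, inner ℝ (y u) (M.θ u)) ≤ c) :
    ∫ t in (0 : ℝ)..T, v t * Real.exp (M.R t - (∫ u in (0 : ℝ)..t, v u)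
      + ∫ u in (0 : ℝ)..t, inner ℝ (y u) (M.θ u))
      ≤ Real.exp c * (1 - Real.exp (-∫ u in (0 : ℝ)..T, v u)) := by
  have hTm : T ∈ Icc 0 T := ⟨hT, le_rfl⟩
  rw [← integral_mul_exp_neg_primitive hc.v_int hT, ← intervalIntegral.integral_const_mul]
  have c1 := continuousOn_primitive_zero hc.v_int
  have c2 := continuousOn_primitive_zero (M.r_cadlag.integrableOn T)
  have c3 := continuousOn_primitive_zero (integrableOn_inner hc.y_sq hθ)
  refine intervalIntegral.integral_mono_on hT ?_ ?_ fun t ht => ?_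
  · exact (hc.v_int.mul_continuousOn ((c2.sub c1).add c3).rexp
      isCompact_Icc).intervalIntegrable_zero hTm
  · exact (IntegrableOn.intervalIntegrable_zero (hc.v_int.mul_continuousOn c1.neg.rexp
      isCompact_Icc) hTm).const_mul _
  · have hv := hc.v_nonneg t ht
    rw [mul_left_comm, ← Real.exp_add]
    refine mul_le_mul_of_nonneg_left (Real.exp_le_exp.2 ?_) hv
    linarith [h t ht]

end Wealth

/-! ### The root ρ* of the quadratic constraint -/

section Rho

variable {α ζ n : ℝ}

theorem log_one_sub_neg (hζ0 : 0 < ζ) (hζ1 : ζ < 1) : Real.log (1 - ζ) < 0 :=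
  Real.log_neg (by linarith) (by linarith)

theorem rhoVaR_add_sq (hζ0 : 0 < ζ) (hζ1 : ζ < 1) (n : ℝ) :
    (rhoVaR α ζ n + (|normalQuantile α| - n)) ^ 2
      = (|normalQuantile α| - n) ^ 2 - 2 * Real.log (1 - ζ) := by
  have := log_one_sub_neg hζ0 hζ1
  rw [rhoVaR, sub_add_cancel, Real.sq_sqrt (by nlinarith [sq_nonneg (|normalQuantile α| - n)])]

/-- `ρ*` is a root of a quadratic polynomial. -/
theorem rhoVaR_root (hζ0 : 0 < ζ) (hζ1 : ζ < 1) (n : ℝ) :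
    rhoVaR α ζ n ^ 2 / 2 + (|normalQuantile α| - n) * rhoVaR α ζ n = -Real.log (1 - ζ) := by
  have := rhoVaR_add_sq (α := α) hζ0 hζ1 n
  linarith

theorem rhoVaR_pos (hζ0 : 0 < ζ) (hζ1 : ζ < 1) (n : ℝ) : 0 < rhoVaR α ζ n := by
  have := log_one_sub_neg hζ0 hζ1
  refine sub_pos.2 (lt_of_le_of_lt (le_abs_self _) ?_)
  rw [← Real.sqrt_sq_eq_abs]
  exact Real.sqrt_lt_sqrt (sq_nonneg _) (by linarith)

/-- Completing the square bounds (m + |z_α| - n)² by the radicand of ρ*. -/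
theorem le_rhoVaR {m : ℝ} (h : m ^ 2 / 2 + (|normalQuantile α| - n) * m ≤ -Real.log (1 - ζ)) :
    m ≤ rhoVaR α ζ n := by
  rw [rhoVaR, le_sub_iff_add_le]
  exact (le_abs_self _).trans (Real.abs_le_sqrt (by nlinarith))

/-- The lower bound on ζ gives -2 ln(1-ζ) ≥ 2|z_α| n - z_α², so the radicand (|z_α| - n)² - 2
ln(1-ζ) is at least n². -/
theorem two_mul_sub_le_rhoVaR (hζ1 : ζ < 1)
    (h : 1 - Real.exp (normalQuantile α ^ 2 / 2 - |normalQuantile α| * n) ≤ ζ) :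
    2 * n - |normalQuantile α| ≤ rhoVaR α ζ n := by
  have h1 : Real.log (1 - ζ) ≤ normalQuantile α ^ 2 / 2 - |normalQuantile α| * n :=
    (Real.log_le_iff_le_exp (by linarith)).2 (by linarith)
  rw [← sq_abs] at h1
  have h2 : n ≤ √((|normalQuantile α| - n) ^ 2 - 2 * Real.log (1 - ζ)) :=
    Real.le_sqrt_of_sq_le (by nlinarith)
  rw [rhoVaR]
  linarith

end Rho

/-! ### Upper bound, equality case and optimal controls -/

section Optimization

variable {Ω : Type*} [MeasurableSpace Ω] {d : ℕ} {W : ℝ≥0 → Ω → EuclideanSpace ℝ (Fin d)}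
  {P : Measure Ω} [IsProbabilityMeasure P] {T x α ζ : ℝ} {M : Market d}
  {y : ℝ → EuclideanSpace ℝ (Fin d)} {v : ℝ → ℝ} {X : ℝ → Ω → ℝ}

theorem IsControl.zero_consumption (hy : MemLp y 2 (volume.restrict (Icc 0 T))) :
    IsControl T y fun _ => 0 :=
  ⟨hy, fun _ _ => le_rfl, integrableOn_zero⟩

/-- The constraint at the terminal time bounds `‖y‖_T` and the consumption. -/
theorem IsWealth.le_rhoVaR_of_varBound (hW : IsStandardBrownian W P) (hT : 0 ≤ T) (hx : 0 < x)
    (hα0 : 0 < α) (hα : α ≤ 1 / 2) (hζ0 : 0 < ζ) (hζ1 : ζ < 1)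
    (hθ : MemLp M.θ 2 (volume.restrict (Icc 0 T))) (hc : IsControl T y v)
    (h : IsWealth M W P T x y v X) (hb : VaRBound M P T x α ζ X) :
    l2norm y T ≤ rhoVaR α ζ (l2norm M.θ T) ∧
      (∫ u in (0 : ℝ)..T, v u) + l2norm y T ^ 2 / 2 + |normalQuantile α| * l2norm y T
        - (∫ u in (0 : ℝ)..T, inner ℝ (y u) (M.θ u)) ≤ -Real.log (1 - ζ) := by
  have hTm : T ∈ Icc 0 T := ⟨hT, le_rfl⟩
  have h1 := (h.varBound_iff hW hT hx hα0 (by linarith) hζ0 hζ1 hθ hc).1 hb T hTm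
  have h2 := integral_inner_le hc.y_sq hθ hTm
  have h3 : 0 ≤ ∫ u in (0 : ℝ)..T, v u := intervalIntegral.integral_nonneg hT hc.v_nonneg
  have h4 := abs_of_nonpos (normalQuantile_nonpos hα0 hα)
  have h5 : (∫ u in (0 : ℝ)..T, v u) + l2norm y T ^ 2 / 2 + |normalQuantile α| * l2norm y T
        - (∫ u in (0 : ℝ)..T, inner ℝ (y u) (M.θ u)) ≤ -Real.log (1 - ζ) := by
    rw [h4]; linarith
  exact ⟨le_rhoVaR (by nlinarith), h5⟩

/-- The constraint is used at T only; earlier times follow because ‖y‖_t and ‖θ‖_t increase with t.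
-/
theorem IsWealth.integral_inner_le_of_varBound (hW : IsStandardBrownian W P) (hT : 0 ≤ T)
    (hx : 0 < x) (hα0 : 0 < α) (hα : α ≤ 1 / 2) (hζ0 : 0 < ζ) (hζ1 : ζ < 1)
    (hθ : MemLp M.θ 2 (volume.restrict (Icc 0 T))) (hc : IsControl T y v)
    (h : IsWealth M W P T x y v X) (hb : VaRBound M P T x α ζ X) {t : ℝ} (ht : t ∈ Icc 0 T) :
    ∫ u in (0 : ℝ)..t, inner ℝ (y u) (M.θ u) ≤ rhoVaR α ζ (l2norm M.θ T) * l2norm M.θ T :=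
  (integral_inner_le hc.y_sq hθ ht).trans (mul_le_mul ((l2norm_mono hc.y_sq ht).trans
    (h.le_rhoVaR_of_varBound hW hT hx hα0 hα hζ0 hζ1 hθ hc hb).1) (l2norm_mono hθ ht)
    (l2norm_nonneg _ _) (rhoVaR_pos hζ0 hζ1 _).le)

/-- The cost is bounded by its terminal part with the drift of `y` cut at `‖θ‖_T ρ*`. -/
theorem IsWealth.cost_le_sub (hW : IsStandardBrownian W P) (hT : 0 ≤ T) (hx : 0 < x)
    (hα0 : 0 < α) (hα : α ≤ 1 / 2) (hζ0 : 0 < ζ) (hζ1 : ζ < 1)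
    (hθ : MemLp M.θ 2 (volume.restrict (Icc 0 T))) (hr : ∀ t ∈ Icc 0 T, 0 ≤ M.r t)
    (hc : IsControl T y v) (h : IsWealth M W P T x y v X) (hb : VaRBound M P T x α ζ X) :
    cost P 1 1 T v X ≤ ENNReal.ofReal (x * (
      Real.exp (rhoVaR α ζ (l2norm M.θ T) * l2norm M.θ T + M.R T)
      - Real.exp (-∫ u in (0 : ℝ)..T, v u)
        * (Real.exp (rhoVaR α ζ (l2norm M.θ T) * l2norm M.θ T + M.R T)
          - Real.exp ((∫ u in (0 : ℝ)..T, inner ℝ (y u) (M.θ u)) + M.R T)))) := by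
  rw [h.cost_eq hW hT hx hθ hc]
  -- Here r ≥ 0 enters: R_t ≤ R_T gives a bound c for the log-return before consumption that is
  -- uniform in t.
  have h1 := hc.integral_consumption_le hT hθ
    (c := rhoVaR α ζ (l2norm M.θ T) * l2norm M.θ T + M.R T) fun t ht => by
      have := h.integral_inner_le_of_varBound hW hT hx hα0 hα hζ0 hζ1 hθ hc hb ht
      linarith [Market.R_mono hr ht]
  refine ENNReal.ofReal_le_ofReal (mul_le_mul_of_nonneg_left ?_ hx.le)
  have h2 : Real.exp (M.R T - (∫ u in (0 : ℝ)..T, v u) + ∫ u in (0 : ℝ)..T, inner ℝ (y u) (M.θ u))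
      = Real.exp (-∫ u in (0 : ℝ)..T, v u)
        * Real.exp ((∫ u in (0 : ℝ)..T, inner ℝ (y u) (M.θ u)) + M.R T) := by
    rw [← Real.exp_add]; ring_nf
  rw [h2]
  linarith

theorem IsWealth.cost_le (hW : IsStandardBrownian W P) (hT : 0 ≤ T) (hx : 0 < x)
    (hα0 : 0 < α) (hα : α ≤ 1 / 2) (hζ0 : 0 < ζ) (hζ1 : ζ < 1)
    (hθ : MemLp M.θ 2 (volume.restrict (Icc 0 T))) (hr : ∀ t ∈ Icc 0 T, 0 ≤ M.r t)
    (hc : IsControl T y v) (h : IsWealth M W P T x y v X) (hb : VaRBound M P T x α ζ X) :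
    cost P 1 1 T v X ≤ ENNReal.ofReal (x *
      Real.exp (rhoVaR α ζ (l2norm M.θ T) * l2norm M.θ T + M.R T)) := by
  refine (h.cost_le_sub hW hT hx hα0 hα hζ0 hζ1 hθ hr hc hb).trans
    (ENNReal.ofReal_le_ofReal (mul_le_mul_of_nonneg_left (sub_le_self _ ?_) hx.le))
  have h1 := h.integral_inner_le_of_varBound hW hT hx hα0 hα hζ0 hζ1 hθ hc hb
    (right_mem_Icc.2 hT)
  refine mul_nonneg (Real.exp_pos _).le (sub_nonneg.2 (Real.exp_le_exp.2 ?_))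
  linarith

/-- The equality case of the bound of the cost function. -/
theorem IsWealth.ae_eq_of_le_cost (hW : IsStandardBrownian W P) (hT : 0 ≤ T) (hx : 0 < x)
    (hα0 : 0 < α) (hα : α ≤ 1 / 2) (hζ0 : 0 < ζ) (hζ1 : ζ < 1)
    (hθ : MemLp M.θ 2 (volume.restrict (Icc 0 T))) (hθ0 : 0 < l2norm M.θ T)
    (hr : ∀ t ∈ Icc 0 T, 0 ≤ M.r t)
    (hc : IsControl T y v) (h : IsWealth M W P T x y v X) (hb : VaRBound M P T x α ζ X)
    (hcost : ENNReal.ofReal (x * Real.exp (rhoVaR α ζ (l2norm M.θ T) * l2norm M.θ T + M.R T))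
      ≤ cost P 1 1 T v X) :
    y =ᵐ[volume.restrict (Icc 0 T)] optimalY M T α ζ ∧
      v =ᵐ[volume.restrict (Icc 0 T)] fun _ => 0 := by
  set ρ := rhoVaR α ζ (l2norm M.θ T) with hρ
  have hTm : T ∈ Icc 0 T := ⟨hT, le_rfl⟩
  obtain ⟨h1, h2⟩ := h.le_rhoVaR_of_varBound hW hT hx hα0 hα hζ0 hζ1 hθ hc hb
  have h3 := hcost.trans (h.cost_le_sub hW hT hx hα0 hα hζ0 hζ1 hθ hr hc hb)
  -- Otherwise the term subtracted in `IsWealth.cost_le_sub` would be strictly positive, since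
  -- e^{-V_T} > 0, and the cost would fall short of the maximum.
  have hS : ρ * l2norm M.θ T ≤ ∫ u in (0 : ℝ)..T, inner ℝ (y u) (M.θ u) := by
    by_contra hlt
    rw [not_le] at hlt
    refine absurd h3 (not_le.2 ((ENNReal.ofReal_lt_ofReal_iff (by positivity)).2
      (mul_lt_mul_of_pos_left (sub_lt_self _ (mul_pos (Real.exp_pos _) (sub_pos.2
        (Real.exp_lt_exp.2 ?_)))) hx)))
    linarith
  have hy := ae_eq_smul_of_integral_inner hc.y_sq hθ hT hθ0 h1 hS
  refine ⟨hy, ?_⟩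
  have h4 := integral_inner_le hc.y_sq hθ hTm
  -- With ‖y‖_T = ρ* and ∫ y'θ at most ρ*‖θ‖_T, the investment terms of the constraint at T already
  -- use up all of -ln(1-ζ), by the equation for ρ*. So ∫ v ≤ 0.
  have h5 : l2norm y T = ρ := le_antisymm h1 (le_of_mul_le_mul_right (hS.trans h4) hθ0)
  have h6 := rhoVaR_root (α := α) hζ0 hζ1 (l2norm M.θ T)
  rw [← hρ] at h6
  rw [h5] at h2 h4
  have h7 : ∫ u in (0 : ℝ)..T, v u ≤ 0 := by linarith
  rw [intervalIntegral.integral_of_le hT, ← integral_Icc_eq_integral_Ioc] at h7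
  have hv0 : 0 ≤ᵐ[volume.restrict (Icc 0 T)] v := by
    filter_upwards [ae_restrict_mem measurableSet_Icc] with t ht using hc.v_nonneg t ht
  exact (integral_eq_zero_iff_of_nonneg_ae hv0 hc.v_int).1
    (le_antisymm h7 (integral_nonneg_of_ae hv0))

/-- A feasible control without consumption and with maximal drift is optimal. -/
theorem isOptimalControl_of_feasible (hW : IsStandardBrownian W P) (hT : 0 ≤ T) (hx : 0 < x)
    (hα0 : 0 < α) (hα : α ≤ 1 / 2) (hζ0 : 0 < ζ) (hζ1 : ζ < 1)
    (hθ : MemLp M.θ 2 (volume.restrict (Icc 0 T))) (hr : ∀ t ∈ Icc 0 T, 0 ≤ M.r t)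
    (hy : MemLp y 2 (volume.restrict (Icc 0 T)))
    (hfeas : ∀ t ∈ Icc 0 T, l2norm y t ^ 2 / 2 + |normalQuantile α| * l2norm y t
      - (∫ u in (0 : ℝ)..t, inner ℝ (y u) (M.θ u)) ≤ -Real.log (1 - ζ))
    (hS : ∫ u in (0 : ℝ)..T, inner ℝ (y u) (M.θ u)
      = rhoVaR α ζ (l2norm M.θ T) * l2norm M.θ T) :
    IsOptimalControl M W P T x α ζ 1 1 y (fun _ => 0) ∧
    IsGreatest (costValues M W P T x α ζ 1 1) (ENNReal.ofReal
      (x * Real.exp (rhoVaR α ζ (l2norm M.θ T) * l2norm M.θ T + M.R T))) := by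
  have hc : IsControl T y fun _ => 0 := .zero_consumption hy
  have hbound : ∀ X, IsWealth M W P T x y (fun _ => 0) X → VaRBound M P T x α ζ X := fun X h => by
    refine (h.varBound_iff hW hT hx hα0 (by linarith) hζ0 hζ1 hθ hc).2 fun t ht => ?_
    have h1 := hfeas t ht
    have h4 := abs_of_nonpos (normalQuantile_nonpos hα0 hα)
    rw [h4] at h1
    simp only [intervalIntegral.integral_zero]
    linarith
  have hcost : ∀ X, IsWealth M W P T x y (fun _ => 0) X → cost P 1 1 T (fun _ => 0) X =
      ENNReal.ofReal (x * Real.exp (rhoVaR α ζ (l2norm M.θ T) * l2norm M.θ T + M.R T)) :=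
    fun X h => by
      rw [h.cost_eq hW hT hx hθ hc, hS]
      simp only [zero_mul, intervalIntegral.integral_zero, zero_add, sub_zero]
      rw [add_comm]
  obtain ⟨X₀, hX₀⟩ := hc.exists_isWealth hW hT x hθ
  have hgreat : IsGreatest (costValues M W P T x α ζ 1 1) (ENNReal.ofReal
      (x * Real.exp (rhoVaR α ζ (l2norm M.θ T) * l2norm M.θ T + M.R T))) := by
    refine ⟨⟨y, _, X₀, hc, hX₀, hbound X₀ hX₀, (hcost X₀ hX₀).symm⟩, ?_⟩
    rintro _ ⟨y', v', X', hc', hX', hb', rfl⟩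
    exact hX'.cost_le hW hT hx hα0 hα hζ0 hζ1 hθ hr hc' hb'
  exact ⟨⟨hc, ⟨X₀, hX₀⟩, hbound, fun X h => by rw [hcost X h]; exact hgreat⟩, hgreat⟩

theorem isOptimalControl_optimalY (hW : IsStandardBrownian W P) (hT : 0 ≤ T) (hx : 0 < x)
    (hα0 : 0 < α) (hα : α ≤ 1 / 2) (hζ0 : 0 < ζ) (hζ1 : ζ < 1)
    (hζ : 1 - Real.exp (normalQuantile α ^ 2 / 2 - |normalQuantile α| * l2norm M.θ T) ≤ ζ)
    (hθ : MemLp M.θ 2 (volume.restrict (Icc 0 T))) (hθ0 : 0 < l2norm M.θ T)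
    (hr : ∀ t ∈ Icc 0 T, 0 ≤ M.r t) :
    IsOptimalControl M W P T x α ζ 1 1 (optimalY M T α ζ) (fun _ => 0) ∧
    IsGreatest (costValues M W P T x α ζ 1 1) (ENNReal.ofReal
      (x * Real.exp (rhoVaR α ζ (l2norm M.θ T) * l2norm M.θ T + M.R T))) := by
  have hρ0 := rhoVaR_pos (α := α) hζ0 hζ1 (l2norm M.θ T)
  have hroot := rhoVaR_root (α := α) hζ0 hζ1 (l2norm M.θ T)
  have hρζ := two_mul_sub_le_rhoVaR hζ1 hζ
  have hopt : optimalY M T α ζ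
      = fun t => (rhoVaR α ζ (l2norm M.θ T) / l2norm M.θ T) • M.θ t := rfl
  set ρ := rhoVaR α ζ (l2norm M.θ T)
  set z := |normalQuantile α| with hz
  have hz0 : 0 ≤ z := abs_nonneg _
  have hnorm : ∀ t, l2norm (optimalY M T α ζ) t = ρ / l2norm M.θ T * l2norm M.θ t := fun t => by
    rw [hopt, l2norm_smul, abs_of_pos (by positivity)]
  have hinner : ∀ t ∈ Icc 0 T, ∫ u in (0 : ℝ)..t, inner ℝ (optimalY M T α ζ u) (M.θ u)
      = ρ / l2norm M.θ T * l2norm M.θ t ^ 2 := fun t ht => by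
    simp_rw [hopt, real_inner_smul_left, real_inner_self_eq_norm_sq]
    rw [intervalIntegral.integral_const_mul, l2norm_sq _ ht.1]
  refine isOptimalControl_of_feasible hW hT hx hα0 hα hζ0 hζ1 hθ hr (hθ.const_smul (ρ / l2norm M.θ T))
    (fun t ht => ?_) ?_
  · rw [hinner t ht, hnorm t, ← hz, ← hroot]
    obtain ⟨s, hs⟩ : ∃ s, l2norm M.θ t = s * l2norm M.θ T := ⟨l2norm M.θ t / l2norm M.θ T, by field_simp⟩
    have hs0 : 0 ≤ s := nonneg_of_mul_nonneg_left (hs ▸ l2norm_nonneg M.θ t) hθ0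
    have hs1 : s ≤ 1 := le_of_mul_le_mul_right (by rw [← hs, one_mul]; exact l2norm_mono hθ ht) hθ0
    rw [hs]
    set Θ := l2norm M.θ T
    have e1 : ρ / Θ * (s * Θ) = ρ * s := by field_simp
    have e2 : ρ / Θ * (s * Θ) ^ 2 = ρ * Θ * s ^ 2 := by field_simp
    rw [e1, e2]
    -- With s = ‖θ‖_t/‖θ‖_T, the slack of the constraint at t is ρ times this product. The second
    -- factor is affine in s, so it suffices to check s = 0 and s = 1. At s = 1 it is ρ - 2Θ + z ≥
    -- 0, from the lower bound on ζ; at s = 0 it is half of that plus z/2.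
    have key : 0 ≤ (1 - s) * ((ρ / 2 - Θ) * (1 + s) + z) := by
      refine mul_nonneg (by linarith) ?_
      have e3 : (ρ / 2 - Θ) * (1 + s) + z = (1 - s) * (ρ / 2 - Θ + z) + s * (ρ - 2 * Θ + z) := by
        ring
      rw [e3]
      have h1 : 0 ≤ ρ / 2 - Θ + z := by linarith
      have h2 : 0 ≤ ρ - 2 * Θ + z := by linarith
      have h3 : 0 ≤ 1 - s := by linarith
      positivity
    have := mul_nonneg hρ0.le key
    linarith
  · rw [hinner T ⟨hT, le_rfl⟩]
    field_simp
    rfl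

/-- Since θ = 0 almost everywhere, the drift of y vanishes, and the left side of the constraint
increases with ‖y‖_t; at ‖y‖_t = ρ* it equals -ln(1-ζ). -/
theorem isOptimalControl_of_l2norm_eq_zero (hW : IsStandardBrownian W P) (hT : 0 ≤ T) (hx : 0 < x)
    (hα0 : 0 < α) (hα : α ≤ 1 / 2) (hζ0 : 0 < ζ) (hζ1 : ζ < 1)
    (hθ : MemLp M.θ 2 (volume.restrict (Icc 0 T))) (hθ0 : l2norm M.θ T = 0)
    (hr : ∀ t ∈ Icc 0 T, 0 ≤ M.r t) (hy : MemLp y 2 (volume.restrict (Icc 0 T)))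
    (hyρ : l2norm y T ≤ rhoVaR α ζ (l2norm M.θ T)) :
    IsOptimalControl M W P T x α ζ 1 1 y (fun _ => 0) ∧
    IsGreatest (costValues M W P T x α ζ 1 1) (ENNReal.ofReal
      (x * Real.exp (rhoVaR α ζ (l2norm M.θ T) * l2norm M.θ T + M.R T))) := by
  have hroot := rhoVaR_root (α := α) hζ0 hζ1 (l2norm M.θ T)
  have hinner : ∀ t ∈ Icc 0 T, ∫ u in (0 : ℝ)..t, inner ℝ (y u) (M.θ u) = 0 := fun t ht => by
    have h1 := ae_restrict_of_ae_restrict_of_subset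
      (Ioc_subset_Icc_self.trans (Icc_subset_Icc_right ht.2)) (ae_eq_zero_of_l2norm_eq_zero hθ hT hθ0)
    rw [intervalIntegral.integral_of_le ht.1]
    refine integral_eq_zero_of_ae ?_
    filter_upwards [h1] with u hu
    rw [hu]; simp
  refine isOptimalControl_of_feasible hW hT hx hα0 hα hζ0 hζ1 hθ hr hy (fun t ht => ?_) ?_
  · rw [hinner t ht, ← hroot, hθ0, sub_zero, sub_zero]
    rw [hθ0] at hyρ
    have h1 := (l2norm_mono hy ht).trans hyρ
    have h2 := l2norm_nonneg y t
    have h3 := abs_nonneg (normalQuantile α)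
    gcongr
  · rw [hinner T ⟨hT, le_rfl⟩, hθ0, mul_zero]

theorem IsOptimalControl.ae_eq (hW : IsStandardBrownian W P) (hT : 0 ≤ T) (hx : 0 < x)
    (hα0 : 0 < α) (hα : α ≤ 1 / 2) (hζ0 : 0 < ζ) (hζ1 : ζ < 1)
    (hθ : MemLp M.θ 2 (volume.restrict (Icc 0 T))) (hθ0 : 0 < l2norm M.θ T)
    (hr : ∀ t ∈ Icc 0 T, 0 ≤ M.r t)
    (hg : IsGreatest (costValues M W P T x α ζ 1 1) (ENNReal.ofReal
      (x * Real.exp (rhoVaR α ζ (l2norm M.θ T) * l2norm M.θ T + M.R T))))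
    (h : IsOptimalControl M W P T x α ζ 1 1 y v) :
    y =ᵐ[volume.restrict (Icc 0 T)] optimalY M T α ζ ∧
      v =ᵐ[volume.restrict (Icc 0 T)] fun _ => 0 := by
  obtain ⟨X, hX⟩ := h.exists_wealth
  exact hX.ae_eq_of_le_cost hW hT hx hα0 hα hζ0 hζ1 hθ hθ0 hr h.control (h.bound X hX)
    ((h.greatest X hX).2 hg.1)

/-- The rule (σσ')⁻¹ = (σ')⁻¹σ⁻¹ holds for the total matrix inverse without invertibility, so the
identity holds at every t. -/
theorem Market.portfolio_optimalY (M : Market d) (T α ζ t : ℝ) :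
    M.portfolio (optimalY M T α ζ) t = (rhoVaR α ζ (l2norm M.θ T) / l2norm M.θ T) •
      WithLp.toLp 2 ((M.σ t * (M.σ t)ᵀ)⁻¹ *ᵥ (M.excess t).ofLp) := by
  simp only [Market.portfolio, optimalY, Market.θ, WithLp.ofLp_smul, Matrix.mulVec_smul,
    WithLp.toLp_smul, Matrix.mul_inv_rev, ← Matrix.mulVec_mulVec]

/-- The solution depends on the drift only up to null sets. -/
theorem SolvesLinearSDE.congr_drift {a a' : ℝ → ℝ} {b : ℝ → EuclideanSpace ℝ (Fin d)}
    (h : SolvesLinearSDE W P T x a b X) (haa : a =ᵐ[volume.restrict (Icc 0 T)] a') :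
    SolvesLinearSDE W P T x a' b X := by
  have he : ∀ ω, (fun u => X u ω * a u) =ᵐ[volume.restrict (Icc 0 T)] fun u => X u ω * a' u :=
    fun ω => haa.mono fun u hu => by beta_reduce; rw [hu]
  obtain ⟨I, hI, hXI⟩ := h.eqn
  refine ⟨h.adapted, h.cont, h.init, h.drift_integrable.mono fun ω hω => hω.congr (he ω),
    I, hI, hXI.mono fun ω hω t ht => ?_⟩
  rw [hω t ht, intervalIntegral.integral_of_le ht.1, intervalIntegral.integral_of_le ht.1]
  congr 2
  exact integral_congr_ae (ae_restrict_of_ae_restrict_of_subset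
    (Ioc_subset_Icc_self.trans (Icc_subset_Icc_right ht.2)) (he ω))

end Optimization

theorem theorem3p5 {d : ℕ} {Ω : Type*} [MeasurableSpace Ω] (P : Measure Ω) [IsProbabilityMeasure P]
    (W : ℝ≥0 → Ω → EuclideanSpace ℝ (Fin d)) (hW : IsStandardBrownian W P)
    (M : Market d) (T : ℝ) (hT : 0 < T)
    (hθ : MemLp M.θ 2 (volume.restrict (Icc 0 T)))
    (hr : ∀ t ∈ Icc 0 T, 0 ≤ M.r t)
    (x α ζ : ℝ) (hx : 0 < x) (hα0 : 0 < α) (hα : α ≤ 1 / 2)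
    (hζ0 : max 0 (1 - Real.exp (normalQuantile α ^ 2 / 2 - |normalQuantile α| * l2norm M.θ T)) < ζ)
    (hζ1 : ζ < 1) :
    -- the optimal value
    IsGreatest (costValues M W P T x α ζ 1 1)
      (ENNReal.ofReal
        (x * Real.exp (rhoVaR α ζ (l2norm M.θ T) * l2norm M.θ T + M.R T))) ∧
    -- the case `‖θ‖_T > 0`
    (0 < l2norm M.θ T →
      IsOptimalControl M W P T x α ζ 1 1 (optimalY M T α ζ) (fun _ => 0) ∧
      (∀ y v, IsOptimalControl M W P T x α ζ 1 1 y v →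
        y =ᵐ[volume.restrict (Icc 0 T)] optimalY M T α ζ ∧
        v =ᵐ[volume.restrict (Icc 0 T)] fun _ => 0) ∧
      (∀ᵐ t ∂(volume.restrict (Icc 0 T)),
        M.portfolio (optimalY M T α ζ) t =
          (rhoVaR α ζ (l2norm M.θ T) / l2norm M.θ T) •
            WithLp.toLp 2 ((M.σ t * (M.σ t)ᵀ)⁻¹ *ᵥ (M.excess t).ofLp)) ∧
      ∀ X, IsWealth M W P T x (optimalY M T α ζ) (fun _ => 0) X →
        SolvesLinearSDE W P T x
          (fun t => M.r t + rhoVaR α ζ (l2norm M.θ T) * (‖M.θ t‖ ^ 2 / l2norm M.θ T))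
          (fun t => (rhoVaR α ζ (l2norm M.θ T) / l2norm M.θ T) • M.θ t) X) ∧
    -- the case `‖θ‖_T = 0`
    (l2norm M.θ T = 0 →
      rhoVaR α ζ (l2norm M.θ T) =
        √(normalQuantile α ^ 2 - 2 * Real.log (1 - ζ)) - |normalQuantile α| ∧
      IsGreatest (costValues M W P T x α ζ 1 1) (ENNReal.ofReal (x * Real.exp (M.R T))) ∧
      ∀ y : ℝ → EuclideanSpace ℝ (Fin d), MemLp y 2 (volume.restrict (Icc 0 T)) →
        l2norm y T ≤ rhoVaR α ζ (l2norm M.θ T) →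
        IsOptimalControl M W P T x α ζ 1 1 y (fun _ => 0) ∧
        ∀ X, IsWealth M W P T x y (fun _ => 0) X → SolvesLinearSDE W P T x M.r y X) := by
  have hζ0' : 0 < ζ := (le_max_left _ _).trans_lt hζ0
  have hζe := ((le_max_right _ _).trans_lt hζ0).le
  rcases (l2norm_nonneg M.θ T).lt_or_eq with hpos | hzero
  · obtain ⟨hopt, hgr⟩ := isOptimalControl_optimalY hW hT.le hx hα0 hα hζ0' hζ1 hζe hθ hpos hr
    refine ⟨hgr, fun _ => ⟨hopt, fun y v h => h.ae_eq hW hT.le hx hα0 hα hζ0' hζ1 hθ hpos hr hgr,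
      ae_of_all _ fun t => M.portfolio_optimalY T α ζ t, fun X hX => ?_⟩,
      fun h => absurd h hpos.ne'⟩
    refine SolvesLinearSDE.congr_drift hX (ae_of_all _ fun t => ?_)
    simp only [optimalY, real_inner_smul_left, real_inner_self_eq_norm_sq]
    ring
  · have hzero' := hzero.symm
    have key := fun (y : ℝ → EuclideanSpace ℝ (Fin d)) hy hyρ =>
      isOptimalControl_of_l2norm_eq_zero (P := P) (x := x) (α := α) (ζ := ζ) (M := M) (y := y)
        hW hT.le hx hα0 hα hζ0' hζ1 hθ hzero' hr hy hyρ
    -- The control y = 0 is admissible because ρ* > 0, and it already yields the maximum.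
    have hgr := (key (fun _ => 0) MemLp.zero' (by
      simpa [l2norm] using (rhoVaR_pos (α := α) hζ0' hζ1 (l2norm M.θ T)).le)).2
    refine ⟨hgr, fun h => absurd h (by rw [hzero']; exact lt_irrefl _), fun _ => ⟨?_, ?_, ?_⟩⟩
    · rw [rhoVaR, hzero', sub_zero, sq_abs]
    · simpa only [hzero', mul_zero, zero_add] using hgr
    · refine fun y hy hyρ => ⟨(key y hy hyρ).1, fun X hX => ?_⟩
      refine SolvesLinearSDE.congr_drift hX ?_
      filter_upwards [ae_eq_zero_of_l2norm_eq_zero hθ hT.le hzero'] with t ht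
      rw [ht]
      simp
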